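/- Let $n\in\{2,3\}$, $1\le p<\infty$ and $p\le q\le\infty$, and put $\gamma=\frac n2\left(\frac1p-\frac1q\right)$ (with $\frac1\infty=0$). For $\frac n4\le\beta<1$ let $W^{\beta,p}(\mathbb R^n)$ be the space of vector fields $v\in L^p(\mathbb R^n;\mathbb R^n)$ with $$\frac{|v(x)-v(y)|}{|x-y|^{\frac np+\beta}}\in L^p(\mathbb R^n\times\mathbb R^n),$$ and let $\Lambda^\beta=(-\Delta)^{\beta/2}$ be the operator with Fourier symbol $|\xi|^\beta$, applied componentwise and in the sense of distributions; $\|\Lambda^\beta v\|_{L^p}$ is read as $+\infty$ if $\Lambda^\beta v\notin L^p$. For $\alpha>0$, a solution of the Helmholtz equation $u-\alpha^2\Delta u=v$ is a vector field $u\in L^p(\mathbb R^n;\mathbb R^n)$ that satisfies it in the sense of distributions. (1) Suppose $1<p$ and $q<\infty$. There is a constant $C=C(n,p,q)>0$ such that for all $\frac n4\le\beta<1$ with $\gamma<\frac\beta2$, all $v\in W^{\beta,p}(\mathbb R^n)$, all $\alpha\in(0,1)$ and every solution $u$ of $u-\alpha^2\Delta u=v$, $$\|u-v\|_{L^q(\mathbb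 R^n)}\le C\,\alpha^{\frac\beta2-\gamma}\,\|\Lambda^\beta v\|_{L^p(\mathbb R^n)}.$$ If $p=1$ or $q=\infty$, then for each $\frac n4\le\beta<1$ with $\gamma<\frac\beta2$ the same estimate holds with a constant $C=C(n,p,q,\beta)>0$. (2) Let $\frac n4\le\beta<1$ with $\frac1p-\frac1q<\frac\beta n$, let $v\in W^{\beta,p}(\mathbb R^n)$, let $\alpha_i>0$ be a sequence with $\alpha_i\to0$, and let $u_{\alpha_i}$ be solutions of $u_{\alpha_i}-\alpha_i^2\Delta u_{\alpha_i}=v$. Then $v$ and all $u_{\alpha_i}$ belong to $L^q(\mathbb R^n)$, and $u_{\alpha_i}\to v$ strongly in $L^q(\mathbb R^n)$ as $i\to\infty$. -/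

import Mathlib

open MeasureTheory Filter
open scoped ENNReal Topology SchwartzMap FourierTransform Laplacian

noncomputable section

namespace HelmholtzFilter

/-- The space `ℝⁿ` with its Euclidean norm. -/
abbrev Rn (n : ℕ) : Type := EuclideanSpace ℝ (Fin n)

/-- `v ∈ W^{β,p}(ℝⁿ)` for a vector field `v` and `β ∈ (0,1)`, `p ∈ [1,∞)`: `v` is in `L^p(ℝⁿ)` and
`|v(x) - v(y)| / |x - y|^{n/p + β}` is in `L^p(ℝⁿ × ℝⁿ)`. -/
def MemFracSobolev {n : ℕ} (β : ℝ) (p : ℝ≥0∞) (v : Rn n → Rn n) : Prop :=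
  MemLp v p volume ∧
    MemLp (fun z : Rn n × Rn n => ‖v z.1 - v z.2‖ / ‖z.1 - z.2‖ ^ ((n : ℝ) / p.toReal + β))
      p volume

/-- `Λ^β φ = (-Δ)^{β/2} φ` for a Schwartz function `φ`: the Fourier multiplier with symbol `|ξ|^β`.
The transform used here has the kernel `exp (-2πi x·ξ)`, in which `-Δ` has the symbol
`(2π|ξ|)²`, so that `Λ^β` has the symbol `(2π|ξ|)^β`. -/
def lambdaSchwartz {n : ℕ} (β : ℝ) (φ : 𝓢(Rn n, ℂ)) : Rn n → ℂ :=
  𝓕⁻ (fun ξ : Rn n => (((2 * Real.pi * ‖ξ‖) ^ β : ℝ) : ℂ) * 𝓕 (φ : Rn n → ℂ) ξ)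

/-- `Λ^β v = g`, componentwise in the sense of distributions. For `v, g ∈ L^p(ℝⁿ)` both integrands
are integrable, since `Λ^β φ` is bounded and `O(|x|^{-n-β})`. -/
def IsLambda {n : ℕ} (β : ℝ) (v g : Rn n → Rn n) : Prop :=
  ∀ (φ : 𝓢(Rn n, ℂ)) (i : Fin n),
    ∫ x, ((v x i : ℝ) : ℂ) * lambdaSchwartz β φ x = ∫ x, ((g x i : ℝ) : ℂ) * φ x

/-- The extended norm `‖Λ^β v‖_{L^p(ℝⁿ)}`. The function `g ∈ L^p` that represents `Λ^β v` is unique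
up to null sets, and the value is `∞` when `Λ^β v` does not belong to `L^p`. -/
def lambdaNorm {n : ℕ} (β : ℝ) (p : ℝ≥0∞) (v : Rn n → Rn n) : ℝ≥0∞ :=
  ⨅ (g : Rn n → Rn n) (_ : MemLp g p volume ∧ IsLambda β v g), eLpNorm g p volume

/-- `u ∈ L^p(ℝⁿ)` is a weak (distributional) solution of `u - α² Δu = v`. -/
def IsHelmholtzSolution {n : ℕ} (p : ℝ≥0∞) (α : ℝ) (v u : Rn n → Rn n) : Prop :=
  MemLp u p volume ∧
    ∀ (φ : 𝓢(Rn n, ℂ)) (i : Fin n),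
      ∫ x, ((u x i : ℝ) : ℂ) * (φ x - (α : ℂ) ^ 2 * (Δ φ) x) = ∫ x, ((v x i : ℝ) : ℂ) * φ x

/-- The exponent `γ = (n/2) (1/p - 1/q)`, with `1/∞ = 0`. -/
def gammaExp (n : ℕ) (p q : ℝ≥0∞) : ℝ :=
  (n : ℝ) / 2 * ((p⁻¹).toReal - (q⁻¹).toReal)

/-- The estimate `‖u - v‖_{L^q} ≤ C α^{β/2 - γ} ‖Λ^β v‖_{L^p}`, for all `v ∈ W^{β,p}(ℝⁿ)`, all
`α ∈ (0,1)` and all solutions `u` of `u - α² Δu = v`. -/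
def FilterEstimate (n : ℕ) (p q : ℝ≥0∞) (β C : ℝ) : Prop :=
  ∀ (v u : Rn n → Rn n) (α : ℝ), 0 < α → α < 1 →
    MemFracSobolev β p v → IsHelmholtzSolution p α v u →
      eLpNorm (u - v) q volume ≤
        ENNReal.ofReal (C * α ^ (β / 2 - gammaExp n p q)) * lambdaNorm β p v

end HelmholtzFilter

end

/-! Everything is expressed through the heat semigroup `e^{tΔ}`. Since `(1 + α²s)⁻¹ = ∫₀^∞ e^{-r}
e^{-rα²s} dr`, the solution in `L^p` is `u = ∫₀^∞ e^{-r} e^{rα²Δ} v dr`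
(`helmholtz_ae_eq_heatAverage`). As `e^{-r}` has mass 1, `u - v` is an average of `e^{aΔ}v - v` with
`a = rα²`. Hence a bound `‖v - e^{aΔ}v‖_q ≤ B a^δ` for all `a > 0` gives `‖u - v‖_q ≤ 4 B α^{2δ}`
componentwise (`eLpNorm_heatAverage_sub_le`). Here `δ = β/2 - γ`; for `α < 1` the power `α^{2δ}` is
even better than the claimed `α^δ`.

For the estimate in terms of `Λ^β v`, put `b = β/2`. The Laplace transform of `t^{b-1} -
(t-a)_+^{b-1}` shows that `Γ(b)(v - e^{aΔ}v)` is the integral of `e^{tΔ}Λ^β v` against this weight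
(`sub_heat_ae_eq_heatAverage`). For `t > a` the weight has mass at most `a^b/b`, and `e^{tΔ} : L^p →
L^q` has norm at most `a^{-γ}`. For `t ≤ a`, Minkowski's inequality costs a factor `1/(b-γ)`, which
is allowed when the constant may depend on `β`. When `1 < p < q < ∞`, the bound `t^{b-1} ≤ a^{b-γ}
t^{γ-1}` and the Hardy–Littlewood–Sobolev inequality (`exists_eLpNorm_rieszPot_le`) remove that
factor; when `p = q`, `γ = 0` and `b ≥ n/8 ≥ 1/4` suffices.

For strong convergence `Λ^β v` need not lie in `L^p`, and the Gagliardo seminorm is used directly.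
Jensen's inequality and the polynomial decay of the heat kernel give `‖v - e^{tΔ}v‖_p ≤ K t^{β/2}`.
The dyadic differences `e^{tΔ}v - e^{2tΔ}v = e^{tΔ}(v - e^{tΔ}v)` then have `L^q` norm at most `K
t^{β/2-γ}`, and a geometric sum yields the `L^q` bound (`eLpNorm_sub_heat_le_of_rpow`).

The identities are proved on Schwartz functions by Fourier inversion and carried to `L^p` by
duality. -/

noncomputable section

namespace HelmholtzFilter

variable {n : ℕ}

/-! ### Heat kernel and heat semigroup on nonnegative functions -/

/-- The heat kernel of `ℝⁿ` at time `t`. -/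
def heatKernel (t : ℝ) (x : Rn n) : ℝ :=
  (4 * Real.pi * t) ^ (-((n : ℝ) / 2)) * Real.exp (-(4 * t)⁻¹ * ‖x‖ ^ 2)

/-- The heat kernel with values in `ℝ≥0∞`. -/
def lheatKernel (t : ℝ) (x : Rn n) : ℝ≥0∞ := ENNReal.ofReal (heatKernel t x)

/-- The heat semigroup on nonnegative functions. -/
def lheat (t : ℝ) (f : Rn n → ℝ≥0∞) (x : Rn n) : ℝ≥0∞ := ∫⁻ y, lheatKernel t (x - y) * f y

/-- The heat semigroup on complex-valued functions. -/
def heat (t : ℝ) (f : Rn n → ℂ) (x : Rn n) : ℂ := ∫ y, (heatKernel t (x - y) : ℂ) * f y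

lemma heatKernel_nonneg {t : ℝ} (ht : 0 < t) (x : Rn n) : 0 ≤ heatKernel t x := by
  unfold heatKernel; positivity

lemma heatKernel_sub_comm (t : ℝ) (x y : Rn n) : heatKernel t (x - y) = heatKernel t (y - x) := by
  simp [heatKernel, norm_sub_rev]

lemma lheatKernel_sub_comm (t : ℝ) (x y : Rn n) :
    lheatKernel t (x - y) = lheatKernel t (y - x) := by
  simp [lheatKernel, heatKernel_sub_comm]

lemma measurable_heatKernel_uncurry :
    Measurable (fun z : ℝ × Rn n => heatKernel z.1 z.2) := by
  unfold heatKernel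
  fun_prop

@[fun_prop]
lemma measurable_heatKernel {α : Type*} [MeasurableSpace α] {f : α → ℝ} {g : α → Rn n}
    (hf : Measurable f) (hg : Measurable g) : Measurable (fun a => heatKernel (f a) (g a)) :=
  measurable_heatKernel_uncurry.comp (hf.prodMk hg)

@[fun_prop]
lemma measurable_lheatKernel {α : Type*} [MeasurableSpace α] {f : α → ℝ} {g : α → Rn n}
    (hf : Measurable f) (hg : Measurable g) : Measurable (fun a => lheatKernel (f a) (g a)) :=
  (measurable_heatKernel hf hg).ennreal_ofReal

lemma integral_heatKernel {t : ℝ} (ht : 0 < t) : ∫ x : Rn n, heatKernel t x = 1 := by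
  unfold heatKernel
  rw [integral_const_mul, GaussianFourier.integral_rexp_neg_mul_sq_norm (by positivity)]
  have : Real.pi / (4 * t)⁻¹ = 4 * Real.pi * t := by field_simp
  rw [this, finrank_euclideanSpace_fin, ← Real.rpow_add (by positivity)]
  simp

/-- A non-integrable function has Bochner integral 0, whereas this integral is 1. -/
lemma integrable_heatKernel {t : ℝ} (ht : 0 < t) : Integrable (heatKernel t : Rn n → ℝ) := by
  by_contra h
  have := integral_heatKernel (n := n) ht
  rw [integral_undef h] at this
  exact zero_ne_one this

lemma lintegral_lheatKernel {t : ℝ} (ht : 0 < t) : ∫⁻ x : Rn n, lheatKernel t x = 1 := by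
  unfold lheatKernel
  rw [← ofReal_integral_eq_lintegral_ofReal (integrable_heatKernel ht)
    (Eventually.of_forall (heatKernel_nonneg ht)), integral_heatKernel ht, ENNReal.ofReal_one]

lemma lintegral_lheatKernel_sub_left {t : ℝ} (ht : 0 < t) (x : Rn n) :
    ∫⁻ y : Rn n, lheatKernel t (x - y) = 1 := by
  rw [lintegral_sub_left_eq_self (fun y => lheatKernel t y) x, lintegral_lheatKernel ht]

lemma heatKernel_le {t : ℝ} (ht : 0 < t) (x : Rn n) : heatKernel t x ≤ t ^ (-((n : ℝ) / 2)) := by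
  unfold heatKernel
  have h1 : Real.exp (-(4 * t)⁻¹ * ‖x‖ ^ 2) ≤ 1 := by
    apply Real.exp_le_one_iff.2
    have : 0 ≤ (4 * t)⁻¹ * ‖x‖ ^ 2 := by positivity
    linarith
  have h2 : (4 * Real.pi * t) ^ (-((n : ℝ) / 2)) ≤ t ^ (-((n : ℝ) / 2)) := by
    apply Real.rpow_le_rpow_of_nonpos ht
    · nlinarith [Real.pi_gt_three]
    · have : (0 : ℝ) ≤ n := by positivity
      linarith
  calc _ ≤ (4 * Real.pi * t) ^ (-((n : ℝ) / 2)) * 1 := by gcongr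
    _ ≤ _ := by simpa using h2

lemma lheatKernel_le {t : ℝ} (ht : 0 < t) (x : Rn n) :
    lheatKernel t x ≤ ENNReal.ofReal (t ^ (-((n : ℝ) / 2))) :=
  ENNReal.ofReal_le_ofReal (heatKernel_le ht x)

/-- Jensen's inequality for a weight that need not be normalized. -/
lemma lintegral_mul_rpow_le {α : Type*} [MeasurableSpace α] {μ : Measure α} {k f : α → ℝ≥0∞}
    (hk : AEMeasurable k μ) (hf : AEMeasurable f μ) {p : ℝ} (hp : 1 ≤ p) :
    (∫⁻ a, k a * f a ∂μ) ^ p ≤ (∫⁻ a, k a ∂μ) ^ (p - 1) * ∫⁻ a, k a * f a ^ p ∂μ := by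
  rcases hp.eq_or_lt with rfl | hp
  · simp
  have hp0 : 0 < p := by linarith
  have hpq := Real.HolderConjugate.conjExponent hp
  -- Hölder's inequality after writing the weight as `k = k^{1/p'} · k^{1/p}`.
  have key := ENNReal.lintegral_mul_le_Lp_mul_Lq μ hpq.symm
    (f := fun a => k a ^ (1 / p.conjExponent)) (g := fun a => k a ^ (1 / p) * f a)
    (hk.pow_const _) ((hk.pow_const _).mul hf)
  have e0 : 1 / p.conjExponent + 1 / p = 1 := by
    simpa [one_div] using hpq.symm.inv_add_inv_eq_one
  have hq0 : 0 < p.conjExponent := hpq.symm.pos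
  have e1 : ∀ a, ((fun a => k a ^ (1 / p.conjExponent)) * fun a => k a ^ (1 / p) * f a) a
      = k a * f a := by
    intro a
    simp only [Pi.mul_apply]
    rw [← mul_assoc, ← ENNReal.rpow_add_of_nonneg _ _ (by positivity) (by positivity), e0,
      ENNReal.rpow_one]
  simp_rw [e1] at key
  have e2 : ∀ a, (k a ^ (1 / p.conjExponent)) ^ p.conjExponent = k a := by
    intro a
    rw [← ENNReal.rpow_mul, one_div, inv_mul_cancel₀ hq0.ne', ENNReal.rpow_one]
  have e3 : ∀ a, (k a ^ (1 / p) * f a) ^ p = k a * f a ^ p := by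
    intro a
    rw [ENNReal.mul_rpow_of_nonneg _ _ hp0.le, ← ENNReal.rpow_mul, one_div,
      inv_mul_cancel₀ hp0.ne', ENNReal.rpow_one]
  simp_rw [e2, e3] at key
  calc _ ≤ _ := ENNReal.rpow_le_rpow key hp0.le
    _ = _ := by
      rw [ENNReal.mul_rpow_of_nonneg _ _ hp0.le, ← ENNReal.rpow_mul, ← ENNReal.rpow_mul]
      congr 1
      · congr 1
        have : 1 / p.conjExponent = 1 - 1 / p := by linarith
        rw [this]; field_simp
      · rw [one_div, inv_mul_cancel₀ hp0.ne', ENNReal.rpow_one]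

lemma measurable_lheat_uncurry {f : Rn n → ℝ≥0∞} (hf : Measurable f) :
    Measurable (fun z : ℝ × Rn n => lheat z.1 f z.2) := by
  unfold lheat
  apply Measurable.lintegral_prod_right
  fun_prop

@[fun_prop]
lemma measurable_lheat {α : Type*} [MeasurableSpace α] {f : Rn n → ℝ≥0∞} (hf : Measurable f)
    {τ : α → ℝ} {ξ : α → Rn n} (hτ : Measurable τ) (hξ : Measurable ξ) :
    Measurable (fun a => lheat (τ a) f (ξ a)) := by
  have h1 : Measurable (fun a => (τ a, ξ a)) := hτ.prodMk hξ
  have h2 := (measurable_lheat_uncurry hf).comp h1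
  exact h2

lemma lheat_rpow_le {t : ℝ} (ht : 0 < t) {f : Rn n → ℝ≥0∞} (hf : Measurable f) {p : ℝ}
    (hp : 1 ≤ p) (x : Rn n) : lheat t f x ^ p ≤ lheat t (fun y => f y ^ p) x := by
  unfold lheat
  refine (lintegral_mul_rpow_le (by fun_prop) hf.aemeasurable hp).trans ?_
  rw [lintegral_lheatKernel_sub_left ht, ENNReal.one_rpow, one_mul]

/-- The heat semigroup is symmetric. -/
lemma lintegral_mul_lheat (t : ℝ) {f g : Rn n → ℝ≥0∞} (hf : Measurable f) (hg : Measurable g) :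
    ∫⁻ x, g x * lheat t f x = ∫⁻ x, lheat t g x * f x := by
  unfold lheat
  have h1 : ∀ x, g x * ∫⁻ y, lheatKernel t (x - y) * f y
      = ∫⁻ y, g x * (lheatKernel t (x - y) * f y) := fun x =>
    (lintegral_const_mul _ (by fun_prop)).symm
  have h2 : ∀ x, (∫⁻ y, lheatKernel t (x - y) * g y) * f x
      = ∫⁻ y, lheatKernel t (x - y) * g y * f x := fun x =>
    (lintegral_mul_const _ (by fun_prop)).symm
  simp_rw [h1, h2]
  rw [lintegral_lintegral_swap (by fun_prop)]
  refine lintegral_congr fun x => lintegral_congr fun y => ?_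
  rw [lheatKernel_sub_comm]; ring

/-- Symmetry tested against the constant 1, which the semigroup fixes. -/
lemma lintegral_lheat {t : ℝ} (ht : 0 < t) {f : Rn n → ℝ≥0∞} (hf : Measurable f) :
    ∫⁻ x, lheat t f x = ∫⁻ x, f x := by
  have h := lintegral_mul_lheat t hf (g := fun _ => 1) measurable_const
  have : lheat t (fun _ : Rn n => 1) = fun _ => 1 := by
    ext x; simp [lheat, lintegral_lheatKernel_sub_left ht]
  simpa [this] using h

lemma lheat_le_mul_lintegral {t : ℝ} (ht : 0 < t) {f : Rn n → ℝ≥0∞} (hf : Measurable f)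
    (x : Rn n) : lheat t f x ≤ ENNReal.ofReal (t ^ (-((n : ℝ) / 2))) * ∫⁻ y, f y := by
  unfold lheat
  rw [← lintegral_const_mul _ hf]
  exact lintegral_mono fun y => by gcongr; exact lheatKernel_le ht _

lemma lheat_mono (t : ℝ) {f g : Rn n → ℝ≥0∞} (h : ∀ x, f x ≤ g x) (x : Rn n) :
    lheat t f x ≤ lheat t g x :=
  lintegral_mono fun y => by gcongr; exact h y

lemma lheat_const {t : ℝ} (ht : 0 < t) (c : ℝ≥0∞) (x : Rn n) : lheat t (fun _ => c) x = c := by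
  unfold lheat
  rw [lintegral_mul_const _ (by fun_prop), lintegral_lheatKernel_sub_left ht, one_mul]

lemma lheat_add (t : ℝ) {f g : Rn n → ℝ≥0∞} (hf : Measurable f) (x : Rn n) :
    lheat t (fun y => f y + g y) x = lheat t f x + lheat t g x := by
  unfold lheat
  simp_rw [mul_add]
  rw [lintegral_add_left (by fun_prop)]

lemma lheat_const_mul (t : ℝ) {f : Rn n → ℝ≥0∞} (hf : Measurable f) (c : ℝ≥0∞) (x : Rn n) :
    lheat t (fun y => c * f y) x = c * lheat t f x := by
  unfold lheat
  rw [← lintegral_const_mul _ (by fun_prop)]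
  exact lintegral_congr fun y => by ring

/-! ### `L^p → L^q` smoothing of the heat semigroup -/

lemma eLpNorm_eq_lintegral {α : Type*} [MeasurableSpace α] {μ : Measure α} {p : ℝ≥0∞}
    (hp : 1 ≤ p) (hp' : p ≠ ∞) (f : α → ℝ≥0∞) :
    eLpNorm f p μ = (∫⁻ x, f x ^ p.toReal ∂μ) ^ (1 / p.toReal) := by
  rw [eLpNorm_eq_lintegral_rpow_enorm_toReal (by positivity) hp']
  simp

lemma eLpNorm_rpow_eq_lintegral {α : Type*} [MeasurableSpace α] {μ : Measure α} {p : ℝ≥0∞}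
    (hp : 1 ≤ p) (hp' : p ≠ ∞) (f : α → ℝ≥0∞) :
    eLpNorm f p μ ^ p.toReal = ∫⁻ x, f x ^ p.toReal ∂μ := by
  have : 0 < p.toReal := ENNReal.toReal_pos (by positivity) hp'
  rw [eLpNorm_eq_lintegral hp hp', ← ENNReal.rpow_mul, one_div, inv_mul_cancel₀ this.ne',
    ENNReal.rpow_one]

lemma one_le_toReal {p : ℝ≥0∞} (hp : 1 ≤ p) (hp' : p ≠ ∞) : 1 ≤ p.toReal := by
  simpa using ENNReal.toReal_mono hp' hp

/-- Jensen's inequality moves the power `p` inside, the kernel is at most `t^{-n/2}`, and the `p`-th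
root gives `t^{-n/(2p)}`. -/
lemma lheat_le_eLpNorm {t : ℝ} (ht : 0 < t) {p : ℝ≥0∞} (hp : 1 ≤ p) (hp' : p ≠ ∞)
    {f : Rn n → ℝ≥0∞} (hf : Measurable f) (x : Rn n) :
    lheat t f x ≤ ENNReal.ofReal (t ^ (-((n : ℝ) / (2 * p.toReal)))) * eLpNorm f p volume := by
  have hP := one_le_toReal hp hp'
  have hP0 : 0 < p.toReal := by linarith
  rw [← ENNReal.rpow_le_rpow_iff hP0, ENNReal.mul_rpow_of_nonneg _ _ hP0.le,
    eLpNorm_rpow_eq_lintegral hp hp']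
  refine (lheat_rpow_le ht hf hP x).trans ((lheat_le_mul_lintegral ht (by fun_prop) x).trans_eq ?_)
  rw [ENNReal.ofReal_rpow_of_nonneg (by positivity) hP0.le, ← Real.rpow_mul ht.le]
  congr 3
  field_simp

lemma eLpNorm_lheat_le_self {t : ℝ} (ht : 0 < t) {p : ℝ≥0∞} (hp : 1 ≤ p) (hp' : p ≠ ∞)
    {f : Rn n → ℝ≥0∞} (hf : Measurable f) :
    eLpNorm (lheat t f) p volume ≤ eLpNorm f p volume := by
  have hP := one_le_toReal hp hp'
  have hP0 : 0 < p.toReal := by linarith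
  rw [← ENNReal.rpow_le_rpow_iff hP0, eLpNorm_rpow_eq_lintegral hp hp',
    eLpNorm_rpow_eq_lintegral hp hp']
  exact (lintegral_mono fun x => lheat_rpow_le ht hf hP x).trans
    (lintegral_lheat ht (by fun_prop)).le

/-- Interpolation between `L^p` and a uniform bound. -/
lemma eLpNorm_rpow_le_of_le {α : Type*} [MeasurableSpace α] {μ : Measure α} {p q : ℝ≥0∞}
    (hp : 1 ≤ p) (hpq : p ≤ q) (hq : q ≠ ∞) {f : α → ℝ≥0∞} {M : ℝ≥0∞} (hf : Measurable f)
    (hM : ∀ x, f x ≤ M) :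
    eLpNorm f q μ ^ q.toReal ≤ M ^ (q.toReal - p.toReal) * eLpNorm f p μ ^ p.toReal := by
  have hp' : p ≠ ∞ := ne_top_of_le_ne_top hq hpq
  have hP := one_le_toReal hp hp'
  have hPQ : p.toReal ≤ q.toReal := ENNReal.toReal_mono hq hpq
  rw [eLpNorm_rpow_eq_lintegral hp hp', eLpNorm_rpow_eq_lintegral (hp.trans hpq) hq,
    ← lintegral_const_mul _ (by fun_prop)]
  refine lintegral_mono fun x => ?_
  calc f x ^ q.toReal = f x ^ (q.toReal - p.toReal) * f x ^ p.toReal := by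
        rw [← ENNReal.rpow_add_of_nonneg _ _ (by linarith) (by linarith)]; congr 1; ring
    _ ≤ _ := by
      gcongr
      exact hM x

lemma gammaExp_nonneg {p q : ℝ≥0∞} (hp : 1 ≤ p) (hpq : p ≤ q) : 0 ≤ gammaExp n p q := by
  unfold gammaExp
  have : (q⁻¹).toReal ≤ (p⁻¹).toReal :=
    ENNReal.toReal_mono (by simp; positivity) (ENNReal.inv_le_inv.2 hpq)
  have : 0 ≤ (p⁻¹).toReal - (q⁻¹).toReal := by linarith
  positivity

/-- The `L^p → L^q` smoothing estimate of the heat semigroup. -/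
theorem eLpNorm_lheat_le {t : ℝ} (ht : 0 < t) {p q : ℝ≥0∞} (hp : 1 ≤ p) (hp' : p ≠ ∞)
    (hpq : p ≤ q) {f : Rn n → ℝ≥0∞} (hf : Measurable f) :
    eLpNorm (lheat t f) q volume ≤
      ENNReal.ofReal (t ^ (-gammaExp n p q)) * eLpNorm f p volume := by
  have hP := one_le_toReal hp hp'
  rcases eq_or_ne q ∞ with rfl | hq
  · rw [eLpNorm_exponent_top]
    refine essSup_le_of_ae_le _ (Eventually.of_forall fun x => ?_)
    refine (lheat_le_eLpNorm ht hp hp' hf x).trans_eq ?_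
    congr 3
    simp [gammaExp, ENNReal.toReal_inv]
    field_simp
  · have hPQ : p.toReal ≤ q.toReal := ENNReal.toReal_mono hq hpq
    have hQ0 : 0 < q.toReal := by linarith
    -- Interpolation between the `L^p` contraction and the sup bound: the power of `t` is
    -- `-(n/(2p))(1 - p/q) = -γ`.
    rw [← ENNReal.rpow_le_rpow_iff hQ0]
    refine (eLpNorm_rpow_le_of_le hp hpq hq (measurable_lheat hf measurable_const measurable_id) (lheat_le_eLpNorm ht hp hp' hf)).trans ?_
    rw [ENNReal.mul_rpow_of_nonneg _ _ (by linarith), mul_assoc,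
      ENNReal.mul_rpow_of_nonneg _ _ hQ0.le]
    refine mul_le_mul' (le_of_eq ?_) ?_
    · rw [ENNReal.ofReal_rpow_of_nonneg (by positivity) (by linarith),
        ENNReal.ofReal_rpow_of_nonneg (by positivity) (by linarith), ← Real.rpow_mul ht.le,
        ← Real.rpow_mul ht.le]
      congr 2
      simp only [gammaExp, ENNReal.toReal_inv]
      field_simp
    · calc _ ≤ eLpNorm f p volume ^ (q.toReal - p.toReal) * eLpNorm f p volume ^ p.toReal := by
            gcongr
            exact eLpNorm_lheat_le_self ht hp hp' hf
        _ = _ := by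
          rw [← ENNReal.rpow_add_of_nonneg _ _ (by linarith) (by linarith)]; congr 1; ring

/-! ### Minkowski's integral inequality -/

/-- For finite `q`, Jensen's inequality with weight `w b` applied to `F/b`, followed by Tonelli;
this is why `b` must be neither 0 nor `∞`. For `q = ∞` the two almost-everywhere quantifiers are
exchanged. -/
lemma eLpNorm_lintegral_le_of_ne_zero {α T : Type*} [MeasurableSpace α] [MeasurableSpace T]
    {μ : Measure T} {ν : Measure α} [SFinite μ] [SFinite ν] {q : ℝ≥0∞} (hq : 1 ≤ q)
    {w b : T → ℝ≥0∞} {F : T → α → ℝ≥0∞} (hw : Measurable w) (hb : Measurable b)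
    (hF : Measurable (Function.uncurry F)) (hb0 : ∀ t, b t ≠ 0) (hbtop : ∀ t, b t ≠ ∞)
    (h : ∀ᵐ t ∂μ, eLpNorm (F t) q ν ≤ b t) :
    eLpNorm (fun x => ∫⁻ t, w t * F t x ∂μ) q ν ≤ ∫⁻ t, w t * b t ∂μ := by
  rcases eq_or_ne q ∞ with rfl | hq'
  · have h1 : ∀ᵐ t ∂μ, ∀ᵐ x ∂ν, F t x ≤ b t := by
      filter_upwards [h] with t ht
      rw [eLpNorm_exponent_top] at ht
      filter_upwards [ae_le_eLpNormEssSup (f := F t) (μ := ν)] with x hx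
      exact (by simpa using hx : F t x ≤ _).trans ht
    have hms : MeasurableSet {z : α × T | F z.2 z.1 ≤ b z.2} :=
      measurableSet_le (hF.comp measurable_swap) (hb.comp measurable_snd)
    have h2 : ∀ᵐ x ∂ν, ∀ᵐ t ∂μ, F t x ≤ b t := (Measure.ae_ae_comm hms).2 h1
    rw [eLpNorm_exponent_top]
    refine essSup_le_of_ae_le _ ?_
    filter_upwards [h2] with x hx
    simp only [enorm_eq_self]
    refine lintegral_mono_ae ?_
    filter_upwards [hx] with t ht
    gcongr
  · have hQ := one_le_toReal hq hq'
    have hQ0 : 0 < q.toReal := by linarith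
    rw [← ENNReal.rpow_le_rpow_iff hQ0, eLpNorm_rpow_eq_lintegral hq hq']
    have hFx : ∀ x, Measurable fun t => F t x := fun x => hF.comp measurable_prodMk_right
    have hFt : ∀ t, Measurable (F t) := fun t => hF.comp measurable_prodMk_left
    have e1 : ∀ x, (∫⁻ t, w t * F t x ∂μ) = ∫⁻ t, (w t * b t) * (F t x / b t) ∂μ := by
      intro x
      refine lintegral_congr fun t => ?_
      rw [mul_assoc, ENNReal.mul_div_cancel (hb0 t) (hbtop t)]
    calc ∫⁻ x, (∫⁻ t, w t * F t x ∂μ) ^ q.toReal ∂ν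
        ≤ ∫⁻ x, (∫⁻ t, w t * b t ∂μ) ^ (q.toReal - 1) *
            ∫⁻ t, w t * b t * (F t x / b t) ^ q.toReal ∂μ ∂ν := by
          refine lintegral_mono fun x => ?_
          rw [e1]
          exact lintegral_mul_rpow_le (hw.mul hb).aemeasurable ((hFx x).div hb).aemeasurable hQ
      _ = (∫⁻ t, w t * b t ∂μ) ^ (q.toReal - 1) *
            ∫⁻ x, ∫⁻ t, w t * b t * (F t x / b t) ^ q.toReal ∂μ ∂ν := by
          rw [lintegral_const_mul]
          apply Measurable.lintegral_prod_right
          have : Measurable fun z : α × T => F z.2 z.1 := hF.comp measurable_swap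
          fun_prop
      _ = (∫⁻ t, w t * b t ∂μ) ^ (q.toReal - 1) *
            ∫⁻ t, ∫⁻ x, w t * b t * (F t x / b t) ^ q.toReal ∂ν ∂μ := by
          rw [lintegral_lintegral_swap]
          have : Measurable fun z : α × T => F z.2 z.1 := hF.comp measurable_swap
          apply Measurable.aemeasurable
          simp only [Function.uncurry_def]
          fun_prop
      _ ≤ (∫⁻ t, w t * b t ∂μ) ^ (q.toReal - 1) * ∫⁻ t, w t * b t ∂μ := by
          refine mul_le_mul' le_rfl ?_
          refine lintegral_mono_ae ?_
          filter_upwards [h] with t ht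
          have hFt' := hFt t
          rw [lintegral_const_mul _ (by fun_prop)]
          have : ∫⁻ x, (F t x / b t) ^ q.toReal ∂ν ≤ 1 := by
            have e2 : ∀ x, (F t x / b t) ^ q.toReal = (b t ^ q.toReal)⁻¹ * F t x ^ q.toReal := by
              intro x
              rw [ENNReal.div_rpow_of_nonneg _ _ hQ0.le, div_eq_mul_inv, mul_comm]
            simp_rw [e2]
            rw [lintegral_const_mul _ (by fun_prop), ← eLpNorm_rpow_eq_lintegral hq hq']
            calc _ ≤ (b t ^ q.toReal)⁻¹ * b t ^ q.toReal := by gcongr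
              _ ≤ 1 := ENNReal.inv_mul_le_one _
          calc _ ≤ w t * b t * 1 := by gcongr
            _ = _ := mul_one _
      _ = _ := by
          nth_rewrite 2 [← ENNReal.rpow_one (∫⁻ t, w t * b t ∂μ)]
          rw [← ENNReal.rpow_add_of_nonneg _ _ (by linarith) (by norm_num)]
          congr 1; ring

/-- Minkowski's integral inequality, with a finite weight and pointwise finite bounds. -/
theorem eLpNorm_lintegral_le {α T : Type*} [MeasurableSpace α] [MeasurableSpace T]
    {μ : Measure T} {ν : Measure α} [SFinite μ] [SFinite ν] {q : ℝ≥0∞} (hq : 1 ≤ q)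
    {w b : T → ℝ≥0∞} {F : T → α → ℝ≥0∞} (hw : Measurable w) (hb : Measurable b)
    (hF : Measurable (Function.uncurry F)) (hbtop : ∀ t, b t ≠ ∞) (hwtop : ∫⁻ t, w t ∂μ ≠ ∞)
    (h : ∀ᵐ t ∂μ, eLpNorm (F t) q ν ≤ b t) :
    eLpNorm (fun x => ∫⁻ t, w t * F t x ∂μ) q ν ≤ ∫⁻ t, w t * b t ∂μ := by
  -- Zeros of `b` are removed by adding `ε`; the error `ε ∫ w` vanishes as `ε → 0` because `w` has
  -- finite mass.
  have key : ∀ ε : ℝ≥0∞, ε ≠ 0 → ε ≠ ∞ → eLpNorm (fun x => ∫⁻ t, w t * F t x ∂μ) q ν ≤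
      (∫⁻ t, w t * b t ∂μ) + (∫⁻ t, w t ∂μ) * ε := by
    intro ε h0 h1
    have := eLpNorm_lintegral_le_of_ne_zero (b := fun t => b t + ε) hq hw (by fun_prop) hF
      (fun t => by simp [h0]) (fun t => by simp [h1, hbtop t])
      (h.mono fun t ht => ht.trans le_self_add)
    simp_rw [mul_add] at this
    rwa [lintegral_add_right _ (by fun_prop), lintegral_mul_const _ hw] at this
  have hlim : Tendsto (fun ε : ℝ≥0∞ => (∫⁻ t, w t * b t ∂μ) + (∫⁻ t, w t ∂μ) * ε) (𝓝[>] 0)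
      (𝓝 ((∫⁻ t, w t * b t ∂μ) + (∫⁻ t, w t ∂μ) * 0)) := by
    apply Tendsto.mono_left _ nhdsWithin_le_nhds
    exact tendsto_const_nhds.add (ENNReal.Tendsto.const_mul tendsto_id (Or.inr hwtop))
  rw [mul_zero, add_zero] at hlim
  refine ge_of_tendsto hlim ?_
  have : ∀ᶠ ε : ℝ≥0∞ in 𝓝[>] 0, ε < 1 :=
    (eventually_lt_nhds one_pos).filter_mono nhdsWithin_le_nhds
  filter_upwards [this, self_mem_nhdsWithin] with ε h1 h2
  exact key ε (ne_of_gt h2) (h1.trans ENNReal.one_lt_top).ne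

/-! ### Riesz potentials and the Hardy–Littlewood–Sobolev inequality -/

/-- `∫_{0 < s < y} s^(a-1) ds = y^a / a`, also for `y = ∞`. -/
lemma lintegral_rpow_indicator {a : ℝ} (ha : 0 < a) (y : ℝ≥0∞) :
    ∫⁻ s in Set.Ioi (0 : ℝ), {s : ℝ | ENNReal.ofReal s < y}.indicator
      (fun s => ENNReal.ofReal (s ^ (a - 1))) s = ENNReal.ofReal a⁻¹ * y ^ a := by
  have fin : ∀ r : ℝ, 0 ≤ r → ∫⁻ s in Set.Ioo (0 : ℝ) r, ENNReal.ofReal (s ^ (a - 1))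
      = ENNReal.ofReal a⁻¹ * ENNReal.ofReal r ^ a := by
    intro r hr
    have hint : IntegrableOn (fun s : ℝ => s ^ (a - 1)) (Set.Ioc 0 r) := by
      rw [← intervalIntegrable_iff_integrableOn_Ioc_of_le hr]
      exact intervalIntegral.intervalIntegrable_rpow' (by linarith)
    rw [setLIntegral_congr Ioo_ae_eq_Ioc, ← ofReal_integral_eq_lintegral_ofReal hint,
      ← intervalIntegral.integral_of_le hr, integral_rpow (Or.inl (by linarith)),
      ENNReal.ofReal_rpow_of_nonneg hr ha.le, ← ENNReal.ofReal_mul (by positivity)]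
    · congr 1
      rw [sub_add_cancel, Real.zero_rpow ha.ne']; field_simp; ring
    · filter_upwards [ae_restrict_mem measurableSet_Ioc] with s hs
      exact Real.rpow_nonneg hs.1.le _
  have hm : MeasurableSet {s : ℝ | ENNReal.ofReal s < y} :=
    measurableSet_lt ENNReal.measurable_ofReal measurable_const
  rw [lintegral_indicator hm, Measure.restrict_restrict hm]
  rcases eq_or_ne y ∞ with rfl | hy
  · rw [ENNReal.top_rpow_of_pos ha, ENNReal.mul_top (by simpa using ha), eq_top_iff]
    have key : ∀ k : ℕ, ENNReal.ofReal a⁻¹ * ENNReal.ofReal (k : ℝ) ^ a ≤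
        ∫⁻ s in {s : ℝ | ENNReal.ofReal s < ∞} ∩ Set.Ioi 0, ENNReal.ofReal (s ^ (a - 1)) := by
      intro k
      rw [← fin k (by positivity)]
      exact lintegral_mono_set fun s hs => ⟨by simp, hs.1⟩
    have hlim : Tendsto (fun k : ℕ => ENNReal.ofReal a⁻¹ * ENNReal.ofReal (k : ℝ) ^ a) atTop
        (𝓝 (ENNReal.ofReal a⁻¹ * ∞)) := by
      refine ENNReal.Tendsto.const_mul ?_ (Or.inr ENNReal.ofReal_ne_top)
      have h1 : Tendsto (fun k : ℕ => ENNReal.ofReal (k : ℝ)) atTop (𝓝 ∞) := by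
        simpa using ENNReal.tendsto_nat_nhds_top
      have := h1.ennrpow_const a
      rwa [ENNReal.top_rpow_of_pos ha] at this
    rw [ENNReal.mul_top (by simpa using ha)] at hlim
    exact le_of_tendsto' hlim key
  · have : {s : ℝ | ENNReal.ofReal s < y} ∩ Set.Ioi 0 = Set.Ioo 0 y.toReal := by
      ext s
      simp only [Set.mem_inter_iff, Set.mem_ofPred_eq, Set.mem_Ioi, Set.mem_Ioo]
      constructor
      · rintro ⟨h1, h2⟩
        exact ⟨h2, (ENNReal.ofReal_lt_iff_lt_toReal h2.le hy).1 h1⟩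
      · rintro ⟨h1, h2⟩
        exact ⟨(ENNReal.ofReal_lt_iff_lt_toReal h1.le hy).2 h2, h1⟩
    rw [this, fin _ ENNReal.toReal_nonneg, ENNReal.ofReal_toReal hy]

/-- The tail `∫_T^∞ t^(-c-1) dt = T^(-c) / c`. -/
lemma lintegral_Ioi_rpow_neg {c T : ℝ} (hc : 0 < c) (hT : 0 < T) :
    ∫⁻ t in Set.Ioi T, ENNReal.ofReal (t ^ (-c - 1)) = ENNReal.ofReal (c⁻¹ * T ^ (-c)) := by
  rw [← ofReal_integral_eq_lintegral_ofReal
    (integrableOn_Ioi_rpow_of_lt (by linarith) hT), integral_Ioi_rpow_of_lt (by linarith) hT]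
  · congr 1
    rw [sub_add_cancel]; field_simp
  · filter_upwards [ae_restrict_mem measurableSet_Ioi] with s hs
    exact Real.rpow_nonneg (hT.trans hs).le _

lemma lintegral_Ioc_rpow {a T : ℝ} (ha : 0 < a) (hT : 0 ≤ T) :
    ∫⁻ t in Set.Ioc 0 T, ENNReal.ofReal (t ^ (a - 1)) = ENNReal.ofReal (a⁻¹ * T ^ a) := by
  have hint : IntegrableOn (fun s : ℝ => s ^ (a - 1)) (Set.Ioc 0 T) := by
    rw [← intervalIntegrable_iff_integrableOn_Ioc_of_le hT]
    exact intervalIntegral.intervalIntegrable_rpow' (by linarith)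
  rw [← ofReal_integral_eq_lintegral_ofReal hint,
      ← intervalIntegral.integral_of_le hT, integral_rpow (Or.inl (by linarith))]
  · congr 1
    rw [sub_add_cancel, Real.zero_rpow ha.ne']; field_simp; ring
  · filter_upwards [ae_restrict_mem measurableSet_Ioc] with s hs
    exact Real.rpow_nonneg hs.1.le _

/-- The potential `∫_0^∞ t^(γ-1) e^{tΔ} f dt`, a constant multiple of the Riesz potential. -/
def rieszPot (γ : ℝ) (f : Rn n → ℝ≥0∞) (x : Rn n) : ℝ≥0∞ :=
  ∫⁻ t in Set.Ioi (0 : ℝ), ENNReal.ofReal (t ^ (γ - 1)) * lheat t f x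

lemma measurable_setLIntegral_lheat (A : Set ℝ) {w : ℝ → ℝ≥0∞} (hw : Measurable w)
    {f : Rn n → ℝ≥0∞} (hf : Measurable f) :
    Measurable (fun x => ∫⁻ t in A, w t * lheat t f x) := by
  apply Measurable.lintegral_prod_right
  exact (hw.comp measurable_snd).mul (measurable_lheat hf measurable_snd measurable_fst)

lemma measurable_rieszPot (γ : ℝ) {f : Rn n → ℝ≥0∞} (hf : Measurable f) :
    Measurable (rieszPot γ f) :=
  measurable_setLIntegral_lheat _ (by fun_prop) hf

/-- The time integral is cut at `T`. Late times are bounded uniformly through `‖f‖_p ≤ 1` and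
`t^{-n/(2p)}`. At early times `f ≤ s + f·1_{f > s}`, and the constant `s` is fixed by the semigroup;
only large values of `f` remain under the integral. -/
lemma rieszPot_le {p : ℝ≥0∞} (hp : 1 ≤ p) (hp' : p ≠ ∞) {γ c T s : ℝ} (hγ : 0 < γ)
    (hc : 0 < c) (hγc : γ + c = n / (2 * p.toReal)) (hT : 0 < T)
    {f : Rn n → ℝ≥0∞} (hf : Measurable f) (hf1 : eLpNorm f p volume ≤ 1) (x : Rn n) :
    rieszPot γ f x ≤ ENNReal.ofReal (c⁻¹ * T ^ (-c))
      + ENNReal.ofReal (γ⁻¹ * T ^ γ) * ENNReal.ofReal s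
      + ∫⁻ t in Set.Ioc 0 T, ENNReal.ofReal (t ^ (γ - 1)) *
          lheat t ({y | ENNReal.ofReal s < f y}.indicator f) x := by
  have hms : MeasurableSet {y | ENNReal.ofReal s < f y} := measurableSet_lt measurable_const hf
  unfold rieszPot
  rw [← Set.Ioc_union_Ioi_eq_Ioi hT.le,
    lintegral_union measurableSet_Ioi (by
      rw [Set.disjoint_left]; intro t h1 h2; exact absurd h1.2 (not_le.2 h2)), add_comm, add_assoc]
  refine add_le_add ?_ ?_
  · rw [← lintegral_Ioi_rpow_neg hc hT]
    refine setLIntegral_mono (by fun_prop) fun t ht => ?_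
    have ht0 : 0 < t := hT.trans ht
    calc _ ≤ ENNReal.ofReal (t ^ (γ - 1)) *
          (ENNReal.ofReal (t ^ (-((n : ℝ) / (2 * p.toReal)))) * 1) := by
          gcongr
          exact (lheat_le_eLpNorm ht0 hp hp' hf x).trans (by gcongr)
      _ = _ := by
          rw [mul_one, ← ENNReal.ofReal_mul (by positivity), ← Real.rpow_add ht0]
          congr 2; rw [← hγc]; ring
  · rw [← lintegral_Ioc_rpow hγ hT.le, ← lintegral_mul_const _ (by fun_prop),
      ← lintegral_add_left (by fun_prop)]
    refine setLIntegral_mono (by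
      have := hf.indicator hms
      fun_prop) fun t ht => ?_
    rw [← mul_add]
    gcongr
    calc lheat t f x ≤ lheat t (fun y => ENNReal.ofReal s +
            {y | ENNReal.ofReal s < f y}.indicator f y) x := by
          refine lheat_mono t (fun y => ?_) x
          by_cases hy : ENNReal.ofReal s < f y
          · rw [Set.indicator_of_mem (show y ∈ {y | ENNReal.ofReal s < f y} from hy)]
            exact le_add_self
          · exact (not_lt.1 hy).trans le_self_add
      _ = _ := by rw [lheat_add t measurable_const, lheat_const ht.1]

/-- `T` and `s` make each of the first two terms of `rieszPot_le` equal to `l/3`, so the third must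
reach `l/3` wherever the potential exceeds `l`. Chebyshev's inequality applies to that term, whose
`L¹` norm is explicit because `e^{tΔ}` preserves integrals. -/
lemma measure_lt_rieszPot_le {p : ℝ≥0∞} (hp : 1 ≤ p) (hp' : p ≠ ∞) {γ c T s l : ℝ} (hγ : 0 < γ)
    (hc : 0 < c) (hγc : γ + c = n / (2 * p.toReal)) (hT : 0 < T) (hl : 0 < l) (hs : 0 < s)
    (hTl : c⁻¹ * T ^ (-c) = l / 3) (hsl : γ⁻¹ * T ^ γ * s = l / 3)
    {f : Rn n → ℝ≥0∞} (hf : Measurable f) (hf1 : eLpNorm f p volume ≤ 1) :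
    volume {x | ENNReal.ofReal l < rieszPot γ f x} ≤
      ENNReal.ofReal s⁻¹ * ∫⁻ x, {y | ENNReal.ofReal s < f y}.indicator f x := by
  have hms : MeasurableSet {y | ENNReal.ofReal s < f y} := measurableSet_lt measurable_const hf
  set f' := {y | ENNReal.ofReal s < f y}.indicator f with hf'
  have hf'm : Measurable f' := hf.indicator hms
  set R : Rn n → ℝ≥0∞ := fun x => ∫⁻ t in Set.Ioc 0 T, ENNReal.ofReal (t ^ (γ - 1)) * lheat t f' x
    with hR
  have hRm : Measurable R := measurable_setLIntegral_lheat _ (by fun_prop) hf'm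
  have hl3 : (0 : ℝ) < l / 3 := by positivity
  have h1 : {x | ENNReal.ofReal l < rieszPot γ f x} ⊆ {x | ENNReal.ofReal (l / 3) ≤ R x} := by
    intro x hx
    simp only [Set.mem_ofPred_eq] at hx ⊢
    by_contra! hlt
    have h2 := rieszPot_le (s := s) hp hp' hγ hc hγc hT hf hf1 x
    rw [hTl, ← ENNReal.ofReal_mul (by positivity), hsl] at h2
    have h3 : ENNReal.ofReal (l / 3) + ENNReal.ofReal (l / 3) + R x < ENNReal.ofReal l := by
      calc _ < ENNReal.ofReal (l / 3) + ENNReal.ofReal (l / 3) + ENNReal.ofReal (l / 3) := by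
            rw [ENNReal.add_lt_add_iff_left (by simp)]; exact hlt
        _ = _ := by
            rw [← ENNReal.ofReal_add hl3.le hl3.le, ← ENNReal.ofReal_add (by positivity) hl3.le]
            congr 1; ring
    exact absurd (hx.trans_le h2) (not_lt.2 h3.le)
  have h2 : ∫⁻ x, R x = ENNReal.ofReal (γ⁻¹ * T ^ γ) * ∫⁻ x, f' x := by
    simp only [hR]
    rw [lintegral_lintegral_swap]
    · rw [← lintegral_Ioc_rpow hγ hT.le, ← lintegral_mul_const _ (by fun_prop)]
      refine setLIntegral_congr_fun measurableSet_Ioc fun t ht => ?_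
      beta_reduce
      rw [lintegral_const_mul _ (by fun_prop), lintegral_lheat ht.1 hf'm]
    · apply Measurable.aemeasurable
      simp only [Function.uncurry_def]
      fun_prop
  calc _ ≤ volume {x | ENNReal.ofReal (l / 3) ≤ R x} := measure_mono h1
    _ ≤ (∫⁻ x, R x) / ENNReal.ofReal (l / 3) :=
        meas_ge_le_lintegral_div hRm.aemeasurable (by simpa using hl3) (by simp)
    _ = _ := by
        rw [h2, div_eq_mul_inv, mul_right_comm, ← ENNReal.ofReal_inv_of_pos hl3,
          ← ENNReal.ofReal_mul (by positivity)]
        congr 2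
        rw [← hsl]
        field_simp

/-- Layer-cake formula: `S^a` is written as an integral over `0 < l < S`, also where `S = ∞`, and
Tonelli is applied. -/
lemma lintegral_rpow_eq_lintegral_measure {α : Type*} [MeasurableSpace α] {μ : Measure α}
    [SFinite μ] {S : α → ℝ≥0∞} (hS : Measurable S) {a : ℝ} (ha : 0 < a) :
    ∫⁻ x, S x ^ a ∂μ = ENNReal.ofReal a * ∫⁻ l in Set.Ioi (0 : ℝ),
      ENNReal.ofReal (l ^ (a - 1)) * μ {x | ENNReal.ofReal l < S x} := by
  have e1 : ∀ x, S x ^ a = ENNReal.ofReal a * ∫⁻ s in Set.Ioi (0 : ℝ),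
      {s : ℝ | ENNReal.ofReal s < S x}.indicator (fun s => ENNReal.ofReal (s ^ (a - 1))) s := by
    intro x
    rw [lintegral_rpow_indicator ha, ← mul_assoc, ← ENNReal.ofReal_mul ha.le,
      mul_inv_cancel₀ ha.ne', ENNReal.ofReal_one, one_mul]
  have hms : MeasurableSet {z : α × ℝ | ENNReal.ofReal z.2 < S z.1} :=
    measurableSet_lt (by fun_prop) (by fun_prop)
  have hm : Measurable (fun z : α × ℝ => {s : ℝ | ENNReal.ofReal s < S z.1}.indicator
      (fun s => ENNReal.ofReal (s ^ (a - 1))) z.2) := by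
    have : Measurable (fun z : α × ℝ => ENNReal.ofReal (z.2 ^ (a - 1))) := by fun_prop
    exact this.indicator hms
  simp_rw [e1]
  rw [lintegral_const_mul _ (Measurable.lintegral_prod_right hm),
    lintegral_lintegral_swap hm.aemeasurable]
  congr 1
  refine lintegral_congr fun l => ?_
  have : ∀ x, {s : ℝ | ENNReal.ofReal s < S x}.indicator (fun s => ENNReal.ofReal (s ^ (a - 1))) l
      = {x | ENNReal.ofReal l < S x}.indicator (fun _ => ENNReal.ofReal (l ^ (a - 1))) x := by
    intro x; simp [Set.indicator]
  simp_rw [this]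
  rw [lintegral_indicator_const (measurableSet_lt measurable_const hS)]

/-- The Hardy–Littlewood–Sobolev inequality, in terms of the heat semigroup. -/
theorem exists_eLpNorm_rieszPot_le (hn : 0 < n) {p q : ℝ≥0∞} (hp : 1 < p) (hpq : p < q)
    (hq : q ≠ ∞) : ∃ C : ℝ≥0∞, C ≠ ∞ ∧ ∀ f : Rn n → ℝ≥0∞, Measurable f →
      eLpNorm (rieszPot (gammaExp n p q) f) q volume ≤ C * eLpNorm f p volume := by
  have hp' : p ≠ ∞ := ne_top_of_lt hpq
  set P := p.toReal with hPdef
  set Q := q.toReal with hQdef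
  have hP1 : 1 < P := by
    simpa using (ENNReal.toReal_lt_toReal ENNReal.one_ne_top hp').2 hp
  have hPQ : P < Q := (ENNReal.toReal_lt_toReal hp' hq).2 hpq
  have hP0 : 0 < P := by linarith
  have hQ0 : 0 < Q := by linarith
  have hnR : (0 : ℝ) < n := by exact_mod_cast hn
  set γ := gammaExp n p q with hγdef
  have hγval : γ = n / 2 * (P⁻¹ - Q⁻¹) := by simp [hγdef, gammaExp, ENNReal.toReal_inv, P, Q]
  have hinv : Q⁻¹ < P⁻¹ := by gcongr
  have hγ : 0 < γ := by
    rw [hγval]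
    have : 0 < P⁻¹ - Q⁻¹ := by linarith
    positivity
  set c : ℝ := n / (2 * Q) with hcdef
  have hc : 0 < c := by positivity
  have hγc : γ + c = n / (2 * P) := by rw [hγval, hcdef]; field_simp; ring
  have hγdc : γ / c = Q / P - 1 := by rw [hγval, hcdef]; field_simp
  -- With `T` fixed by `T^{-c} = cl/3`, the requirement `γ⁻¹ T^γ s = l/3` and `γ/c = Q/P - 1` force
  -- `s = κ l^{Q/P}`.
  set κ : ℝ := γ / 3 * (c / 3) ^ (Q / P - 1) with hκdef
  have hκ : 0 < κ := by positivity
  -- Dividing `l^{Q-1}` by `s ∼ l^{Q/P}` leaves `l^{a-1}`, integrated over `l < (f/κ)^{P/Q}`. The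
  -- result is a multiple of `f^{P-1}`, which with the remaining factor `f` gives `f^P`. Positivity
  -- of `a` is where `p > 1` enters.
  set a : ℝ := Q - Q / P with hadef
  have ha : 0 < a := by
    have : Q / P < Q := div_lt_self hQ0 hP1
    linarith
  set D : ℝ≥0∞ := ENNReal.ofReal Q * (ENNReal.ofReal κ⁻¹ * (ENNReal.ofReal a⁻¹ *
    ENNReal.ofReal (κ⁻¹) ^ (P - 1))) with hD
  have hDtop : D ≠ ∞ := by
    refine ENNReal.mul_ne_top ENNReal.ofReal_ne_top (ENNReal.mul_ne_top ENNReal.ofReal_ne_top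
      (ENNReal.mul_ne_top ENNReal.ofReal_ne_top
        (ENNReal.rpow_ne_top_of_nonneg (by linarith) ENNReal.ofReal_ne_top)))
  -- Normalized case; homogeneity gives the general one at the end.
  have main : ∀ f : Rn n → ℝ≥0∞, Measurable f → eLpNorm f p volume ≤ 1 →
      eLpNorm (rieszPot γ f) q volume ≤ D ^ (1 / Q) := by
    intro f hf hf1
    have hfP : ∫⁻ x, f x ^ P ≤ 1 := by
      rw [← eLpNorm_rpow_eq_lintegral hp.le hp']
      exact ENNReal.rpow_le_one hf1 hP0.le
    rw [eLpNorm_eq_lintegral (hp.trans hpq).le hq]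
    refine ENNReal.rpow_le_rpow ?_ (by positivity)
    rw [lintegral_rpow_eq_lintegral_measure (measurable_rieszPot γ hf) hQ0, hD]
    gcongr
    have hms : MeasurableSet {z : ℝ × Rn n | ENNReal.ofReal (κ * z.1 ^ (Q / P)) < f z.2} :=
      measurableSet_lt (by fun_prop) (by fun_prop)
    calc ∫⁻ l in Set.Ioi (0 : ℝ), ENNReal.ofReal (l ^ (Q - 1)) *
          volume {x | ENNReal.ofReal l < rieszPot γ f x}
        ≤ ∫⁻ l in Set.Ioi (0 : ℝ), ∫⁻ x, ENNReal.ofReal κ⁻¹ * (f x *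
            {s : ℝ | ENNReal.ofReal s < (f x / ENNReal.ofReal κ) ^ (P / Q)}.indicator
              (fun s => ENNReal.ofReal (s ^ (a - 1))) l) := by
          refine setLIntegral_mono' measurableSet_Ioi fun l hl => ?_
          have hl : 0 < l := hl
          have hs : 0 < κ * l ^ (Q / P) := by positivity
          -- The time at which the late-time bound `c⁻¹ T^{-c}` equals `l/3`.
          set T : ℝ := (c * l / 3) ^ (-c⁻¹) with hT
          have hT0 : 0 < T := by positivity
          have hTc : T ^ (-c) = c * l / 3 := by
            rw [hT, ← Real.rpow_mul (by positivity)]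
            rw [neg_mul_neg, inv_mul_cancel₀ hc.ne', Real.rpow_one]
          have hTγ : T ^ γ * (c * l / 3) ^ (Q / P - 1) = 1 := by
            rw [hT, ← Real.rpow_mul (by positivity), ← hγdc, ← Real.rpow_add (by positivity)]
            convert Real.rpow_zero _ using 2
            field_simp; ring
          have hsl : γ⁻¹ * T ^ γ * (κ * l ^ (Q / P)) = l / 3 := by
            have e1 : κ * l ^ (Q / P) = γ * (l / 3) * (c * l / 3) ^ (Q / P - 1) := by
              have e2 : c * l / 3 = (c / 3) * l := by ring
              have e3 : l ^ (Q / P) = l ^ (Q / P - 1) * l := by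
                nth_rewrite 3 [← Real.rpow_one l]
                rw [← Real.rpow_add hl]; congr 1; ring
              rw [hκdef, e2, Real.mul_rpow (by positivity) hl.le, e3]; ring
            calc _ = (γ⁻¹ * γ) * (l / 3) * (T ^ γ * (c * l / 3) ^ (Q / P - 1)) := by rw [e1]; ring
              _ = _ := by rw [hTγ, inv_mul_cancel₀ hγ.ne']; ring
          have hm := measure_lt_rieszPot_le (s := κ * l ^ (Q / P)) (T := T) (l := l) hp.le hp' hγ hc
            hγc hT0 hl hs (by rw [hTc]; field_simp) hsl hf hf1
          refine (mul_le_mul_right hm _).trans_eq ?_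
          rw [← mul_assoc, ← lintegral_const_mul _ (hf.indicator
            (measurableSet_lt measurable_const hf))]
          refine lintegral_congr fun x => ?_
          have hiff : ENNReal.ofReal (κ * l ^ (Q / P)) < f x ↔
              ENNReal.ofReal l < (f x / ENNReal.ofReal κ) ^ (P / Q) := by
            rw [← ENNReal.rpow_lt_rpow_iff (show 0 < Q / P by positivity) (x := ENNReal.ofReal l),
              ← ENNReal.rpow_mul, show P / Q * (Q / P) = 1 by field_simp, ENNReal.rpow_one,
              ENNReal.lt_div_iff_mul_lt (by simp [hκ]) (by simp),
              ENNReal.ofReal_rpow_of_nonneg hl.le (by positivity), ← ENNReal.ofReal_mul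
              (by positivity), mul_comm]
          by_cases hx : ENNReal.ofReal (κ * l ^ (Q / P)) < f x
          · simp only [Set.indicator_apply, Set.mem_ofPred_eq, if_pos hx, if_pos (hiff.1 hx)]
            rw [← ENNReal.ofReal_mul (by positivity), mul_comm (f x), ← mul_assoc,
              ← ENNReal.ofReal_mul (by positivity)]
            congr 2
            rw [mul_inv, ← Real.rpow_neg hl.le, mul_left_comm, ← Real.rpow_add hl]
            congr 2
            rw [hadef]; ring
          · simp only [Set.indicator_apply, Set.mem_ofPred_eq, if_neg hx, if_neg (mt hiff.2 hx),
              mul_zero]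
      _ = ∫⁻ x, ∫⁻ l in Set.Ioi (0 : ℝ), ENNReal.ofReal κ⁻¹ * (f x *
            {s : ℝ | ENNReal.ofReal s < (f x / ENNReal.ofReal κ) ^ (P / Q)}.indicator
              (fun s => ENNReal.ofReal (s ^ (a - 1))) l) := by
          rw [lintegral_lintegral_swap]
          have hms : MeasurableSet {z : ℝ × Rn n |
              ENNReal.ofReal z.1 < (f z.2 / ENNReal.ofReal κ) ^ (P / Q)} :=
            measurableSet_lt (by fun_prop) (by fun_prop)
          have h1 : Measurable (fun z : ℝ × Rn n => ENNReal.ofReal (z.1 ^ (a - 1))) := by fun_prop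
          have h2 := h1.indicator hms
          exact (measurable_const.mul ((hf.comp measurable_snd).mul h2)).aemeasurable
      _ = ENNReal.ofReal κ⁻¹ * (ENNReal.ofReal a⁻¹ * (ENNReal.ofReal κ⁻¹ ^ (P - 1) *
            ∫⁻ x, f x ^ P)) := by
          rw [← lintegral_const_mul _ (by fun_prop), ← lintegral_const_mul _ (by fun_prop),
            ← lintegral_const_mul _ (by fun_prop)]
          refine lintegral_congr fun x => ?_
          have hmi : Measurable ({s : ℝ | ENNReal.ofReal s <
              (f x / ENNReal.ofReal κ) ^ (P / Q)}.indicator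
              (fun s => ENNReal.ofReal (s ^ (a - 1)))) :=
            Measurable.indicator (by fun_prop) (measurableSet_lt (by fun_prop) measurable_const)
          rw [lintegral_const_mul _ (hmi.const_mul _), lintegral_const_mul _ hmi,
            lintegral_rpow_indicator ha, ← ENNReal.rpow_mul]
          have e1 : P / Q * a = P - 1 := by rw [hadef]; field_simp
          have e2 : f x ^ P = f x * f x ^ (P - 1) := by
            nth_rewrite 2 [← ENNReal.rpow_one (f x)]
            rw [← ENNReal.rpow_add_of_nonneg _ _ (by norm_num) (by linarith)]
            congr 1; ring
          rw [e1, e2, div_eq_mul_inv, ENNReal.mul_rpow_of_nonneg _ _ (by linarith),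
            ENNReal.ofReal_inv_of_pos hκ]
          ring
      _ ≤ _ := by
          gcongr
          calc _ ≤ ENNReal.ofReal κ⁻¹ ^ (P - 1) * 1 := by gcongr
            _ = _ := mul_one _
  -- The added 1 keeps the constant nonzero, so that the right side is `∞` when `‖f‖_p = ∞`.
  refine ⟨D ^ (1 / Q) + 1, by
    simpa using ENNReal.rpow_ne_top_of_nonneg (by positivity) hDtop, fun f hf => ?_⟩
  have hsmul : ∀ (k : ℝ≥0∞) (f : Rn n → ℝ≥0∞), Measurable f →
      rieszPot γ (fun x => k * f x) = fun x => k * rieszPot γ f x := by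
    intro k f hf
    ext x
    unfold rieszPot
    rw [← lintegral_const_mul _ (by fun_prop)]
    refine lintegral_congr fun t => ?_
    rw [lheat_const_mul t hf]; ring
  have hnorm : ∀ (k : ℝ≥0∞) (r : ℝ≥0∞) (f : Rn n → ℝ≥0∞), 1 ≤ r → r ≠ ∞ → Measurable f →
      eLpNorm (fun x => k * f x) r volume = k * eLpNorm f r volume := by
    intro k r f hr hr' hf
    have hR := one_le_toReal hr hr'
    have hR0 : 0 < r.toReal := by linarith
    rw [eLpNorm_eq_lintegral hr hr', eLpNorm_eq_lintegral hr hr']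
    simp_rw [ENNReal.mul_rpow_of_nonneg _ _ hR0.le]
    rw [lintegral_const_mul _ (by fun_prop), ENNReal.mul_rpow_of_nonneg _ _ (by positivity),
      ← ENNReal.rpow_mul, one_div, mul_inv_cancel₀ hR0.ne', ENNReal.rpow_one]
  set N := eLpNorm f p volume with hN
  rcases eq_or_ne N 0 with h0 | h0
  · have hf0 : f =ᵐ[volume] 0 := by
      rw [hN, eLpNorm_eq_zero_iff hf.aestronglyMeasurable (by positivity)] at h0
      exact h0
    have : rieszPot γ f = 0 := by
      ext x
      unfold rieszPot
      have : ∀ t, lheat t f x = 0 := by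
        intro t
        unfold lheat
        rw [lintegral_eq_zero_iff (by fun_prop)]
        filter_upwards [hf0] with y hy
        simp [hy]
      simp [this]
    simp [this]
  rcases eq_or_ne N ∞ with h1 | h1
  · rw [h1, ENNReal.mul_top (by simp)]; exact le_top
  have h2 := main (fun x => N⁻¹ * f x) (by fun_prop) (by
    rw [hnorm _ _ _ hp.le hp' hf]; exact ENNReal.inv_mul_le_one _)
  rw [hsmul _ _ hf, hnorm _ _ _ (hp.trans hpq).le hq (measurable_rieszPot γ hf)] at h2
  calc _ = N * (N⁻¹ * eLpNorm (rieszPot γ f) q volume) := by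
        rw [← mul_assoc, ENNReal.mul_inv_cancel h0 h1, one_mul]
    _ ≤ N * D ^ (1 / Q) := by gcongr
    _ ≤ N * (D ^ (1 / Q) + 1) := by gcongr; exact le_self_add
    _ = _ := mul_comm _ _

/-! ### The heat semigroup as a Fourier multiplier -/

@[fun_prop]
lemma measurable_heat {α : Type*} [MeasurableSpace α] {f : Rn n → ℂ} (hf : Measurable f)
    {τ : α → ℝ} {ξ : α → Rn n} (hτ : Measurable τ) (hξ : Measurable ξ) :
    Measurable (fun a => heat (τ a) f (ξ a)) := by
  have h : Measurable (fun z : α × Rn n => (heatKernel (τ z.1) (ξ z.1 - z.2) : ℂ) * f z.2) := by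
    fun_prop
  exact (h.stronglyMeasurable.integral_prod_right').measurable

lemma enorm_heatKernel {t : ℝ} (ht : 0 < t) (x : Rn n) :
    ‖(heatKernel t x : ℂ)‖ₑ = lheatKernel t x := by
  rw [← ofReal_norm, Complex.norm_real, Real.norm_of_nonneg (heatKernel_nonneg ht x),
    lheatKernel]

lemma lintegral_enorm_heat_integrand {t : ℝ} (ht : 0 < t) (f : Rn n → ℂ) (x : Rn n) :
    ∫⁻ y, ‖(heatKernel t (x - y) : ℂ) * f y‖ₑ = lheat t (fun y => ‖f y‖ₑ) x := by
  simp [lheat, enorm_mul, enorm_heatKernel ht]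

lemma enorm_heat_le {t : ℝ} (ht : 0 < t) (f : Rn n → ℂ) (x : Rn n) :
    ‖heat t f x‖ₑ ≤ lheat t (fun y => ‖f y‖ₑ) x :=
  (enorm_integral_le_lintegral_enorm _).trans_eq (lintegral_enorm_heat_integrand ht f x)

lemma heat_congr_ae (t : ℝ) {f g : Rn n → ℂ} (h : f =ᵐ[volume] g) : heat t f = heat t g := by
  ext x
  refine integral_congr_ae ?_
  filter_upwards [h] with y hy
  rw [hy]

/-- The Fourier symbol of `-Δ`. -/
def symb (ξ : Rn n) : ℝ := (2 * Real.pi * ‖ξ‖) ^ 2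

lemma symb_nonneg (ξ : Rn n) : 0 ≤ symb ξ := by unfold symb; positivity

@[fun_prop]
lemma continuous_symb : Continuous (symb : Rn n → ℝ) := by unfold symb; fun_prop

@[fun_prop]
lemma measurable_symb : Measurable (symb : Rn n → ℝ) := continuous_symb.measurable

/-- Plane waves are eigenfunctions of the heat semigroup; a translation reduces this to the Fourier
transform of a Gaussian. -/
lemma integral_heatKernel_mul_cexp {t : ℝ} (ht : 0 < t) (x ξ : Rn n) :
    ∫ y, (heatKernel t (x - y) : ℂ) * Complex.exp (↑(2 * Real.pi * inner ℝ ξ y) * Complex.I)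
      = Complex.exp (↑(2 * Real.pi * inner ℝ ξ x) * Complex.I) * Real.exp (-t * symb ξ) := by
  have h1 := integral_sub_left_eq_self (fun z : Rn n => (heatKernel t z : ℂ) *
    Complex.exp (↑(2 * Real.pi * inner ℝ ξ (x - z)) * Complex.I)) volume x
  simp only [sub_sub_cancel] at h1
  rw [h1]
  have hb : 0 < (((4 * t)⁻¹ : ℝ) : ℂ).re := by rw [Complex.ofReal_re]; positivity
  have h2 := GaussianFourier.integral_cexp_neg_mul_sq_norm_add hb (-(2 * Real.pi * Complex.I)) ξ
  have h3 : ∀ z : Rn n, (heatKernel t z : ℂ) *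
      Complex.exp (↑(2 * Real.pi * inner ℝ ξ (x - z)) * Complex.I)
      = (((4 * Real.pi * t) ^ (-((n : ℝ) / 2)) : ℝ) : ℂ) *
        Complex.exp (↑(2 * Real.pi * inner ℝ ξ x) * Complex.I) *
        Complex.exp (-(((4 * t)⁻¹ : ℝ) : ℂ) * ‖z‖ ^ 2
          + -(2 * Real.pi * Complex.I) * inner ℝ ξ z) := by
    intro z
    have h : Complex.exp ((-(4 * t)⁻¹ * ‖z‖ ^ 2 : ℝ) : ℂ) *
        Complex.exp (↑(2 * Real.pi * inner ℝ ξ (x - z)) * Complex.I)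
        = Complex.exp (↑(2 * Real.pi * inner ℝ ξ x) * Complex.I) *
          Complex.exp (-(((4 * t)⁻¹ : ℝ) : ℂ) * ‖z‖ ^ 2
          + -(2 * Real.pi * Complex.I) * inner ℝ ξ z) := by
      rw [inner_sub_right, ← Complex.exp_add, ← Complex.exp_add]
      congr 1
      push_cast
      ring
    rw [heatKernel, Complex.ofReal_mul, Complex.ofReal_exp]
    linear_combination (((4 * Real.pi * t) ^ (-((n : ℝ) / 2)) : ℝ) : ℂ) * h
  simp_rw [h3]
  rw [integral_const_mul, h2, finrank_euclideanSpace_fin]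
  have h4 : (Real.pi : ℂ) / (((4 * t)⁻¹ : ℝ) : ℂ) = ((4 * Real.pi * t : ℝ) : ℂ) := by
    push_cast; field_simp
  have h5 : ((n : ℂ) / 2) = (((n : ℝ) / 2 : ℝ) : ℂ) := by push_cast; rfl
  rw [h4, h5, ← Complex.ofReal_cpow (by positivity)]
  have h6 : ((-(2 * Real.pi * Complex.I)) ^ 2 * ‖ξ‖ ^ 2 / (4 * (((4 * t)⁻¹ : ℝ) : ℂ)))
      = ((-t * symb ξ : ℝ) : ℂ) := by
    unfold symb
    push_cast
    have : (t : ℂ) ≠ 0 := by exact_mod_cast ht.ne'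
    field_simp
    rw [Complex.I_sq]; ring
  rw [h6, ← Complex.ofReal_exp]
  have h7 : (((4 * Real.pi * t) ^ (-((n : ℝ) / 2)) : ℝ) : ℂ) *
      (((4 * Real.pi * t) ^ ((n : ℝ) / 2) : ℝ) : ℂ) = 1 := by
    rw [← Complex.ofReal_mul, ← Real.rpow_add (by positivity)]; simp
  linear_combination (Complex.exp (↑(2 * Real.pi * inner ℝ ξ x) * Complex.I) *
    (Real.exp (-t * symb ξ) : ℂ)) * h7

lemma exp_neg_mul_symb_le_one {t : ℝ} (ht : 0 ≤ t) (ξ : Rn n) : Real.exp (-t * symb ξ) ≤ 1 := by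
  apply Real.exp_le_one_iff.2
  nlinarith [symb_nonneg ξ, mul_nonneg ht (symb_nonneg ξ)]

lemma integrable_exp_symb_mul {t : ℝ} (ht : 0 ≤ t) {m : Rn n → ℂ} (hm : Integrable m) :
    Integrable (fun ξ => (Real.exp (-t * symb ξ) : ℂ) * m ξ) := by
  refine hm.bdd_mul (c := 1) (by fun_prop) (Eventually.of_forall fun ξ => ?_)
  rw [Complex.norm_real, Real.norm_of_nonneg (Real.exp_pos _).le]
  exact exp_neg_mul_symb_le_one ht ξ

/-- The heat semigroup is a Fourier multiplier. -/
theorem heat_fourierInv {t : ℝ} (ht : 0 < t) {m : Rn n → ℂ} (hm : Integrable m) (x : Rn n) :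
    heat t (𝓕⁻ m) x = 𝓕⁻ (fun ξ => (Real.exp (-t * symb ξ) : ℂ) * m ξ) x := by
  have hk : Integrable (fun y : Rn n => (heatKernel t (x - y) : ℂ)) :=
    ((integrable_heatKernel ht).comp_sub_left x).ofReal
  have hint : Integrable (Function.uncurry fun y ξ : Rn n => (heatKernel t (x - y) : ℂ) *
      (Complex.exp (↑(2 * Real.pi * inner ℝ ξ y) * Complex.I) * m ξ)) (volume.prod volume) := by
    have h1 := hk.mul_prod hm
    have h2 := h1.bdd_mul (c := 1)
      (f := fun z : Rn n × Rn n => Complex.exp (↑(2 * Real.pi * inner ℝ z.2 z.1) * Complex.I))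
      (by fun_prop) (Eventually.of_forall fun z => by rw [Complex.norm_exp_ofReal_mul_I])
    refine h2.congr (Eventually.of_forall fun z => ?_)
    simp only [Function.uncurry]
    ring
  unfold heat
  simp_rw [Real.fourierInv_eq', smul_eq_mul, ← integral_const_mul]
  rw [integral_integral_swap hint]
  refine integral_congr_ae (Eventually.of_forall fun ξ => ?_)
  beta_reduce
  simp_rw [← mul_assoc]
  rw [integral_mul_const, integral_heatKernel_mul_cexp ht]

/-- Superposition of Fourier multipliers. -/
theorem integral_fourierInv {T : Type*} [MeasurableSpace T] {μ : Measure T} [SFinite μ]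
    {κ : T → Rn n → ℝ} {m : Rn n → ℂ} (hκ : Measurable (Function.uncurry κ))
    (hm : AEStronglyMeasurable m)
    (hint : ∫⁻ ξ, (∫⁻ t, ‖κ t ξ‖ₑ ∂μ) * ‖m ξ‖ₑ ≠ ∞) (x : Rn n) :
    ∫ t, 𝓕⁻ (fun ξ => (κ t ξ : ℂ) * m ξ) x ∂μ
      = 𝓕⁻ (fun ξ => ((∫ t, κ t ξ ∂μ : ℝ) : ℂ) * m ξ) x := by
  have hκξ : ∀ ξ, Measurable fun t => κ t ξ := fun ξ => hκ.comp measurable_prodMk_right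
  have hI : Integrable (Function.uncurry fun (t : T) (ξ : Rn n) =>
      Complex.exp (↑(2 * Real.pi * inner ℝ ξ x) * Complex.I) * ((κ t ξ : ℂ) * m ξ))
      (μ.prod volume) := by
    have hmeas : AEStronglyMeasurable (Function.uncurry fun (t : T) (ξ : Rn n) =>
        Complex.exp (↑(2 * Real.pi * inner ℝ ξ x) * Complex.I) * ((κ t ξ : ℂ) * m ξ))
        (μ.prod volume) := by
      have h1 : Measurable fun z : T × Rn n => (κ z.1 z.2 : ℂ) := Complex.measurable_ofReal.comp hκ
      have h2 : Measurable fun z : T × Rn n =>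
          Complex.exp (↑(2 * Real.pi * inner ℝ z.2 x) * Complex.I) := by fun_prop
      exact h2.aestronglyMeasurable.mul (h1.aestronglyMeasurable.mul hm.comp_snd)
    refine ⟨hmeas, ?_⟩
    rw [hasFiniteIntegral_iff_enorm, lintegral_prod_symm _ hmeas.enorm]
    refine lt_of_le_of_lt (le_of_eq ?_) hint.lt_top
    refine lintegral_congr fun ξ => ?_
    rw [← lintegral_mul_const _ (by fun_prop)]
    refine lintegral_congr fun t => ?_
    simp only [Function.uncurry, enorm_mul]
    rw [← ofReal_norm (Complex.exp _), Complex.norm_exp_ofReal_mul_I]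
    simp [enorm_eq_nnnorm]
  simp_rw [Real.fourierInv_eq', smul_eq_mul]
  rw [integral_integral_swap hI]
  refine integral_congr_ae (Eventually.of_forall fun ξ => ?_)
  beta_reduce
  rw [integral_const_mul, integral_mul_const, integral_complex_ofReal]

/-! ### One-dimensional weights and their Laplace transforms -/

/-- The weight `t^(b-1) - (t-a)_+^(b-1)`, whose Laplace transform is `Γ(b) s^(-b) (1 - e^(-as))`. -/
def diffWeight (a b t : ℝ) : ℝ :=
  t ^ (b - 1) - (Set.Ioi a).indicator (fun t => (t - a) ^ (b - 1)) t

@[fun_prop]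
lemma measurable_diffWeight (a b : ℝ) : Measurable (diffWeight a b) := by
  unfold diffWeight
  have : Measurable fun t : ℝ => (t - a) ^ (b - 1) := by fun_prop
  exact (by fun_prop : Measurable fun t : ℝ => t ^ (b - 1)).sub (this.indicator measurableSet_Ioi)

lemma diffWeight_of_le {a b t : ℝ} (h : t ≤ a) : diffWeight a b t = t ^ (b - 1) := by
  simp [diffWeight, not_lt.2 h]

lemma diffWeight_of_lt {a b t : ℝ} (h : a < t) :
    diffWeight a b t = t ^ (b - 1) - (t - a) ^ (b - 1) := by
  simp [diffWeight, h]

/-- Beyond `a` the weight is nonpositive since `b < 1`, so its absolute integral is a difference of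
primitives. Neither power alone is integrable at infinity; on `(a, a+k]` the value is `(k^b -
(a+k)^b + a^b)/b ≤ a^b/b`, and `k` tends to infinity. -/
lemma lintegral_diffWeight_Ioi_le {a b : ℝ} (ha : 0 < a) (hb : 0 < b) (hb1 : b < 1) :
    ∫⁻ t in Set.Ioi a, ‖diffWeight a b t‖ₑ ≤ ENNReal.ofReal (b⁻¹ * a ^ b) := by
  have hU : Set.Ioi a = ⋃ k : ℕ, Set.Ioc a (a + k) := by
    ext t
    simp only [Set.mem_Ioi, Set.mem_iUnion, Set.mem_Ioc, exists_and_left, iff_self_and]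
    intro _
    obtain ⟨k, hk⟩ := exists_nat_ge (t - a)
    exact ⟨k, by linarith⟩
  have hmono : Monotone fun k : ℕ => Set.Ioc a (a + k) := fun i j hij =>
    Set.Ioc_subset_Ioc_right (by gcongr)
  rw [hU, setLIntegral_iUnion_of_directed _ hmono.directed_le]
  refine iSup_le fun k => ?_
  have hM : a ≤ a + k := by simp
  have h1 : IntervalIntegrable (fun t : ℝ => t ^ (b - 1)) volume a (a + k) :=
    intervalIntegral.intervalIntegrable_rpow' (by linarith)
  have h2 : IntervalIntegrable (fun t : ℝ => (t - a) ^ (b - 1)) volume a (a + k) := by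
    have := (intervalIntegral.intervalIntegrable_rpow' (by linarith : -1 < b - 1)
      (a := 0) (b := k)).comp_sub_right a
    simpa [add_comm] using this
  have hI := h2.sub h1
  rw [intervalIntegrable_iff_integrableOn_Ioc_of_le hM] at hI
  have e : ∫⁻ t in Set.Ioc a (a + k), ‖diffWeight a b t‖ₑ
      = ∫⁻ t in Set.Ioc a (a + k), ENNReal.ofReal ((t - a) ^ (b - 1) - t ^ (b - 1)) := by
    refine setLIntegral_congr_fun measurableSet_Ioc fun t ht => ?_
    have ht' : 0 < t - a := sub_pos.2 ht.1
    have : t ^ (b - 1) ≤ (t - a) ^ (b - 1) :=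
      Real.rpow_le_rpow_of_nonpos ht' (by linarith) (by linarith)
    rw [diffWeight_of_lt ht.1, ← ofReal_norm, Real.norm_of_nonpos (by linarith)]
    congr 1; ring
  rw [e, ← ofReal_integral_eq_lintegral_ofReal hI]
  · refine ENNReal.ofReal_le_ofReal ?_
    rw [← intervalIntegral.integral_of_le hM, intervalIntegral.integral_sub h2 h1,
      intervalIntegral.integral_comp_sub_right (fun t => t ^ (b - 1)), integral_rpow
      (Or.inl (by linarith)), integral_rpow (Or.inl (by linarith)), sub_self, add_sub_cancel_left,
      sub_add_cancel, Real.zero_rpow hb.ne', sub_zero, ← sub_div, div_eq_inv_mul]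
    gcongr
    have : (k : ℝ) ^ b ≤ (a + k) ^ b := by gcongr; linarith
    linarith
  · filter_upwards [ae_restrict_mem measurableSet_Ioc] with t ht
    have ht' : 0 < t - a := sub_pos.2 ht.1
    have : t ^ (b - 1) ≤ (t - a) ^ (b - 1) :=
      Real.rpow_le_rpow_of_nonpos ht' (by linarith) (by linarith)
    simpa using this

lemma lintegral_diffWeight_ne_top {a b : ℝ} (ha : 0 < a) (hb : 0 < b) (hb1 : b < 1) :
    ∫⁻ t in Set.Ioi 0, ‖diffWeight a b t‖ₑ ≠ ∞ := by
  rw [← Set.Ioc_union_Ioi_eq_Ioi ha.le,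
    lintegral_union measurableSet_Ioi (by
      rw [Set.disjoint_left]; intro t h1 h2; exact absurd h1.2 (not_le.2 h2))]
  refine ENNReal.add_ne_top.2 ⟨?_, ne_top_of_le_ne_top ENNReal.ofReal_ne_top
    (lintegral_diffWeight_Ioi_le ha hb hb1)⟩
  have : ∫⁻ t in Set.Ioc 0 a, ‖diffWeight a b t‖ₑ
      = ∫⁻ t in Set.Ioc 0 a, ENNReal.ofReal (t ^ (b - 1)) := by
    refine setLIntegral_congr_fun measurableSet_Ioc fun t ht => ?_
    have := ht.1
    rw [diffWeight_of_le ht.2, ← ofReal_norm, Real.norm_of_nonneg (by positivity)]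
  rw [this, lintegral_Ioc_rpow hb ha.le]
  exact ENNReal.ofReal_ne_top

/-- The Gamma integral has a nonzero value, while the integral of a non-integrable function is 0. -/
lemma integrableOn_rpow_mul_exp {b s : ℝ} (hb : 0 < b) (hs : 0 < s) :
    IntegrableOn (fun t : ℝ => t ^ (b - 1) * Real.exp (-t * s)) (Set.Ioi 0) := by
  by_contra h
  have h1 := Real.integral_rpow_mul_exp_neg_mul_Ioi hb hs
  have h2 : ∫ t in Set.Ioi (0 : ℝ), t ^ (b - 1) * Real.exp (-(s * t)) = 0 := by
    refine integral_undef fun h3 => h (h3.congr (Eventually.of_forall fun t => ?_))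
    beta_reduce
    ring_nf
  rw [h2] at h1
  have : 0 < (1 / s) ^ b * Real.Gamma b := mul_pos (by positivity) (Real.Gamma_pos_of_pos hb)
  linarith

lemma integral_rpow_mul_exp {b s : ℝ} (hb : 0 < b) (hs : 0 < s) :
    ∫ t in Set.Ioi (0 : ℝ), t ^ (b - 1) * Real.exp (-t * s) = Real.Gamma b * s ^ (-b) := by
  have h1 := Real.integral_rpow_mul_exp_neg_mul_Ioi hb hs
  rw [one_div, Real.inv_rpow hs.le, ← Real.rpow_neg hs.le, mul_comm] at h1
  rw [← h1]
  refine integral_congr_ae (Eventually.of_forall fun t => ?_)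
  beta_reduce
  ring_nf

/-- The Laplace transform of `diffWeight`. -/
lemma integral_diffWeight_mul_exp {a b s : ℝ} (ha : 0 < a) (hb : 0 < b) (hs : 0 < s) :
    ∫ t in Set.Ioi (0 : ℝ), diffWeight a b t * Real.exp (-t * s)
      = Real.Gamma b * s ^ (-b) * (1 - Real.exp (-a * s)) := by
  set f : ℝ → ℝ := fun t => t ^ (b - 1) * Real.exp (-t * s) with hf
  have hfi : IntegrableOn f (Set.Ioi 0) := integrableOn_rpow_mul_exp hb hs
  set g : ℝ → ℝ := fun t => (t - a) ^ (b - 1) * Real.exp (-t * s) with hg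
  have hgf : g = fun t => Real.exp (-a * s) * f (t - a) := by
    ext t
    simp only [hg, hf]
    rw [mul_left_comm, ← Real.exp_add]; congr 2; ring
  have himg : (fun t : ℝ => t - a) ⁻¹' Set.Ioi 0 = Set.Ioi a := by ext t; simp
  have hgi : IntegrableOn g (Set.Ioi a) := by
    rw [hgf]
    refine Integrable.const_mul ?_ _
    have := (measurePreserving_sub_right volume a).integrableOn_comp_preimage
      (measurableEmbedding_subRight a) (f := f) (s := Set.Ioi 0)
    rw [himg] at this
    exact this.2 hfi
  have hgint : ∫ t in Set.Ioi a, g t = Real.exp (-a * s) * ∫ t in Set.Ioi 0, f t := by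
    rw [hgf, integral_const_mul]
    congr 1
    have := (measurePreserving_sub_right volume a).setIntegral_preimage_emb
      (measurableEmbedding_subRight a) f (Set.Ioi 0)
    rw [himg] at this
    exact this
  have e : ∀ t, diffWeight a b t * Real.exp (-t * s) = f t - (Set.Ioi a).indicator g t := by
    intro t
    by_cases h : a < t
    · rw [diffWeight_of_lt h, Set.indicator_of_mem (show t ∈ Set.Ioi a from h)]; ring
    · rw [diffWeight_of_le (not_lt.1 h), Set.indicator_of_notMem (show t ∉ Set.Ioi a from h)]; ring
  simp_rw [e]
  rw [integral_sub hfi ((integrable_indicator_iff measurableSet_Ioi).2 hgi).integrableOn,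
    setIntegral_indicator measurableSet_Ioi,
    Set.inter_eq_right.2 (Set.Ioi_subset_Ioi ha.le), hgint, integral_rpow_mul_exp hb hs]
  ring

/-- The constant `∫_0^∞ τ^(-1-b) (1 - e^(-τ)) dτ`. -/
def fracConst (b : ℝ) : ℝ := ∫ τ in Set.Ioi (0 : ℝ), τ ^ (-1 - b) * (1 - Real.exp (-τ))

/-- The integrand is at most `τ^{-b}` near 0 and `τ^{-1-b}` at infinity. -/
lemma integrableOn_fracConst {b : ℝ} (hb : 0 < b) (hb1 : b < 1) :
    IntegrableOn (fun τ : ℝ => τ ^ (-1 - b) * (1 - Real.exp (-τ))) (Set.Ioi 0) := by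
  have hm : Measurable (fun τ : ℝ => τ ^ (-1 - b) * (1 - Real.exp (-τ))) := by fun_prop
  rw [← Set.Ioc_union_Ioi_eq_Ioi zero_le_one]
  refine IntegrableOn.union ?_ ?_
  · have h : IntegrableOn (fun τ : ℝ => τ ^ (-b)) (Set.Ioc 0 1) := by
      rw [← intervalIntegrable_iff_integrableOn_Ioc_of_le zero_le_one]
      exact intervalIntegral.intervalIntegrable_rpow' (by linarith)
    refine h.mono' hm.aestronglyMeasurable ?_
    filter_upwards [ae_restrict_mem measurableSet_Ioc] with τ hτ
    have h0 := hτ.1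
    have h1 : 0 ≤ 1 - Real.exp (-τ) := by
      rw [sub_nonneg, Real.exp_le_one_iff]; linarith
    have h2 : 1 - Real.exp (-τ) ≤ τ := by have := Real.add_one_le_exp (-τ); linarith
    rw [Real.norm_of_nonneg (by positivity)]
    calc _ ≤ τ ^ (-1 - b) * τ := by gcongr
      _ = τ ^ (-b) := by
        nth_rewrite 2 [← Real.rpow_one τ]
        rw [← Real.rpow_add h0]; congr 1; ring
  · have h : IntegrableOn (fun τ : ℝ => τ ^ (-1 - b)) (Set.Ioi 1) :=
      integrableOn_Ioi_rpow_of_lt (by linarith) one_pos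
    refine h.mono' hm.aestronglyMeasurable ?_
    filter_upwards [ae_restrict_mem measurableSet_Ioi] with τ hτ
    have h0 : 0 < τ := one_pos.trans hτ
    have h1 : 0 ≤ 1 - Real.exp (-τ) := by
      rw [sub_nonneg, Real.exp_le_one_iff]; linarith
    have h2 : 1 - Real.exp (-τ) ≤ 1 := by have := Real.exp_pos (-τ); linarith
    rw [Real.norm_of_nonneg (by positivity)]
    calc _ ≤ τ ^ (-1 - b) * 1 := by gcongr
      _ = _ := mul_one _

lemma fracConst_pos {b : ℝ} (hb : 0 < b) (hb1 : b < 1) : 0 < fracConst b := by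
  have hnn : ∀ τ : ℝ, 0 < τ → 0 < τ ^ (-1 - b) * (1 - Real.exp (-τ)) := by
    intro τ hτ
    have : 0 < 1 - Real.exp (-τ) := by
      rw [sub_pos, Real.exp_lt_one_iff]; linarith
    positivity
  unfold fracConst
  rw [setIntegral_pos_iff_support_of_nonneg_ae _ (integrableOn_fracConst hb hb1)]
  · have : Set.Ioi (0 : ℝ) ⊆ Function.support (fun τ : ℝ => τ ^ (-1 - b) * (1 - Real.exp (-τ))) :=
      fun τ hτ => (hnn τ hτ).ne'
    rw [Set.inter_eq_right.2 this]
    simp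
  · filter_upwards [ae_restrict_mem measurableSet_Ioi] with τ hτ
    exact (hnn τ hτ).le

lemma integrableOn_rpow_mul_one_sub_exp {b s : ℝ} (hb : 0 < b) (hb1 : b < 1) (hs : 0 ≤ s) :
    IntegrableOn (fun τ : ℝ => τ ^ (-1 - b) * (1 - Real.exp (-τ * s))) (Set.Ioi 0) := by
  rcases hs.eq_or_lt with rfl | hs
  · simp
  have h := (integrableOn_Ioi_comp_mul_left_iff
    (fun τ : ℝ => τ ^ (-1 - b) * (1 - Real.exp (-τ))) 0 hs).2 (by
      rw [mul_zero]; exact integrableOn_fracConst hb hb1)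
  refine (h.const_mul (s ^ (1 + b))).congr ?_
  filter_upwards [ae_restrict_mem measurableSet_Ioi] with τ hτ
  have hτ : 0 < τ := hτ
  rw [Real.mul_rpow hs.le hτ.le, ← mul_assoc, ← mul_assoc, ← Real.rpow_add hs]
  simp [mul_comm]

/-- Scaling `τ ↦ sτ`. Read with `s = |2πξ|²`, it expresses a fractional power of `-Δ` through heat
differences. -/
lemma integral_rpow_mul_one_sub_exp {b s : ℝ} (hb : 0 < b) (hs : 0 ≤ s) :
    ∫ τ in Set.Ioi (0 : ℝ), τ ^ (-1 - b) * (1 - Real.exp (-τ * s)) = fracConst b * s ^ b := by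
  rcases hs.eq_or_lt with rfl | hs
  · simp [Real.zero_rpow hb.ne']
  have h := integral_comp_mul_left_Ioi
    (fun τ : ℝ => τ ^ (-1 - b) * (1 - Real.exp (-τ))) 0 hs
  rw [mul_zero, smul_eq_mul] at h
  have e : ∀ τ ∈ Set.Ioi (0 : ℝ), τ ^ (-1 - b) * (1 - Real.exp (-τ * s))
      = s ^ (1 + b) * ((s * τ) ^ (-1 - b) * (1 - Real.exp (-(s * τ)))) := by
    intro τ hτ
    have hτ : 0 < τ := hτ
    rw [Real.mul_rpow hs.le hτ.le, ← mul_assoc, ← mul_assoc, ← Real.rpow_add hs]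
    simp [mul_comm]
  rw [setIntegral_congr_fun measurableSet_Ioi e, integral_const_mul, h, fracConst, ← mul_assoc,
    mul_comm]
  congr 1
  rw [Real.rpow_add hs, Real.rpow_one]; field_simp

/-! ### Multipliers and superposition formulas on Schwartz functions -/

lemma symb_eq : (symb : Rn n → ℝ) = fun ξ => (2 * Real.pi) ^ 2 * ‖ξ‖ ^ 2 := by
  ext ξ; unfold symb; ring

lemma hasTemperateGrowth_symb : (symb : Rn n → ℝ).HasTemperateGrowth := by
  rw [symb_eq]
  fun_prop

/-- The function `y ↦ e^{-ty}` grows exponentially as `y → -∞`, so the composition is taken on the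
open half-line `y > -1`, which contains the range of `symb`. There the `k`-th derivative is at most
`t^k e^t ≤ (1+t)^N e^t` for `k ≤ N`. -/
lemma hasTemperateGrowth_exp_symb {t : ℝ} (ht : 0 < t) :
    (fun ξ : Rn n => Real.exp (-t * symb ξ)).HasTemperateGrowth := by
  have hU : UniqueDiffOn ℝ (Set.Ioi (-1 : ℝ)) := isOpen_Ioi.uniqueDiffOn
  refine Function.HasTemperateGrowth.comp' (g := fun y : ℝ => Real.exp (-t * y))
    (t := Set.Ioi (-1)) ?_ hU (by fun_prop) ?_ hasTemperateGrowth_symb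
  · rintro _ ⟨ξ, rfl⟩
    have := symb_nonneg ξ
    simp only [Set.mem_Ioi]; linarith
  · intro N
    refine ⟨0, (1 + t) ^ N * Real.exp t, by positivity, fun k hk y hy => ?_⟩
    rw [norm_iteratedFDerivWithin_eq_norm_iteratedDerivWithin,
      iteratedDerivWithin_eq_iteratedDeriv hU (by fun_prop) hy, iteratedDeriv_exp_const_mul,
      norm_mul, norm_pow, norm_neg, Real.norm_of_nonneg ht.le,
      Real.norm_of_nonneg (Real.exp_pos _).le, pow_zero, mul_one]
    have hy : -1 < y := hy
    gcongr
    · calc t ^ k ≤ (1 + t) ^ k := by gcongr; linarith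
        _ ≤ _ := by gcongr; linarith
    · nlinarith

/-- The symbol is `(1 + |x|²)⁻¹` composed with the dilation by `2πα`. -/
lemma hasTemperateGrowth_resolvent (α : ℝ) :
    (fun ξ : Rn n => (1 + α ^ 2 * symb ξ)⁻¹).HasTemperateGrowth := by
  have h : (fun ξ : Rn n => (1 + α ^ 2 * symb ξ)⁻¹)
      = (fun x : Rn n => (1 + ‖x‖ ^ 2) ^ (-1 : ℝ)) ∘
        ((2 * Real.pi * α) • ContinuousLinearMap.id ℝ (Rn n)) := by
    ext ξ
    simp only [Function.comp, smul_apply, ContinuousLinearMap.id_apply,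
      norm_smul, Real.rpow_neg_one, symb]
    congr 2
    simp only [mul_pow, Real.norm_eq_abs, sq_abs]
    ring
  rw [h]
  exact (Function.hasTemperateGrowth_one_add_norm_sq_rpow (Rn n) (-1)).comp
    (ContinuousLinearMap.hasTemperateGrowth _)

lemma fourierInv_congr {m₁ m₂ : Rn n → ℂ} (h : ∀ ξ, m₁ ξ = m₂ ξ) (x : Rn n) :
    𝓕⁻ m₁ x = 𝓕⁻ m₂ x := by
  rw [funext h]

lemma fourierInv_fourier_schwartz (φ : 𝓢(Rn n, ℂ)) : 𝓕⁻ (𝓕 (φ : Rn n → ℂ)) = φ := by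
  rw [← SchwartzMap.fourier_coe, ← SchwartzMap.fourierInv_coe, FourierTransform.fourierInv_fourier_eq]

lemma integrable_fourier_schwartz (φ : 𝓢(Rn n, ℂ)) : Integrable (𝓕 (φ : Rn n → ℂ)) := by
  rw [← SchwartzMap.fourier_coe]
  exact SchwartzMap.integrable _

/-- Fourier multipliers of temperate growth act on Schwartz functions. -/
lemma exists_schwartz_multiplier {g : Rn n → ℝ} (hg : g.HasTemperateGrowth) (φ : 𝓢(Rn n, ℂ)) :
    ∃ Φ : 𝓢(Rn n, ℂ), 𝓕 (Φ : Rn n → ℂ) = fun ξ => (g ξ : ℂ) * 𝓕 (φ : Rn n → ℂ) ξ := by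
  refine ⟨SchwartzMap.fourierMultiplierCLM ℂ g φ, ?_⟩
  rw [SchwartzMap.fourierMultiplierCLM_apply, ← SchwartzMap.fourier_coe,
    FourierTransform.fourier_fourierInv_eq, SchwartzMap.smulLeftCLM_apply hg]
  ext ξ
  rw [SchwartzMap.fourier_coe]
  simp

lemma fourier_laplacian (φ : 𝓢(Rn n, ℂ)) (ξ : Rn n) :
    𝓕 ((Δ φ : 𝓢(Rn n, ℂ)) : Rn n → ℂ) ξ = -(symb ξ : ℂ) * 𝓕 (φ : Rn n → ℂ) ξ := by
  rw [SchwartzMap.laplacian_eq_fourierMultiplierCLM, ← SchwartzMap.fourier_coe,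
    SchwartzMap.fourierMultiplierCLM_apply, FourierTransform.fourier_smul,
    FourierTransform.fourier_fourierInv_eq, smul_apply,
    SchwartzMap.smulLeftCLM_apply_apply (by fun_prop), SchwartzMap.fourier_coe, symb_eq]
  simp only [Complex.real_smul]
  push_cast
  ring

lemma heat_schwartz {t : ℝ} (ht : 0 < t) (φ : 𝓢(Rn n, ℂ)) (x : Rn n) :
    heat t φ x = 𝓕⁻ (fun ξ => (Real.exp (-t * symb ξ) : ℂ) * 𝓕 (φ : Rn n → ℂ) ξ) x := by
  rw [← heat_fourierInv ht (integrable_fourier_schwartz φ), fourierInv_fourier_schwartz]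

/-- The heat semigroup preserves Schwartz functions. -/
lemma exists_schwartz_heat {t : ℝ} (ht : 0 < t) (φ : 𝓢(Rn n, ℂ)) :
    ∃ Φ : 𝓢(Rn n, ℂ), (Φ : Rn n → ℂ) = heat t φ ∧
      𝓕 (Φ : Rn n → ℂ) = fun ξ => (Real.exp (-t * symb ξ) : ℂ) * 𝓕 (φ : Rn n → ℂ) ξ := by
  obtain ⟨Φ, hΦ⟩ := exists_schwartz_multiplier (hasTemperateGrowth_exp_symb ht) φ
  refine ⟨Φ, ?_, hΦ⟩
  ext x
  rw [heat_schwartz ht, ← hΦ, fourierInv_fourier_schwartz]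

lemma heat_heat_schwartz {s t : ℝ} (hs : 0 < s) (ht : 0 < t) (φ : 𝓢(Rn n, ℂ)) :
    heat s (heat t φ) = heat (s + t) φ := by
  obtain ⟨Φ, hΦ, hΦ'⟩ := exists_schwartz_heat ht φ
  ext x
  rw [← hΦ, heat_schwartz hs, hΦ', heat_schwartz (by positivity)]
  refine fourierInv_congr (fun ξ => ?_) x
  rw [← mul_assoc, ← Complex.ofReal_mul, ← Real.exp_add]
  congr 3
  ring

lemma integrable_symb_mul_fourier (φ : 𝓢(Rn n, ℂ)) :
    Integrable (fun ξ => (symb ξ : ℂ) * 𝓕 (φ : Rn n → ℂ) ξ) := by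
  refine (integrable_fourier_schwartz (Δ φ)).neg.congr (Eventually.of_forall fun ξ => ?_)
  simp [fourier_laplacian]

lemma integrable_symb_rpow_mul_fourier {b : ℝ} (hb : 0 < b) (hb1 : b < 1) (φ : 𝓢(Rn n, ℂ)) :
    Integrable (fun ξ => ((symb ξ ^ b : ℝ) : ℂ) * 𝓕 (φ : Rn n → ℂ) ξ) := by
  have h1 := (integrable_fourier_schwartz φ).norm.add (integrable_symb_mul_fourier φ).norm
  refine h1.mono' ?_ (Eventually.of_forall fun ξ => ?_)
  · have : Measurable fun ξ : Rn n => ((symb ξ ^ b : ℝ) : ℂ) := by fun_prop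
    exact this.aestronglyMeasurable.mul (integrable_fourier_schwartz φ).1
  · have h0 := symb_nonneg ξ
    have h2 : symb ξ ^ b ≤ 1 + symb ξ := by
      rcases le_total (symb ξ) 1 with h | h
      · have := Real.rpow_le_one h0 h hb.le; linarith
      · have := Real.rpow_le_rpow_of_exponent_le h hb1.le
        rw [Real.rpow_one] at this; linarith
    simp only [Pi.add_apply, norm_mul, Complex.norm_real]
    rw [Real.norm_of_nonneg h0, Real.norm_of_nonneg (by positivity)]
    nlinarith [norm_nonneg (𝓕 (φ : Rn n → ℂ) ξ)]

/-- In terms of the symbol of `-Δ` the order halves, hence the exponent `β/2` throughout. -/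
lemma lambdaSchwartz_eq {β : ℝ} (φ : 𝓢(Rn n, ℂ)) : lambdaSchwartz β φ =
    𝓕⁻ (fun ξ : Rn n => ((symb ξ ^ (β / 2) : ℝ) : ℂ) * 𝓕 (φ : Rn n → ℂ) ξ) := by
  unfold lambdaSchwartz
  congr 1
  ext ξ
  congr 2
  unfold symb
  rw [← Real.rpow_natCast, ← Real.rpow_mul (by positivity)]
  congr 1
  push_cast; ring

/-- `Λ^β` commutes with the heat semigroup. -/
lemma lambdaSchwartz_heat {β t : ℝ} (hb : 0 < β) (hb1 : β < 1) (ht : 0 < t) {φ Φ : 𝓢(Rn n, ℂ)}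
    (hΦ : 𝓕 (Φ : Rn n → ℂ) = fun ξ => (Real.exp (-t * symb ξ) : ℂ) * 𝓕 (φ : Rn n → ℂ) ξ) :
    lambdaSchwartz β Φ = heat t (lambdaSchwartz β φ) := by
  ext x
  rw [lambdaSchwartz_eq, lambdaSchwartz_eq, heat_fourierInv ht
    (integrable_symb_rpow_mul_fourier (by linarith) (by linarith) φ), hΦ]
  refine fourierInv_congr (fun ξ => ?_) x
  ring

lemma continuous_fourierInv {m : Rn n → ℂ} (hm : Integrable m) : Continuous (𝓕⁻ m) := by
  have : 𝓕⁻ m = fun x => 𝓕 m (-x) := by ext x; exact Real.fourierInv_eq_fourier_neg m x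
  rw [this]
  exact (VectorFourier.fourierIntegral_continuous Real.continuous_fourierChar
    (by exact continuous_inner) hm).comp continuous_neg

lemma continuous_lambdaSchwartz {β : ℝ} (hb : 0 < β) (hb1 : β < 1) (φ : 𝓢(Rn n, ℂ)) :
    Continuous (lambdaSchwartz β φ) := by
  rw [lambdaSchwartz_eq]
  exact continuous_fourierInv (integrable_symb_rpow_mul_fourier (by linarith) (by linarith) φ)

lemma fourierInv_sub_apply {m₁ m₂ : Rn n → ℂ} (h₁ : Integrable m₁) (h₂ : Integrable m₂) (x : Rn n) :
    𝓕⁻ (fun ξ => m₁ ξ - m₂ ξ) x = 𝓕⁻ m₁ x - 𝓕⁻ m₂ x := by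
  simp_rw [Real.fourierInv_eq', smul_eq_mul, mul_sub]
  rw [integral_sub]
  · exact h₁.bdd_mul (c := 1) (by fun_prop)
      (Eventually.of_forall fun z => by rw [Complex.norm_exp_ofReal_mul_I])
  · exact h₂.bdd_mul (c := 1) (by fun_prop)
      (Eventually.of_forall fun z => by rw [Complex.norm_exp_ofReal_mul_I])

lemma sub_heat_schwartz {t : ℝ} (ht : 0 < t) (φ : 𝓢(Rn n, ℂ)) (x : Rn n) :
    φ x - heat t φ x =
      𝓕⁻ (fun ξ => ((1 - Real.exp (-t * symb ξ) : ℝ) : ℂ) * 𝓕 (φ : Rn n → ℂ) ξ) x := by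
  have h := fourierInv_sub_apply (integrable_fourier_schwartz φ)
    (integrable_exp_symb_mul ht.le (integrable_fourier_schwartz φ)) x
  rw [fourierInv_fourier_schwartz, ← heat_schwartz ht] at h
  rw [← h]
  refine fourierInv_congr (fun ξ => ?_) x
  push_cast; ring

/-- `φ - e^{τΔ} φ = - ∫_0^τ e^{σΔ} Δφ dσ`. -/
lemma sub_heat_schwartz_eq_integral {τ : ℝ} (hτ : 0 < τ) (φ : 𝓢(Rn n, ℂ)) (x : Rn n) :
    φ x - heat τ φ x = -∫ σ in Set.Ioc 0 τ, heat σ (Δ φ : 𝓢(Rn n, ℂ)) x := by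
  have h := integral_fourierInv (μ := volume.restrict (Set.Ioc 0 τ))
    (κ := fun σ ξ => Real.exp (-σ * symb ξ)) (m := 𝓕 ((Δ φ : 𝓢(Rn n, ℂ)) : Rn n → ℂ))
    (by simp only [Function.uncurry_def]; fun_prop) (integrable_fourier_schwartz _).1 ?_ x
  · have e1 : ∫ σ in Set.Ioc 0 τ, heat σ (Δ φ : 𝓢(Rn n, ℂ)) x = ∫ σ in Set.Ioc 0 τ,
        𝓕⁻ (fun ξ => (Real.exp (-σ * symb ξ) : ℂ) * 𝓕 ((Δ φ : 𝓢(Rn n, ℂ)) : Rn n → ℂ) ξ) x :=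
      setIntegral_congr_fun measurableSet_Ioc fun σ hσ => heat_schwartz hσ.1 _ x
    rw [e1, h, sub_heat_schwartz hτ, Real.fourierInv_eq', Real.fourierInv_eq', ← integral_neg]
    refine integral_congr_ae (Eventually.of_forall fun ξ => ?_)
    simp only [smul_eq_mul, fourier_laplacian]
    have e2 : symb ξ * ∫ σ in Set.Ioc 0 τ, Real.exp (-σ * symb ξ) = 1 - Real.exp (-τ * symb ξ) := by
      rw [← intervalIntegral.integral_of_le hτ.le, ← intervalIntegral.integral_const_mul]
      have hd : ∀ σ ∈ Set.uIcc 0 τ, HasDerivAt (fun σ => -Real.exp (-σ * symb ξ))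
          (symb ξ * Real.exp (-σ * symb ξ)) σ := by
        intro σ _
        have := (((hasDerivAt_id σ).neg.mul_const (symb ξ)).exp).neg
        refine this.congr_deriv ?_
        simp; ring
      rw [intervalIntegral.integral_eq_sub_of_hasDerivAt hd
        (Continuous.intervalIntegrable (by fun_prop) _ _)]
      simp; ring
    rw [← e2]
    push_cast; ring
  · have hle : ∀ ξ : Rn n, ∫⁻ σ in Set.Ioc 0 τ, ‖Real.exp (-σ * symb ξ)‖ₑ ≤ ENNReal.ofReal τ := by
      intro ξ
      calc _ ≤ ∫⁻ σ in Set.Ioc 0 τ, 1 := by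
            refine setLIntegral_mono measurable_const fun σ hσ => ?_
            rw [← ofReal_norm, Real.norm_of_nonneg (Real.exp_pos _).le, ← ENNReal.ofReal_one]
            exact ENNReal.ofReal_le_ofReal (exp_neg_mul_symb_le_one hσ.1.le ξ)
        _ = _ := by simp
    refine ne_top_of_le_ne_top (b := ENNReal.ofReal τ *
      ∫⁻ ξ, ‖𝓕 ((Δ φ : 𝓢(Rn n, ℂ)) : Rn n → ℂ) ξ‖ₑ) ?_ ?_
    · exact ENNReal.mul_ne_top ENNReal.ofReal_ne_top
        (integrable_fourier_schwartz (Δ φ)).hasFiniteIntegral.ne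
    · rw [← lintegral_const_mul' _ _ ENNReal.ofReal_ne_top]
      exact lintegral_mono fun ξ => mul_le_mul_left (hle ξ) _

lemma const_mul_fourierInv (c : ℂ) (m : Rn n → ℂ) (x : Rn n) :
    𝓕⁻ (fun ξ => c * m ξ) x = c * 𝓕⁻ m x := by
  simp_rw [Real.fourierInv_eq', smul_eq_mul]
  rw [← integral_const_mul]
  exact integral_congr_ae (Eventually.of_forall fun ξ => by beta_reduce; ring)

/-- `Λ^β φ` as a superposition of heat differences. -/
lemma lambdaSchwartz_eq_integral {β : ℝ} (hb : 0 < β) (hb1 : β < 1) (φ : 𝓢(Rn n, ℂ)) (x : Rn n) :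
    (fracConst (β / 2) : ℂ) * lambdaSchwartz β φ x =
      ∫ τ in Set.Ioi (0 : ℝ), ((τ ^ (-1 - β / 2) : ℝ) : ℂ) * (φ x - heat τ φ x) := by
  have hb2 : 0 < β / 2 := by linarith
  have hb21 : β / 2 < 1 := by linarith
  have hF := fracConst_pos hb2 hb21
  have h := integral_fourierInv (μ := volume.restrict (Set.Ioi (0 : ℝ)))
    (κ := fun τ (ξ : Rn n) => τ ^ (-1 - β / 2) * (1 - Real.exp (-τ * symb ξ)))
    (m := 𝓕 (φ : Rn n → ℂ))
    (by simp only [Function.uncurry_def]; fun_prop) (integrable_fourier_schwartz φ).1 ?_ x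
  · have e1 : ∫ τ in Set.Ioi (0 : ℝ), ((τ ^ (-1 - β / 2) : ℝ) : ℂ) * (φ x - heat τ φ x)
        = ∫ τ in Set.Ioi (0 : ℝ), 𝓕⁻ (fun ξ =>
          ((τ ^ (-1 - β / 2) * (1 - Real.exp (-τ * symb ξ)) : ℝ) : ℂ) * 𝓕 (φ : Rn n → ℂ) ξ) x := by
      refine setIntegral_congr_fun measurableSet_Ioi fun τ hτ => ?_
      beta_reduce
      rw [sub_heat_schwartz hτ, ← const_mul_fourierInv]
      refine fourierInv_congr (fun ξ => ?_) x; push_cast; ring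
    rw [e1, h, lambdaSchwartz_eq, ← const_mul_fourierInv]
    refine fourierInv_congr (fun ξ => ?_) x
    rw [integral_rpow_mul_one_sub_exp hb2 (symb_nonneg ξ)]
    push_cast; ring
  · have e : ∀ ξ : Rn n, ∫⁻ τ in Set.Ioi (0 : ℝ), ‖τ ^ (-1 - β / 2) * (1 - Real.exp (-τ * symb ξ))‖ₑ
        = ENNReal.ofReal (fracConst (β / 2) * symb ξ ^ (β / 2)) := by
      intro ξ
      rw [← integral_rpow_mul_one_sub_exp hb2 (symb_nonneg ξ), ofReal_integral_eq_lintegral_ofReal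
        (integrableOn_rpow_mul_one_sub_exp hb2 hb21 (symb_nonneg ξ))]
      · refine setLIntegral_congr_fun measurableSet_Ioi fun τ hτ => ?_
        have hτ : 0 < τ := hτ
        rw [← ofReal_norm, Real.norm_of_nonneg]
        have := exp_neg_mul_symb_le_one hτ.le ξ
        have : 0 ≤ 1 - Real.exp (-τ * symb ξ) := by linarith
        positivity
      · filter_upwards [ae_restrict_mem measurableSet_Ioi] with τ hτ
        have hτ : 0 < τ := hτ
        have := exp_neg_mul_symb_le_one hτ.le ξ
        have : 0 ≤ 1 - Real.exp (-τ * symb ξ) := by linarith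
        simp only [Pi.zero_apply]
        positivity
    have h2 := ((integrable_symb_rpow_mul_fourier hb2 hb21 φ).const_mul
      (fracConst (β / 2) : ℂ)).hasFiniteIntegral
    refine ne_of_lt (lt_of_le_of_lt (le_of_eq ?_) h2)
    refine lintegral_congr fun ξ => ?_
    rw [e, enorm_mul, enorm_mul, ← mul_assoc]
    congr 1
    have := symb_nonneg ξ
    rw [← enorm_mul, ← Complex.ofReal_mul, ← ofReal_norm, Complex.norm_real,
      Real.norm_of_nonneg (by positivity)]

/-- `φ - e^{aΔ} φ` as a superposition of `e^{tΔ} Λ^β φ`. -/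
lemma sub_heat_eq_integral_lambda {β a : ℝ} (hb : 0 < β) (hb1 : β < 1) (ha : 0 < a)
    (φ : 𝓢(Rn n, ℂ)) (x : Rn n) :
    (Real.Gamma (β / 2) : ℂ) * (φ x - heat a φ x) =
      ∫ t in Set.Ioi (0 : ℝ), (diffWeight a (β / 2) t : ℂ) * heat t (lambdaSchwartz β φ) x := by
  have hb2 : 0 < β / 2 := by linarith
  have hb21 : β / 2 < 1 := by linarith
  have hI := integrable_symb_rpow_mul_fourier hb2 hb21 φ
  have h := integral_fourierInv (μ := volume.restrict (Set.Ioi (0 : ℝ)))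
    (κ := fun t (ξ : Rn n) => diffWeight a (β / 2) t * Real.exp (-t * symb ξ))
    (m := fun ξ : Rn n => ((symb ξ ^ (β / 2) : ℝ) : ℂ) * 𝓕 (φ : Rn n → ℂ) ξ)
    (by simp only [Function.uncurry_def]; fun_prop) hI.1 ?_ x
  · have e1 : ∫ t in Set.Ioi (0 : ℝ), (diffWeight a (β / 2) t : ℂ) * heat t (lambdaSchwartz β φ) x
        = ∫ t in Set.Ioi (0 : ℝ), 𝓕⁻ (fun ξ =>
          ((diffWeight a (β / 2) t * Real.exp (-t * symb ξ) : ℝ) : ℂ) *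
            (((symb ξ ^ (β / 2) : ℝ) : ℂ) * 𝓕 (φ : Rn n → ℂ) ξ)) x := by
      refine setIntegral_congr_fun measurableSet_Ioi fun t ht => ?_
      beta_reduce
      rw [lambdaSchwartz_eq, heat_fourierInv ht hI, ← const_mul_fourierInv]
      refine fourierInv_congr (fun ξ => ?_) x; push_cast; ring
    rw [e1, h, sub_heat_schwartz ha, ← const_mul_fourierInv]
    refine fourierInv_congr (fun ξ => ?_) x
    -- At frequency zero the Laplace transform formula is not available, but both sides vanish
    -- there.
    rcases (symb_nonneg ξ).eq_or_lt with h0 | h0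
    · rw [← h0]; simp [Real.zero_rpow hb2.ne']
    · rw [integral_diffWeight_mul_exp ha hb2 h0, ← mul_assoc, ← mul_assoc, ← Complex.ofReal_mul,
        ← Complex.ofReal_mul]
      congr 2
      have : symb ξ ^ (-(β / 2)) * symb ξ ^ (β / 2) = 1 := by
        rw [← Real.rpow_add h0]; simp
      linear_combination (-(Real.Gamma (β / 2)) * (1 - Real.exp (-a * symb ξ))) * this
  · have hle : ∀ ξ : Rn n, ∫⁻ t in Set.Ioi (0 : ℝ),
        ‖diffWeight a (β / 2) t * Real.exp (-t * symb ξ)‖ₑ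
        ≤ ∫⁻ t in Set.Ioi (0 : ℝ), ‖diffWeight a (β / 2) t‖ₑ := by
      intro ξ
      refine setLIntegral_mono (by fun_prop) fun t ht => ?_
      have ht : 0 < t := ht
      rw [enorm_mul]
      calc _ ≤ ‖diffWeight a (β / 2) t‖ₑ * 1 := by
            gcongr
            rw [← ofReal_norm, Real.norm_of_nonneg (Real.exp_pos _).le, ← ENNReal.ofReal_one]
            exact ENNReal.ofReal_le_ofReal (exp_neg_mul_symb_le_one ht.le ξ)
        _ = _ := mul_one _
    have hW := lintegral_diffWeight_ne_top ha hb2 hb21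
    refine ne_top_of_le_ne_top (ENNReal.mul_ne_top hW hI.hasFiniteIntegral.ne) ?_
    rw [← lintegral_const_mul' _ _ hW]
    exact lintegral_mono fun ξ => mul_le_mul_left (hle ξ) _

/-- The Helmholtz equation is solvable in the Schwartz space, and the solution is an average of the
heat semigroup. -/
lemma exists_schwartz_resolvent {α : ℝ} (hα : 0 < α) (φ : 𝓢(Rn n, ℂ)) :
    ∃ ψ : 𝓢(Rn n, ℂ), (∀ x, ψ x - (α : ℂ) ^ 2 * (Δ ψ : 𝓢(Rn n, ℂ)) x = φ x) ∧
      ∀ x, ψ x = ∫ r in Set.Ioi (0 : ℝ), (Real.exp (-r) : ℂ) * heat (r * α ^ 2) φ x := by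
  obtain ⟨ψ, hψ⟩ := exists_schwartz_multiplier (hasTemperateGrowth_resolvent α) φ
  have hpos : ∀ ξ : Rn n, 0 < 1 + α ^ 2 * symb ξ := fun ξ => by
    have := symb_nonneg ξ; positivity
  refine ⟨ψ, fun x => ?_, fun x => ?_⟩
  · have h := fourierInv_sub_apply (integrable_fourier_schwartz ψ)
      ((integrable_fourier_schwartz (Δ ψ)).const_mul ((α : ℂ) ^ 2)) x
    rw [const_mul_fourierInv, fourierInv_fourier_schwartz, fourierInv_fourier_schwartz] at h
    rw [← h]
    conv_rhs => rw [← fourierInv_fourier_schwartz φ]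
    refine fourierInv_congr (fun ξ => ?_) x
    rw [fourier_laplacian, hψ]
    have h1 : ((1 + α ^ 2 * symb ξ : ℝ) : ℂ) ≠ 0 := by exact_mod_cast (hpos ξ).ne'
    have h2 : (((1 + α ^ 2 * symb ξ)⁻¹ : ℝ) : ℂ) * ((1 + α ^ 2 * symb ξ : ℝ) : ℂ) = 1 := by
      rw [Complex.ofReal_inv, inv_mul_cancel₀ h1]
    push_cast at h2 ⊢
    linear_combination 𝓕 (φ : Rn n → ℂ) ξ * h2
  · have h := integral_fourierInv (μ := volume.restrict (Set.Ioi (0 : ℝ)))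
      (κ := fun r (ξ : Rn n) => Real.exp (-r) * Real.exp (-(r * α ^ 2) * symb ξ))
      (m := 𝓕 (φ : Rn n → ℂ))
      (by simp only [Function.uncurry_def]; fun_prop) (integrable_fourier_schwartz φ).1 ?_ x
    · have e1 : ∫ r in Set.Ioi (0 : ℝ), (Real.exp (-r) : ℂ) * heat (r * α ^ 2) φ x
          = ∫ r in Set.Ioi (0 : ℝ), 𝓕⁻ (fun ξ =>
            ((Real.exp (-r) * Real.exp (-(r * α ^ 2) * symb ξ) : ℝ) : ℂ) *
              𝓕 (φ : Rn n → ℂ) ξ) x := by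
        refine setIntegral_congr_fun measurableSet_Ioi fun r hr => ?_
        have hr : 0 < r := hr
        beta_reduce
        rw [heat_schwartz (by positivity), ← const_mul_fourierInv]
        refine fourierInv_congr (fun ξ => ?_) x; push_cast; ring
      rw [e1, h]
      conv_lhs => rw [← fourierInv_fourier_schwartz ψ, hψ]
      refine fourierInv_congr (fun ξ => ?_) x
      congr 2
      have e2 : ∀ r : ℝ, Real.exp (-r) * Real.exp (-(r * α ^ 2) * symb ξ)
          = Real.exp (-(1 + α ^ 2 * symb ξ) * r) := by
        intro r; rw [← Real.exp_add]; congr 1; ring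
      simp_rw [e2]
      rw [integral_exp_mul_Ioi (by linarith [hpos ξ])]
      rw [mul_zero, Real.exp_zero, neg_div_neg_eq, one_div]
    · have hle : ∀ ξ : Rn n, ∫⁻ r in Set.Ioi (0 : ℝ),
          ‖Real.exp (-r) * Real.exp (-(r * α ^ 2) * symb ξ)‖ₑ ≤ 1 := by
        intro ξ
        calc _ ≤ ∫⁻ r in Set.Ioi (0 : ℝ), ENNReal.ofReal (Real.exp (-r)) := by
              refine setLIntegral_mono (by fun_prop) fun r hr => ?_
              have hr : 0 < r := hr
              rw [← ofReal_norm, Real.norm_of_nonneg (by positivity)]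
              refine ENNReal.ofReal_le_ofReal ?_
              exact mul_le_of_le_one_right (Real.exp_pos _).le
                (exp_neg_mul_symb_le_one (by positivity) ξ)
          _ = 1 := by
              rw [← ofReal_integral_eq_lintegral_ofReal (integrableOn_exp_neg_Ioi 0)
                (Eventually.of_forall fun r => (Real.exp_pos _).le), integral_exp_neg_Ioi_zero,
                ENNReal.ofReal_one]
      refine ne_top_of_le_ne_top (integrable_fourier_schwartz φ).hasFiniteIntegral.ne ?_
      refine lintegral_mono fun ξ => ?_
      calc _ ≤ 1 * ‖𝓕 (φ : Rn n → ℂ) ξ‖ₑ := by gcongr; exact hle ξ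
        _ = _ := one_mul _

/-! ### Pairings with `L^p` -/

variable {p q : ℝ≥0∞}

/-- `F` pairs boundedly with `L^p`. -/
def DualBdd (p : ℝ≥0∞) (F : Rn n → ℂ) : Prop :=
  Measurable F ∧ ∃ K : ℝ≥0∞, K ≠ ∞ ∧ ∀ W : Rn n → ℝ≥0∞, Measurable W →
    ∫⁻ x, W x * ‖F x‖ₑ ≤ K * eLpNorm W p volume

/-- Hölder's inequality, with the sup norm of `φ` for `p = 1` and its norm at the conjugate exponent
otherwise. -/
lemma dualBdd_schwartz (hp : 1 ≤ p) (hp' : p ≠ ∞) (φ : 𝓢(Rn n, ℂ)) : DualBdd p φ := by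
  refine ⟨φ.continuous.measurable, ?_⟩
  have hφm : Measurable φ := φ.continuous.measurable
  rcases hp.eq_or_lt with rfl | hp
  · refine ⟨ENNReal.ofReal (SchwartzMap.seminorm ℝ 0 0 φ), ENNReal.ofReal_ne_top, fun W hW => ?_⟩
    rw [eLpNorm_one_eq_lintegral_enorm, ← lintegral_const_mul _ (by fun_prop)]
    refine lintegral_mono fun x => ?_
    rw [mul_comm, enorm_eq_self]
    gcongr
    rw [← ofReal_norm]
    exact ENNReal.ofReal_le_ofReal (SchwartzMap.norm_le_seminorm ℝ φ x)
  · have hP : 1 < p.toReal := by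
      simpa using (ENNReal.toReal_lt_toReal ENNReal.one_ne_top hp').2 hp
    have hpq := Real.HolderConjugate.conjExponent hP
    have hq0 : 0 < p.toReal.conjExponent := hpq.symm.pos
    refine ⟨(∫⁻ x, ‖φ x‖ₑ ^ p.toReal.conjExponent) ^ (1 / p.toReal.conjExponent), ?_,
      fun W hW => ?_⟩
    · have h := (φ.memLp (ENNReal.ofReal p.toReal.conjExponent) volume).eLpNorm_ne_top
      rw [eLpNorm_eq_lintegral_rpow_enorm_toReal (by simpa using hq0) ENNReal.ofReal_ne_top,
        ENNReal.toReal_ofReal hq0.le] at h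
      exact h
    · have h := ENNReal.lintegral_mul_le_Lp_mul_Lq volume hpq (f := W) (g := fun x => ‖φ x‖ₑ)
        hW.aemeasurable (by fun_prop)
      rw [← eLpNorm_eq_lintegral hp.le hp', mul_comm (eLpNorm W p volume)] at h
      exact h

lemma eLpNorm_enorm_comp (V : Rn n → ℂ) :
    eLpNorm (fun x => ‖V x‖ₑ) p volume = eLpNorm V p volume :=
  eLpNorm_congr_enorm_ae (Eventually.of_forall fun x => by simp)

/-- `Λ^β φ` is in general not Schwartz, its symbol being singular at 0, yet it must pair with `L^p`.
Its representation by heat differences gives this without pointwise decay: the pairing with `φ -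
e^{τΔ}φ` is bounded by a constant and by a multiple of `τ`, so `τ^{-1-β/2}` times it is integrable.
-/
lemma dualBdd_lambdaSchwartz (hp : 1 ≤ p) (hp' : p ≠ ∞) {β : ℝ} (hb : 0 < β) (hb1 : β < 1)
    (φ : 𝓢(Rn n, ℂ)) : DualBdd p (lambdaSchwartz β φ) := by
  have hΛm : Measurable (lambdaSchwartz β φ) := (continuous_lambdaSchwartz hb hb1 φ).measurable
  refine ⟨hΛm, ?_⟩
  obtain ⟨hφm, K₀, hK₀, hW₀⟩ := dualBdd_schwartz hp hp' φ
  obtain ⟨hΔm, K₁, hK₁, hW₁⟩ := dualBdd_schwartz hp hp' (Δ φ)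
  have hb2 : 0 < β / 2 := by linarith
  have hb21 : β / 2 < 1 := by linarith
  have hF := fracConst_pos hb2 hb21
  -- The bound for large `τ`: the semigroup is moved onto `W`, where it contracts `L^p`.
  have B₀ : ∀ τ : ℝ, 0 < τ → ∀ W : Rn n → ℝ≥0∞, Measurable W →
      ∫⁻ x, W x * ‖φ x - heat τ φ x‖ₑ ≤ 2 * K₀ * eLpNorm W p volume := by
    intro τ hτ W hW
    calc _ ≤ ∫⁻ x, (W x * ‖φ x‖ₑ + W x * lheat τ (fun y => ‖φ y‖ₑ) x) := by
          refine lintegral_mono fun x => ?_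
          rw [← mul_add]
          gcongr
          exact (enorm_sub_le).trans (by gcongr; exact enorm_heat_le hτ _ x)
      _ = (∫⁻ x, W x * ‖φ x‖ₑ) + ∫⁻ x, lheat τ W x * ‖φ x‖ₑ := by
          rw [lintegral_add_left (by fun_prop), lintegral_mul_lheat τ (by fun_prop) hW]
      _ ≤ K₀ * eLpNorm W p volume + K₀ * eLpNorm (lheat τ W) p volume :=
          add_le_add (hW₀ W hW) (hW₀ _ (by fun_prop))
      _ ≤ K₀ * eLpNorm W p volume + K₀ * eLpNorm W p volume := by
          gcongr; exact eLpNorm_lheat_le_self hτ hp hp' hW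
      _ = _ := by ring
  -- The bound for small `τ`, from `φ - e^{τΔ}φ = -∫₀^τ e^{σΔ}Δφ dσ`.
  have B₁ : ∀ τ : ℝ, 0 < τ → ∀ W : Rn n → ℝ≥0∞, Measurable W →
      ∫⁻ x, W x * ‖φ x - heat τ φ x‖ₑ ≤ ENNReal.ofReal τ * (K₁ * eLpNorm W p volume) := by
    intro τ hτ W hW
    calc _ ≤ ∫⁻ x, ∫⁻ σ in Set.Ioc 0 τ, W x * lheat σ (fun y => ‖(Δ φ : 𝓢(Rn n, ℂ)) y‖ₑ) x := by
          refine lintegral_mono fun x => ?_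
          rw [lintegral_const_mul _ (by fun_prop)]
          gcongr
          rw [sub_heat_schwartz_eq_integral hτ, enorm_neg]
          refine (enorm_integral_le_lintegral_enorm _).trans ?_
          exact setLIntegral_mono (by fun_prop) fun σ hσ => enorm_heat_le hσ.1 _ x
      _ = ∫⁻ σ in Set.Ioc 0 τ, ∫⁻ x, W x * lheat σ (fun y => ‖(Δ φ : 𝓢(Rn n, ℂ)) y‖ₑ) x := by
          rw [lintegral_lintegral_swap]
          apply Measurable.aemeasurable
          simp only [Function.uncurry_def]
          fun_prop
      _ ≤ ∫⁻ σ in Set.Ioc 0 τ, K₁ * eLpNorm W p volume := by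
          refine setLIntegral_mono measurable_const fun σ hσ => ?_
          rw [lintegral_mul_lheat σ (by fun_prop) hW]
          refine (hW₁ _ (by fun_prop)).trans ?_
          gcongr; exact eLpNorm_lheat_le_self hσ.1 hp hp' hW
      _ = _ := by simp [mul_comm]
  refine ⟨ENNReal.ofReal (fracConst (β / 2))⁻¹ * (ENNReal.ofReal ((1 - β / 2)⁻¹ * 1 ^ (1 - β / 2))
    * K₁ + ENNReal.ofReal ((β / 2)⁻¹ * 1 ^ (-(β / 2))) * (2 * K₀)), ?_, fun W hW => ?_⟩
  · refine ENNReal.mul_ne_top ENNReal.ofReal_ne_top (ENNReal.add_ne_top.2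
      ⟨ENNReal.mul_ne_top ENNReal.ofReal_ne_top hK₁, ENNReal.mul_ne_top ENNReal.ofReal_ne_top
        (ENNReal.mul_ne_top (by simp) hK₀)⟩)
  have hmeas : Measurable (fun z : Rn n × ℝ => W z.1 *
      (ENNReal.ofReal (z.2 ^ (-1 - β / 2)) * ‖φ z.1 - heat z.2 φ z.1‖ₑ)) := by fun_prop
  calc ∫⁻ x, W x * ‖lambdaSchwartz β φ x‖ₑ
      ≤ ∫⁻ x, ENNReal.ofReal (fracConst (β / 2))⁻¹ * ∫⁻ τ in Set.Ioi (0 : ℝ), W x *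
        (ENNReal.ofReal (τ ^ (-1 - β / 2)) * ‖φ x - heat τ φ x‖ₑ) := by
        refine lintegral_mono fun x => ?_
        rw [lintegral_const_mul _ (by fun_prop), mul_left_comm]
        gcongr
        have h1 : lambdaSchwartz β φ x = ((fracConst (β / 2))⁻¹ : ℝ) *
            ∫ τ in Set.Ioi (0 : ℝ), ((τ ^ (-1 - β / 2) : ℝ) : ℂ) * (φ x - heat τ φ x) := by
          rw [← lambdaSchwartz_eq_integral hb hb1, ← mul_assoc, ← Complex.ofReal_mul,
            inv_mul_cancel₀ hF.ne', Complex.ofReal_one, one_mul]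
        rw [h1, enorm_mul]
        gcongr
        · rw [← ofReal_norm, Complex.norm_real, Real.norm_of_nonneg (by positivity)]
        · refine (enorm_integral_le_lintegral_enorm _).trans ?_
          refine setLIntegral_mono (by fun_prop) fun τ hτ => ?_
          have hτ : 0 < τ := hτ
          rw [enorm_mul, ← ofReal_norm, Complex.norm_real, Real.norm_of_nonneg (by positivity)]
    _ = ENNReal.ofReal (fracConst (β / 2))⁻¹ * ∫⁻ τ in Set.Ioi (0 : ℝ), ∫⁻ x, W x *
        (ENNReal.ofReal (τ ^ (-1 - β / 2)) * ‖φ x - heat τ φ x‖ₑ) := by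
        rw [lintegral_const_mul _ (Measurable.lintegral_prod_right hmeas),
          lintegral_lintegral_swap hmeas.aemeasurable]
    _ = ENNReal.ofReal (fracConst (β / 2))⁻¹ * ∫⁻ τ in Set.Ioi (0 : ℝ),
        ENNReal.ofReal (τ ^ (-1 - β / 2)) * ∫⁻ x, W x * ‖φ x - heat τ φ x‖ₑ := by
        congr 1
        refine lintegral_congr fun τ => ?_
        rw [← lintegral_const_mul _ (by fun_prop)]
        exact lintegral_congr fun x => by ring
    _ ≤ ENNReal.ofReal (fracConst (β / 2))⁻¹ *
        ((∫⁻ τ in Set.Ioc (0 : ℝ) 1, ENNReal.ofReal (τ ^ ((1 - β / 2) - 1)) *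
          (K₁ * eLpNorm W p volume)) +
        ∫⁻ τ in Set.Ioi (1 : ℝ), ENNReal.ofReal (τ ^ (-(β / 2) - 1)) *
          (2 * K₀ * eLpNorm W p volume)) := by
        gcongr
        rw [← Set.Ioc_union_Ioi_eq_Ioi zero_le_one]
        refine (lintegral_union_le _ _ _).trans (add_le_add ?_ ?_)
        · refine setLIntegral_mono (by fun_prop) fun τ hτ => ?_
          have h0 := hτ.1
          refine (mul_le_mul_right (B₁ τ h0 W hW) _).trans_eq ?_
          rw [← mul_assoc, ← ENNReal.ofReal_mul (by positivity)]
          congr 2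
          nth_rewrite 2 [← Real.rpow_one τ]
          rw [← Real.rpow_add h0]; congr 1; ring
        · refine setLIntegral_mono (by fun_prop) fun τ hτ => ?_
          refine (mul_le_mul_right (B₀ τ (one_pos.trans hτ) W hW) _).trans_eq ?_
          congr 3; ring
    _ = _ := by
        rw [lintegral_mul_const _ (by fun_prop), lintegral_mul_const _ (by fun_prop),
          lintegral_Ioc_rpow (by linarith) zero_le_one, lintegral_Ioi_rpow_neg hb2 one_pos]
        ring

lemma DualBdd.lintegral_ne_top {F : Rn n → ℂ} (hF : DualBdd p F) {V : Rn n → ℂ}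
    (hVm : Measurable V) (hV : MemLp V p volume) : ∫⁻ x, ‖V x‖ₑ * ‖F x‖ₑ ≠ ∞ := by
  obtain ⟨hFm, K, hK, h⟩ := hF
  refine ne_top_of_le_ne_top ?_ (h (fun x => ‖V x‖ₑ) (by fun_prop))
  rw [eLpNorm_enorm_comp]
  exact ENNReal.mul_ne_top hK hV.eLpNorm_ne_top

lemma DualBdd.integrable_mul {F : Rn n → ℂ} (hF : DualBdd p F) {V : Rn n → ℂ}
    (hVm : Measurable V) (hV : MemLp V p volume) : Integrable (fun x => V x * F x) := by
  refine ⟨(hVm.mul hF.1).aestronglyMeasurable, ?_⟩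
  rw [hasFiniteIntegral_iff_enorm]
  simp_rw [enorm_mul]
  exact (hF.lintegral_ne_top hVm hV).lt_top

lemma eLpNorm_heat_le_self (hp : 1 ≤ p) (hp' : p ≠ ∞) {t : ℝ} (ht : 0 < t) {V : Rn n → ℂ}
    (hVm : Measurable V) : eLpNorm (heat t V) p volume ≤ eLpNorm V p volume := by
  calc _ ≤ eLpNorm (lheat t fun y => ‖V y‖ₑ) p volume :=
        eLpNorm_mono_enorm fun x => by simpa using enorm_heat_le ht V x
    _ ≤ _ := (eLpNorm_lheat_le_self ht hp hp' (by fun_prop)).trans_eq (eLpNorm_enorm_comp V)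

lemma memLp_heat (hp : 1 ≤ p) (hp' : p ≠ ∞) {t : ℝ} (ht : 0 < t) {V : Rn n → ℂ}
    (hVm : Measurable V) (hV : MemLp V p volume) : MemLp (heat t V) p volume :=
  ⟨(measurable_heat hVm measurable_const measurable_id).aestronglyMeasurable,
    (eLpNorm_heat_le_self hp hp' ht hVm).trans_lt hV.eLpNorm_lt_top⟩

/-- The heat semigroup is symmetric. -/
lemma integral_heat_mul (hp : 1 ≤ p) (hp' : p ≠ ∞) {t : ℝ} (ht : 0 < t) {V F : Rn n → ℂ}
    (hVm : Measurable V) (hV : MemLp V p volume) (hF : DualBdd p F) :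
    ∫ x, heat t V x * F x = ∫ x, V x * heat t F x := by
  obtain ⟨hFm, K, hK, hW⟩ := hF
  have hm : Measurable (fun z : Rn n × Rn n =>
      (heatKernel t (z.1 - z.2) : ℂ) * V z.2 * F z.1) := by fun_prop
  have hint : Integrable (Function.uncurry fun x y : Rn n =>
      (heatKernel t (x - y) : ℂ) * V y * F x) (volume.prod volume) := by
    refine ⟨hm.aestronglyMeasurable, ?_⟩
    rw [hasFiniteIntegral_iff_enorm, lintegral_prod _ (by exact hm.enorm.aemeasurable)]
    refine lt_of_le_of_lt ?_ (ENNReal.mul_lt_top hK.lt_top hV.eLpNorm_lt_top)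
    calc _ = ∫⁻ x, lheat t (fun y => ‖V y‖ₑ) x * ‖F x‖ₑ := by
          refine lintegral_congr fun x => ?_
          rw [← lintegral_enorm_heat_integrand ht, ← lintegral_mul_const _ (by fun_prop)]
          exact lintegral_congr fun y => by simp [enorm_mul]
      _ ≤ K * eLpNorm (lheat t fun y => ‖V y‖ₑ) p volume := hW _ (by fun_prop)
      _ ≤ _ := by
          gcongr
          exact (eLpNorm_lheat_le_self ht hp hp' (by fun_prop)).trans_eq (eLpNorm_enorm_comp V)
  unfold heat
  simp_rw [← integral_mul_const, ← integral_const_mul]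
  rw [integral_integral_swap hint]
  refine integral_congr_ae (Eventually.of_forall fun y => integral_congr_ae
    (Eventually.of_forall fun x => ?_))
  beta_reduce
  rw [heatKernel_sub_comm]; ring

/-! ### Weighted averages of the heat semigroup -/

/-- A superposition of the heat semigroup over positive times. -/
def heatAverage (w τ : ℝ → ℝ) (V : Rn n → ℂ) (x : Rn n) : ℂ :=
  ∫ t in Set.Ioi (0 : ℝ), (w t : ℂ) * heat (τ t) V x

/-- Admissible weights and times for `heatAverage`. -/
structure HeatWeight (w τ : ℝ → ℝ) : Prop where
  meas_weight : Measurable w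
  meas_time : Measurable τ
  time_pos : ∀ t, 0 < t → 0 < τ t
  weight_ne_top : ∫⁻ t in Set.Ioi 0, ‖w t‖ₑ ≠ ∞

namespace HeatWeight

variable {w τ : ℝ → ℝ} {V F : Rn n → ℂ}

lemma measurable_heatAverage (h : HeatWeight w τ) (hV : Measurable V) :
    Measurable (heatAverage w τ V) := by
  have := h.meas_weight
  have := h.meas_time
  have h : Measurable (fun z : Rn n × ℝ => (w z.2 : ℂ) * heat (τ z.2) V z.1) := by fun_prop
  exact (h.stronglyMeasurable.integral_prod_right').measurable

lemma enorm_mul_heat_le (h : HeatWeight w τ) {t : ℝ} (ht : 0 < t) (x : Rn n) :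
    ‖(w t : ℂ) * heat (τ t) V x‖ₑ ≤ ‖w t‖ₑ * lheat (τ t) (fun y => ‖V y‖ₑ) x := by
  rw [enorm_mul]
  gcongr
  · rw [← ofReal_norm, Complex.norm_real, ofReal_norm]
  · exact enorm_heat_le (h.time_pos t ht) V x

lemma enorm_heatAverage_le (h : HeatWeight w τ) (hV : Measurable V) (x : Rn n) :
    ‖heatAverage w τ V x‖ₑ ≤
      ∫⁻ t in Set.Ioi 0, ‖w t‖ₑ * lheat (τ t) (fun y => ‖V y‖ₑ) x := by
  have := h.meas_weight
  have := h.meas_time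
  refine (enorm_integral_le_lintegral_enorm _).trans ?_
  exact setLIntegral_mono (by fun_prop) fun t ht => h.enorm_mul_heat_le ht x

lemma eLpNorm_lintegral_le (h : HeatWeight w τ) (hp : 1 ≤ p) (hp' : p ≠ ∞) (hV : Measurable V)
    (hVp : MemLp V p volume) :
    eLpNorm (fun x => ∫⁻ t in Set.Ioi 0, ‖w t‖ₑ * lheat (τ t) (fun y => ‖V y‖ₑ) x) p volume ≤
      ∫⁻ t in Set.Ioi 0, ‖w t‖ₑ * eLpNorm V p volume := by
  have := h.meas_weight
  have := h.meas_time
  refine HelmholtzFilter.eLpNorm_lintegral_le hp (b := fun _ => eLpNorm V p volume) (by fun_prop)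
    (by fun_prop) (F := fun t => lheat (τ t) (fun y => ‖V y‖ₑ))
    (by simp only [Function.uncurry_def]; fun_prop) (fun _ => hVp.eLpNorm_ne_top)
    h.weight_ne_top ?_
  filter_upwards [ae_restrict_mem measurableSet_Ioi] with t ht
  exact (eLpNorm_lheat_le_self (h.time_pos t ht) hp hp' (by fun_prop)).trans_eq
    (eLpNorm_enorm_comp V)

lemma lintegral_mul_eLpNorm_ne_top (h : HeatWeight w τ) (hVp : MemLp V p volume) :
    ∫⁻ t in Set.Ioi 0, ‖w t‖ₑ * eLpNorm V p volume ≠ ∞ := by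
  have := h.meas_weight
  rw [lintegral_mul_const _ (by fun_prop)]
  exact ENNReal.mul_ne_top h.weight_ne_top hVp.eLpNorm_ne_top

lemma memLp_heatAverage (h : HeatWeight w τ) (hp : 1 ≤ p) (hp' : p ≠ ∞) (hV : Measurable V)
    (hVp : MemLp V p volume) : MemLp (heatAverage w τ V) p volume := by
  refine ⟨(h.measurable_heatAverage hV).aestronglyMeasurable, lt_of_le_of_lt ?_
    (h.lintegral_mul_eLpNorm_ne_top hVp).lt_top⟩
  refine le_trans ?_ (h.eLpNorm_lintegral_le hp hp' hV hVp)
  exact eLpNorm_mono_enorm fun x => by simpa using h.enorm_heatAverage_le hV x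

/-- The absolute convergence behind Fubini's theorem in `integral_heatAverage_mul` and, by symmetry
of the semigroup, in `integral_mul_heatAverage`. -/
lemma lintegral_pairing_ne_top (h : HeatWeight w τ) (hp : 1 ≤ p) (hp' : p ≠ ∞)
    (hV : Measurable V) (hVp : MemLp V p volume) (hF : DualBdd p F) :
    ∫⁻ t in Set.Ioi 0, ‖w t‖ₑ * ∫⁻ x, lheat (τ t) (fun y => ‖V y‖ₑ) x * ‖F x‖ₑ ≠ ∞ := by
  have := h.meas_weight
  obtain ⟨hFm, K, hK, hW⟩ := hF
  refine ne_top_of_le_ne_top (ENNReal.mul_ne_top hK (h.lintegral_mul_eLpNorm_ne_top hVp)) ?_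
  rw [← lintegral_const_mul _ (by fun_prop)]
  refine setLIntegral_mono (by fun_prop) fun t ht => ?_
  rw [mul_left_comm]
  gcongr
  refine (hW _ (by fun_prop)).trans ?_
  gcongr
  exact (eLpNorm_lheat_le_self (h.time_pos t ht) hp hp' (by fun_prop)).trans_eq
    (eLpNorm_enorm_comp V)

lemma integral_heatAverage_mul (h : HeatWeight w τ) (hp : 1 ≤ p) (hp' : p ≠ ∞)
    (hV : Measurable V) (hVp : MemLp V p volume) (hF : DualBdd p F) :
    ∫ x, heatAverage w τ V x * F x
      = ∫ t in Set.Ioi 0, (w t : ℂ) * ∫ x, heat (τ t) V x * F x := by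
  have := h.meas_weight
  have := h.meas_time
  have hFm := hF.1
  have hm : Measurable (fun z : Rn n × ℝ => (w z.2 : ℂ) * heat (τ z.2) V z.1 * F z.1) := by
    fun_prop
  have hint : Integrable (Function.uncurry fun (x : Rn n) (t : ℝ) =>
      (w t : ℂ) * heat (τ t) V x * F x) (volume.prod (volume.restrict (Set.Ioi 0))) := by
    refine ⟨hm.aestronglyMeasurable, ?_⟩
    rw [hasFiniteIntegral_iff_enorm, lintegral_prod_symm _ (by exact hm.enorm.aemeasurable)]
    refine lt_of_le_of_lt ?_ (h.lintegral_pairing_ne_top hp hp' hV hVp hF).lt_top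
    refine setLIntegral_mono' measurableSet_Ioi fun t ht => ?_
    rw [← lintegral_const_mul _ (by fun_prop)]
    refine lintegral_mono fun x => ?_
    rw [Function.uncurry_apply_pair, enorm_mul, ← mul_assoc]
    gcongr
    exact h.enorm_mul_heat_le ht x
  unfold heatAverage
  simp_rw [← integral_mul_const, ← integral_const_mul]
  rw [integral_integral_swap hint]
  simp_rw [mul_assoc]

lemma integral_mul_heatAverage (h : HeatWeight w τ) (hp : 1 ≤ p) (hp' : p ≠ ∞)
    (hV : Measurable V) (hVp : MemLp V p volume) (hF : DualBdd p F) :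
    ∫ x, V x * heatAverage w τ F x
      = ∫ t in Set.Ioi 0, (w t : ℂ) * ∫ x, V x * heat (τ t) F x := by
  have := h.meas_weight
  have := h.meas_time
  have hFm := hF.1
  have hm : Measurable (fun z : Rn n × ℝ => V z.1 * ((w z.2 : ℂ) * heat (τ z.2) F z.1)) := by
    fun_prop
  have hint : Integrable (Function.uncurry fun (x : Rn n) (t : ℝ) =>
      V x * ((w t : ℂ) * heat (τ t) F x)) (volume.prod (volume.restrict (Set.Ioi 0))) := by
    refine ⟨hm.aestronglyMeasurable, ?_⟩
    rw [hasFiniteIntegral_iff_enorm, lintegral_prod_symm _ (by exact hm.enorm.aemeasurable)]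
    refine lt_of_le_of_lt ?_ (h.lintegral_pairing_ne_top hp hp' hV hVp hF).lt_top
    refine setLIntegral_mono' measurableSet_Ioi fun t ht => ?_
    rw [← lintegral_mul_lheat _ (by fun_prop) (by fun_prop), ← lintegral_const_mul _ (by fun_prop)]
    refine lintegral_mono fun x => ?_
    rw [Function.uncurry_apply_pair, enorm_mul, mul_left_comm]
    gcongr
    exact h.enorm_mul_heat_le ht x
  unfold heatAverage
  simp_rw [← integral_const_mul]
  rw [integral_integral_swap hint]
  simp_rw [mul_left_comm]

end HeatWeight

/-! ### Representation formulas in `L^p` -/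

/-- Functions in `L^p` are determined by their pairings with Schwartz functions. -/
lemma ae_eq_of_integral_schwartz_eq (hp : 1 ≤ p) {A B : Rn n → ℂ}
    (hA : MemLp A p volume) (hB : MemLp B p volume)
    (h : ∀ φ : 𝓢(Rn n, ℂ), ∫ x, A x * φ x = ∫ x, B x * φ x) : A =ᵐ[volume] B := by
  refine ae_eq_of_integral_contDiff_smul_eq (hA.locallyIntegrable hp) (hB.locallyIntegrable hp) ?_
  intro g hg hgc
  have hg₁ : HasCompactSupport (Complex.ofRealCLM ∘ g) := hgc.comp_left rfl
  have hg₂ : ContDiff ℝ ((⊤ : ℕ∞) : WithTop ℕ∞) (Complex.ofRealCLM ∘ g) := by fun_prop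
  have := h (hg₁.toSchwartzMap hg₂)
  simp only [HasCompactSupport.toSchwartzMap_toFun, Function.comp, Complex.ofRealCLM_apply] at this
  simpa [mul_comm] using this

lemma heatWeight_diffWeight {a b : ℝ} (ha : 0 < a) (hb : 0 < b) (hb1 : b < 1) :
    HeatWeight (diffWeight a b) id :=
  ⟨by fun_prop, measurable_id, fun _ h => h, lintegral_diffWeight_ne_top ha hb hb1⟩

lemma lintegral_exp_neg : ∫⁻ r in Set.Ioi (0 : ℝ), ENNReal.ofReal (Real.exp (-r)) = 1 := by
  rw [← ofReal_integral_eq_lintegral_ofReal (integrableOn_exp_neg_Ioi 0)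
    (Eventually.of_forall fun r => (Real.exp_pos _).le), integral_exp_neg_Ioi_zero,
    ENNReal.ofReal_one]

lemma heatWeight_exp {α : ℝ} (hα : 0 < α) :
    HeatWeight (fun r => Real.exp (-r)) (fun r => r * α ^ 2) := by
  refine ⟨by fun_prop, by fun_prop, fun _ h => by positivity, ?_⟩
  have : ∀ r : ℝ, ‖Real.exp (-r)‖ₑ = ENNReal.ofReal (Real.exp (-r)) := fun r => by
    rw [← ofReal_norm, Real.norm_of_nonneg (Real.exp_pos _).le]
  simp_rw [this, lintegral_exp_neg]
  exact ENNReal.one_ne_top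

/-- If `Λ^β V = G`, then `V - e^{aΔ} V` is a superposition of `e^{tΔ} G`. -/
theorem sub_heat_ae_eq_heatAverage (hp : 1 ≤ p) (hp' : p ≠ ∞) {β a : ℝ} (hb : 0 < β) (hb1 : β < 1)
    (ha : 0 < a) {V G : Rn n → ℂ} (hVm : Measurable V) (hV : MemLp V p volume)
    (hGm : Measurable G) (hG : MemLp G p volume)
    (h : ∀ φ : 𝓢(Rn n, ℂ), ∫ x, V x * lambdaSchwartz β φ x = ∫ x, G x * φ x) :
    (fun x => (Real.Gamma (β / 2) : ℂ) * (V x - heat a V x)) =ᵐ[volume]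
      heatAverage (diffWeight a (β / 2)) id G := by
  have hw := heatWeight_diffWeight ha (by linarith : 0 < β / 2) (by linarith : β / 2 < 1)
  have hh := memLp_heat hp hp' ha hVm hV
  have hhm : Measurable (heat a V) := measurable_heat hVm measurable_const measurable_id
  refine ae_eq_of_integral_schwartz_eq hp ((hV.sub hh).const_mul _)
    (hw.memLp_heatAverage hp hp' hGm hG) fun φ => ?_
  have hφ := dualBdd_schwartz hp hp' φ
  have hΛ := dualBdd_lambdaSchwartz hp hp' hb hb1 φ
  obtain ⟨Φ, hΦ, -⟩ := exists_schwartz_heat ha φ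
  have hiΦ : Integrable fun x => V x * heat a φ x := by
    rw [← hΦ]; exact (dualBdd_schwartz hp hp' Φ).integrable_mul hVm hV
  calc ∫ x, (Real.Gamma (β / 2) : ℂ) * (V x - heat a V x) * φ x
      = (Real.Gamma (β / 2) : ℂ) * ((∫ x, V x * φ x) - ∫ x, heat a V x * φ x) := by
        rw [← integral_sub (hφ.integrable_mul hVm hV) (hφ.integrable_mul hhm hh),
          ← integral_const_mul]
        exact integral_congr_ae (Eventually.of_forall fun x => by beta_reduce; ring)
    _ = ∫ x, V x * heatAverage (diffWeight a (β / 2)) id (lambdaSchwartz β φ) x := by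
        rw [integral_heat_mul hp hp' ha hVm hV hφ, ← integral_sub (hφ.integrable_mul hVm hV) hiΦ,
          ← integral_const_mul]
        refine integral_congr_ae (Eventually.of_forall fun x => ?_)
        beta_reduce
        rw [heatAverage]
        simp only [id]
        rw [← sub_heat_eq_integral_lambda hb hb1 ha]
        ring
    _ = ∫ t in Set.Ioi 0, (diffWeight a (β / 2) t : ℂ) * ∫ x, heat t G x * φ x := by
        rw [hw.integral_mul_heatAverage hp hp' hVm hV hΛ]
        refine setIntegral_congr_fun measurableSet_Ioi fun t ht => ?_
        simp only [id]
        congr 1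
        -- `e^{tΔ}φ` is again Schwartz and `Λ^β` commutes with the semigroup, so the hypothesis `Λ^β
        -- V = G` can be tested with it.
        obtain ⟨Ψ, hΨ, hΨ'⟩ := exists_schwartz_heat ht φ
        rw [← lambdaSchwartz_heat hb hb1 ht hΨ', h, hΨ, integral_heat_mul hp hp' ht hGm hG hφ]
    _ = _ := (hw.integral_heatAverage_mul hp hp' hGm hG hφ).symm

/-- Solutions of the Helmholtz equation are averages of the heat semigroup. -/
theorem helmholtz_ae_eq_heatAverage (hp : 1 ≤ p) (hp' : p ≠ ∞) {α : ℝ} (hα : 0 < α)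
    {V U : Rn n → ℂ} (hVm : Measurable V) (hV : MemLp V p volume) (hU : MemLp U p volume)
    (h : ∀ φ : 𝓢(Rn n, ℂ), ∫ x, U x * (φ x - (α : ℂ) ^ 2 * (Δ φ : 𝓢(Rn n, ℂ)) x)
      = ∫ x, V x * φ x) :
    U =ᵐ[volume] heatAverage (fun r => Real.exp (-r)) (fun r => r * α ^ 2) V := by
  have hw := heatWeight_exp hα
  refine ae_eq_of_integral_schwartz_eq hp hU (hw.memLp_heatAverage hp hp' hVm hV) fun φ => ?_
  have hφ := dualBdd_schwartz hp hp' φ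
  -- Testing the equation with `ψ = (1 - α²Δ)⁻¹φ` turns its left side into the pairing of `U` with
  -- `φ`.
  obtain ⟨ψ, hψ, hψ'⟩ := exists_schwartz_resolvent hα φ
  have h1 := h ψ
  simp_rw [hψ] at h1
  have h2 : ∀ x, ψ x = heatAverage (fun r => Real.exp (-r)) (fun r => r * α ^ 2) φ x := hψ'
  rw [h1, hw.integral_heatAverage_mul hp hp' hVm hV hφ]
  simp_rw [h2]
  rw [hw.integral_mul_heatAverage hp hp' hVm hV hφ]
  refine setIntegral_congr_fun measurableSet_Ioi fun r hr => ?_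
  beta_reduce
  rw [integral_heat_mul hp hp' (hw.time_pos r hr) hVm hV hφ]

/-! ### From heat differences to the Helmholtz filter -/

/-- From `r^δ ≤ 1 + r ≤ 2e^{r/2}`; the bound does not depend on `δ`, as a constant uniform in `β`
requires. -/
lemma lintegral_exp_neg_mul_rpow_le {δ : ℝ} (hδ : 0 < δ) (hδ1 : δ ≤ 1) :
    ∫⁻ r in Set.Ioi (0 : ℝ), ‖Real.exp (-r)‖ₑ * ENNReal.ofReal (r ^ δ) ≤ 4 := by
  calc _ ≤ ∫⁻ r in Set.Ioi (0 : ℝ), ENNReal.ofReal (2 * Real.exp (-(1 / 2) * r)) := by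
        refine setLIntegral_mono (by fun_prop) fun r hr => ?_
        have hr : 0 < r := hr
        rw [← ofReal_norm, Real.norm_of_nonneg (Real.exp_pos _).le,
          ← ENNReal.ofReal_mul (Real.exp_pos _).le]
        refine ENNReal.ofReal_le_ofReal ?_
        have h1 : r ^ δ ≤ 1 + r := by
          rcases le_total r 1 with h | h
          · have := Real.rpow_le_one hr.le h hδ.le; linarith
          · have := Real.rpow_le_rpow_of_exponent_le h hδ1
            rw [Real.rpow_one] at this; linarith
        have h2 : 1 + r ≤ 2 * Real.exp (r / 2) := by
          have := Real.add_one_le_exp (r / 2); linarith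
        calc Real.exp (-r) * r ^ δ ≤ Real.exp (-r) * (2 * Real.exp (r / 2)) := by
              gcongr; linarith
          _ = _ := by
              rw [mul_left_comm, ← Real.exp_add]; congr 2; ring
    _ = 4 := by
        rw [← ofReal_integral_eq_lintegral_ofReal
          ((integrableOn_exp_mul_Ioi (by norm_num) 0).const_mul 2)
          (Eventually.of_forall fun r => by positivity), integral_const_mul,
          integral_exp_mul_Ioi (by norm_num)]
        norm_num

/-- Averaging bounds for `V - e^{aΔ} V` over `a` bounds the Helmholtz filter. -/
theorem eLpNorm_heatAverage_sub_le (hq : 1 ≤ q) {α δ : ℝ} (hα : 0 < α)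
    (hδ : 0 < δ) (hδ1 : δ ≤ 1) {V : Rn n → ℂ} (hVm : Measurable V) {B : ℝ≥0∞} (hB : B ≠ ∞)
    (h : ∀ a : ℝ, 0 < a → eLpNorm (fun x => V x - heat a V x) q volume ≤
      B * ENNReal.ofReal (a ^ δ)) :
    eLpNorm (fun x => heatAverage (fun r => Real.exp (-r)) (fun r => r * α ^ 2) V x - V x) q volume
      ≤ 4 * B * ENNReal.ofReal (α ^ (2 * δ)) := by
  have hw : ∫⁻ r in Set.Ioi (0 : ℝ), ‖Real.exp (-r)‖ₑ ≠ ∞ := (heatWeight_exp hα).weight_ne_top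
  have hei : IntegrableOn (fun r : ℝ => (Real.exp (-r) : ℂ)) (Set.Ioi 0) :=
    (integrableOn_exp_neg_Ioi 0).ofReal
  have hone : ∫ r in Set.Ioi (0 : ℝ), (Real.exp (-r) : ℂ) = 1 := by
    rw [integral_complex_ofReal, integral_exp_neg_Ioi_zero, Complex.ofReal_one]
  have hpt : ∀ x, ‖heatAverage (fun r => Real.exp (-r)) (fun r => r * α ^ 2) V x - V x‖ₑ ≤
      ∫⁻ r in Set.Ioi (0 : ℝ), ‖Real.exp (-r)‖ₑ * ‖V x - heat (r * α ^ 2) V x‖ₑ := by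
    intro x
    have e : ∀ r : ℝ, ‖(Real.exp (-r) : ℂ) * (heat (r * α ^ 2) V x - V x)‖ₑ
        = ‖Real.exp (-r)‖ₑ * ‖V x - heat (r * α ^ 2) V x‖ₑ := by
      intro r
      rw [enorm_mul, enorm_sub_rev, ← ofReal_norm, Complex.norm_real, ofReal_norm]
    simp_rw [← e]
    -- If the integral diverges there is nothing to prove. Otherwise `e^{-r}V(x)` may be added under
    -- the integral, and `∫ e^{-r} = 1` identifies the difference.
    by_cases hfin : ∫⁻ r in Set.Ioi (0 : ℝ),
        ‖(Real.exp (-r) : ℂ) * (heat (r * α ^ 2) V x - V x)‖ₑ = ∞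
    · rw [hfin]; exact le_top
    have hm : Measurable fun r : ℝ => (Real.exp (-r) : ℂ) * (heat (r * α ^ 2) V x - V x) := by
      fun_prop
    have hi : IntegrableOn (fun r : ℝ => (Real.exp (-r) : ℂ) * (heat (r * α ^ 2) V x - V x))
        (Set.Ioi 0) := ⟨hm.aestronglyMeasurable, by
      rw [hasFiniteIntegral_iff_enorm]; exact lt_top_iff_ne_top.2 hfin⟩
    have heq : heatAverage (fun r => Real.exp (-r)) (fun r => r * α ^ 2) V x - V x
        = ∫ r in Set.Ioi (0 : ℝ), (Real.exp (-r) : ℂ) * (heat (r * α ^ 2) V x - V x) := by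
      have h2 := integral_add hi (hei.mul_const (V x))
      rw [integral_mul_const, hone, one_mul] at h2
      rw [← sub_eq_iff_eq_add] at h2
      rw [← h2, heatAverage]
      congr 1
      exact integral_congr_ae (Eventually.of_forall fun r => by ring)
    rw [heq]
    exact enorm_integral_le_lintegral_enorm _
  calc _ ≤ eLpNorm (fun x => ∫⁻ r in Set.Ioi (0 : ℝ),
          ‖Real.exp (-r)‖ₑ * ‖V x - heat (r * α ^ 2) V x‖ₑ) q volume :=
        eLpNorm_mono_enorm fun x => by simpa using hpt x
    _ ≤ ∫⁻ r in Set.Ioi (0 : ℝ), ‖Real.exp (-r)‖ₑ * (B * ENNReal.ofReal ((r * α ^ 2) ^ δ)) := by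
        refine eLpNorm_lintegral_le hq (b := fun r => B * ENNReal.ofReal ((r * α ^ 2) ^ δ))
          (by fun_prop) (by fun_prop) (F := fun r x => ‖V x - heat (r * α ^ 2) V x‖ₑ)
          (by simp only [Function.uncurry_def]; fun_prop)
          (fun r => ENNReal.mul_ne_top hB ENNReal.ofReal_ne_top) hw ?_
        filter_upwards [ae_restrict_mem measurableSet_Ioi] with r hr
        have hr : 0 < r := hr
        refine le_trans (le_of_eq ?_) (h (r * α ^ 2) (by positivity))
        exact eLpNorm_congr_enorm_ae (Eventually.of_forall fun x => by simp)
    _ = B * ENNReal.ofReal (α ^ (2 * δ)) *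
          ∫⁻ r in Set.Ioi (0 : ℝ), ‖Real.exp (-r)‖ₑ * ENNReal.ofReal (r ^ δ) := by
        rw [← lintegral_const_mul _ (by fun_prop)]
        refine setLIntegral_congr_fun measurableSet_Ioi fun r hr => ?_
        have hr : 0 < r := hr
        rw [Real.mul_rpow hr.le (by positivity), ENNReal.ofReal_mul (by positivity),
          ← Real.rpow_natCast, ← Real.rpow_mul hα.le]
        push_cast
        ring
    _ ≤ B * ENNReal.ofReal (α ^ (2 * δ)) * 4 := by
        gcongr; exact lintegral_exp_neg_mul_rpow_le hδ hδ1
    _ = _ := by ring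

/-! ### `L^q` bounds for `V - e^{aΔ}V` in terms of `Λ^β V` -/

/-- The local part of the heat representation is bounded from `L^p` to `L^q`. -/
def LocalBound (n : ℕ) (p q : ℝ≥0∞) (b : ℝ) (A : ℝ≥0∞) : Prop :=
  ∀ a : ℝ, 0 < a → ∀ f : Rn n → ℝ≥0∞, Measurable f → eLpNorm f p volume ≠ ∞ →
    eLpNorm (fun x => ∫⁻ t in Set.Ioc 0 a, ENNReal.ofReal (t ^ (b - 1)) * lheat t f x) q volume ≤
      A * ENNReal.ofReal (a ^ (b - gammaExp n p q)) * eLpNorm f p volume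

/-- Minkowski's inequality and the smoothing rate `t^{-γ}`. The constant blows up as `b` decreases
to `γ`, but all end-points are covered. -/
lemma localBound_of_lt (hp : 1 ≤ p) (hp' : p ≠ ∞) (hpq : p ≤ q) {b : ℝ} (hb : 0 < b)
    (hγb : gammaExp n p q < b) :
    LocalBound n p q b (ENNReal.ofReal (b - gammaExp n p q)⁻¹) := by
  intro a ha f hf hfp
  calc _ ≤ ∫⁻ t in Set.Ioc 0 a, ENNReal.ofReal (t ^ (b - 1)) *
        (ENNReal.ofReal (t ^ (-gammaExp n p q)) * eLpNorm f p volume) := by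
        refine eLpNorm_lintegral_le (hp.trans hpq) (by fun_prop) (by fun_prop)
          (F := fun t => lheat t f) (by simp only [Function.uncurry_def]; fun_prop)
          (fun t => ENNReal.mul_ne_top ENNReal.ofReal_ne_top hfp) ?_ ?_
        · rw [lintegral_Ioc_rpow hb ha.le]; exact ENNReal.ofReal_ne_top
        · filter_upwards [ae_restrict_mem measurableSet_Ioc] with t ht
          exact eLpNorm_lheat_le ht.1 hp hp' hpq hf
    _ = (∫⁻ t in Set.Ioc 0 a, ENNReal.ofReal (t ^ ((b - gammaExp n p q) - 1))) *
          eLpNorm f p volume := by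
        rw [← lintegral_mul_const _ (by fun_prop)]
        refine setLIntegral_congr_fun measurableSet_Ioc fun t ht => ?_
        have h0 := ht.1
        beta_reduce
        rw [← mul_assoc, ← ENNReal.ofReal_mul (by positivity), ← Real.rpow_add h0]
        congr 3; ring
    _ = _ := by
        have : 0 < b - gammaExp n p q := by linarith
        rw [lintegral_Ioc_rpow this ha.le, ENNReal.ofReal_mul (by positivity)]

lemma eLpNorm_const_mul_ennreal_le (f : Rn n → ℝ≥0∞) (c : ℝ) :
    eLpNorm (fun x => ENNReal.ofReal c * f x) q volume ≤ ENNReal.ofReal c * eLpNorm f q volume := by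
  have h := eLpNorm_le_nnreal_smul_eLpNorm_of_ae_le_mul' (μ := volume) (c := Real.toNNReal c)
    (f := fun x => ENNReal.ofReal c * f x) (g := f)
    (Eventually.of_forall fun x => by simp [ENNReal.ofReal]) q
  exact h

/-- On `(0, a]` one has `t^{b-1} ≤ a^{b-γ} t^{γ-1}`, so the Riesz potential of order `γ` dominates
and its bound does not involve `b`. -/
lemma exists_localBound_uniform (hn : 0 < n) (hp : 1 < p) (hpq : p < q) (hq : q ≠ ∞) :
    ∃ A : ℝ≥0∞, A ≠ ∞ ∧ ∀ b : ℝ, gammaExp n p q < b → LocalBound n p q b A := by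
  obtain ⟨C, hC, h⟩ := exists_eLpNorm_rieszPot_le hn hp hpq hq
  refine ⟨C, hC, fun b hb a ha f hf _ => ?_⟩
  set γ := gammaExp n p q
  have hpt : ∀ x, ∫⁻ t in Set.Ioc 0 a, ENNReal.ofReal (t ^ (b - 1)) * lheat t f x ≤
      ENNReal.ofReal (a ^ (b - γ)) * rieszPot γ f x := by
    intro x
    unfold rieszPot
    rw [← lintegral_const_mul _ (by fun_prop)]
    refine (setLIntegral_mono (by fun_prop) fun t ht => ?_).trans
      (lintegral_mono_set Set.Ioc_subset_Ioi_self)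
    have h0 := ht.1
    rw [← mul_assoc, ← ENNReal.ofReal_mul (by positivity)]
    gcongr
    calc t ^ (b - 1) = t ^ (b - γ) * t ^ (γ - 1) := by rw [← Real.rpow_add h0]; congr 1; ring
      _ ≤ _ := by
        gcongr
        · exact ht.2
  calc _ ≤ eLpNorm (fun x => ENNReal.ofReal (a ^ (b - γ)) * rieszPot γ f x) q volume :=
        eLpNorm_mono_enorm fun x => by simpa using hpt x
    _ ≤ ENNReal.ofReal (a ^ (b - γ)) * (C * eLpNorm f p volume) :=
        (eLpNorm_const_mul_ennreal_le _ _).trans (by gcongr; exact h f hf)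
    _ = _ := by ring

/-- The `L^q` bound of `V - e^{aΔ} V` in terms of `Λ^β V`. -/
theorem eLpNorm_sub_heat_le (hp : 1 ≤ p) (hp' : p ≠ ∞) (hpq : p ≤ q) {β a : ℝ} (hβ : 0 < β)
    (hβ1 : β < 1) (ha : 0 < a) {A : ℝ≥0∞} (hA : LocalBound n p q (β / 2) A) {V G : Rn n → ℂ}
    (hVm : Measurable V) (hV : MemLp V p volume) (hGm : Measurable G) (hG : MemLp G p volume)
    (h : ∀ φ : 𝓢(Rn n, ℂ), ∫ x, V x * lambdaSchwartz β φ x = ∫ x, G x * φ x) :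
    eLpNorm (fun x => V x - heat a V x) q volume ≤
      ENNReal.ofReal (Real.Gamma (β / 2))⁻¹ * (A + ENNReal.ofReal (β / 2)⁻¹) *
        eLpNorm G p volume * ENNReal.ofReal (a ^ (β / 2 - gammaExp n p q)) := by
  have hb : 0 < β / 2 := by linarith
  have hb1 : β / 2 < 1 := by linarith
  set b := β / 2
  set γ := gammaExp n p q with hγdef
  have hγ : 0 ≤ γ := gammaExp_nonneg hp hpq
  have hΓ : 0 < Real.Gamma b := Real.Gamma_pos_of_pos hb
  set f : Rn n → ℝ≥0∞ := fun y => ‖G y‖ₑ with hf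
  have hfm : Measurable f := by fun_prop
  have hfp : eLpNorm f p volume = eLpNorm G p volume := eLpNorm_enorm_comp G
  have hrep := sub_heat_ae_eq_heatAverage hp hp' hβ hβ1 ha hVm hV hGm hG h
  have hw := heatWeight_diffWeight ha hb hb1
  have hq := hp.trans hpq
  have hX : Measurable fun x => ∫⁻ t in Set.Ioc 0 a, ENNReal.ofReal (t ^ (b - 1)) * lheat t f x :=
    measurable_setLIntegral_lheat _ (by fun_prop) hfm
  have hY : Measurable fun x => ∫⁻ t in Set.Ioi a, ‖diffWeight a b t‖ₑ * lheat t f x :=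
    measurable_setLIntegral_lheat _ (by fun_prop) hfm
  have hXn := hA a ha f hfm (by rw [hfp]; exact hG.eLpNorm_ne_top)
  -- For `t > a` no singularity occurs: the smoothing rate is at most `a^{-γ}` and the weight has
  -- mass at most `a^b/b`.
  have hYn : eLpNorm (fun x => ∫⁻ t in Set.Ioi a, ‖diffWeight a b t‖ₑ * lheat t f x) q volume ≤
      ENNReal.ofReal b⁻¹ * ENNReal.ofReal (a ^ (b - γ)) * eLpNorm G p volume := by
    calc _ ≤ ∫⁻ t in Set.Ioi a, ‖diffWeight a b t‖ₑ *
            (ENNReal.ofReal (a ^ (-γ)) * eLpNorm G p volume) := by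
          refine eLpNorm_lintegral_le hq (by fun_prop) (by fun_prop)
            (F := fun t => lheat t f) (by simp only [Function.uncurry_def]; fun_prop)
            (fun t => ENNReal.mul_ne_top ENNReal.ofReal_ne_top hG.eLpNorm_ne_top) ?_ ?_
          · exact ne_top_of_le_ne_top ENNReal.ofReal_ne_top (lintegral_diffWeight_Ioi_le ha hb hb1)
          · filter_upwards [ae_restrict_mem measurableSet_Ioi] with t ht
            have ht : a < t := ht
            refine (eLpNorm_lheat_le (ha.trans ht) hp hp' hpq hfm).trans ?_
            rw [hfp]
            gcongr ENNReal.ofReal ?_ * _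
            exact Real.rpow_le_rpow_of_nonpos ha ht.le (by linarith)
      _ ≤ ENNReal.ofReal (b⁻¹ * a ^ b) * (ENNReal.ofReal (a ^ (-γ)) * eLpNorm G p volume) := by
          rw [lintegral_mul_const _ (by fun_prop)]
          gcongr
          exact lintegral_diffWeight_Ioi_le ha hb hb1
      _ = _ := by
          rw [← mul_assoc, ← ENNReal.ofReal_mul (by positivity), ← ENNReal.ofReal_mul
            (by positivity), mul_assoc b⁻¹, ← Real.rpow_add ha, sub_eq_add_neg]
  have havg : eLpNorm (heatAverage (diffWeight a b) id G) q volume ≤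
      (A + ENNReal.ofReal b⁻¹) * ENNReal.ofReal (a ^ (b - γ)) * eLpNorm G p volume := by
    calc _ ≤ eLpNorm ((fun x => ∫⁻ t in Set.Ioc 0 a, ENNReal.ofReal (t ^ (b - 1)) * lheat t f x) +
            fun x => ∫⁻ t in Set.Ioi a, ‖diffWeight a b t‖ₑ * lheat t f x) q volume := by
          refine eLpNorm_mono_enorm fun x => ?_
          refine (hw.enorm_heatAverage_le hGm x).trans_eq ?_
          rw [enorm_eq_self, Pi.add_apply, ← Set.Ioc_union_Ioi_eq_Ioi ha.le,
            lintegral_union measurableSet_Ioi (by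
              rw [Set.disjoint_left]; intro t h1 h2; exact absurd h1.2 (not_le.2 h2))]
          congr 1
          refine setLIntegral_congr_fun measurableSet_Ioc fun t ht => ?_
          have := ht.1
          rw [diffWeight_of_le ht.2, ← ofReal_norm, Real.norm_of_nonneg (by positivity)]
          rfl
      _ ≤ _ := eLpNorm_add_le hX.aestronglyMeasurable hY.aestronglyMeasurable hq
      _ ≤ _ := add_le_add hXn hYn
      _ = _ := by rw [hfp]; ring
  have heq : (fun x => V x - heat a V x) =ᵐ[volume]
      ((Real.Gamma b)⁻¹ : ℂ) • heatAverage (diffWeight a b) id G := by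
    filter_upwards [hrep] with x hx
    rw [Pi.smul_apply, ← hx, smul_eq_mul, ← mul_assoc, inv_mul_cancel₀, one_mul]
    exact_mod_cast hΓ.ne'
  rw [eLpNorm_congr_ae heq, eLpNorm_const_smul]
  have hc : ‖((Real.Gamma b)⁻¹ : ℂ)‖ₑ = ENNReal.ofReal (Real.Gamma b)⁻¹ := by
    rw [← ofReal_norm, ← Complex.ofReal_inv, Complex.norm_real, Real.norm_of_nonneg (by positivity)]
  rw [hc, mul_assoc, mul_assoc]
  gcongr
  refine havg.trans_eq ?_
  ring

/-! ### Vector fields and the filter estimate -/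

/-- The `i`-th component of a vector field, as a complex-valued function. -/
abbrev component (v : Rn n → Rn n) (i : Fin n) : Rn n → ℂ := fun x => ((v x i : ℝ) : ℂ)

lemma enorm_component_le (v : Rn n → Rn n) (i : Fin n) (x : Rn n) :
    ‖component v i x‖ₑ ≤ ‖v x‖ₑ := by
  rw [← ofReal_norm, ← ofReal_norm, Complex.norm_real]
  exact ENNReal.ofReal_le_ofReal (PiLp.norm_apply_le (v x) i)

lemma memLp_component {v : Rn n → Rn n} (hv : MemLp v p volume) (i : Fin n) :
    MemLp (component v i) p volume := by
  have hm : Measurable fun y : Rn n => ((y i : ℝ) : ℂ) := by fun_prop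
  exact MemLp.of_le hv (hm.comp_aemeasurable hv.1.aemeasurable).aestronglyMeasurable
    (Eventually.of_forall fun x => by
      have := enorm_component_le v i x
      rwa [enorm_le_iff_norm_le] at this)

lemma norm_le_sum_norm (y : Rn n) : ‖y‖ ≤ ∑ i, ‖y i‖ := by
  rw [EuclideanSpace.norm_eq]
  refine Real.sqrt_le_iff.2 ⟨Finset.sum_nonneg fun _ _ => norm_nonneg _, ?_⟩
  exact Finset.sum_sq_le_sq_sum_of_nonneg fun _ _ => norm_nonneg _

lemma eLpNorm_le_of_component (hq : 1 ≤ q) {w : Rn n → Rn n}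
    (hw : ∀ i, AEStronglyMeasurable (component w i) volume) {B : ℝ≥0∞}
    (h : ∀ i, eLpNorm (component w i) q volume ≤ B) : eLpNorm w q volume ≤ n * B := by
  calc eLpNorm w q volume ≤ eLpNorm (∑ i, fun x => ‖component w i x‖) q volume := by
        refine eLpNorm_mono_real fun x => ?_
        rw [Finset.sum_apply]
        simpa using norm_le_sum_norm (w x)
    _ ≤ ∑ i, eLpNorm (fun x => ‖component w i x‖) q volume :=
        eLpNorm_sum_le (fun i _ => (hw i).norm) hq
    _ ≤ ∑ _i : Fin n, B := Finset.sum_le_sum fun i _ => by rw [eLpNorm_norm]; exact h i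
    _ = n * B := by simp

/-- Bounds for `v - e^{aΔ} v` carry over to the Helmholtz filter. -/
theorem eLpNorm_sub_le_of_heat (hp : 1 ≤ p) (hp' : p ≠ ∞) (hpq : p ≤ q) {α δ : ℝ} (hα : 0 < α)
    (hδ : 0 < δ) (hδ1 : δ ≤ 1) {v u : Rn n → Rn n} (hv : MemLp v p volume)
    (hu : IsHelmholtzSolution p α v u) {B : ℝ≥0∞} (hB : B ≠ ∞)
    (h : ∀ (i : Fin n) (a : ℝ), 0 < a →
      eLpNorm (fun x => component v i x - heat a (component v i) x) q volume ≤
        B * ENNReal.ofReal (a ^ δ)) :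
    eLpNorm (u - v) q volume ≤ n * (4 * B * ENNReal.ofReal (α ^ (2 * δ))) := by
  have e : ∀ i, component (u - v) i = component u i - component v i := fun i => by
    ext x; simp [component]
  refine eLpNorm_le_of_component (hp.trans hpq) (fun i => ?_) fun i => ?_
  · rw [e]; exact (memLp_component hu.1 i).1.sub (memLp_component hv i).1
  have hVp := memLp_component hv i
  -- The scalar results ask for a Borel function; passing to an almost everywhere equal one leaves
  -- `heat` unchanged at every point.
  obtain ⟨V, hVm, hVe⟩ : ∃ V : Rn n → ℂ, Measurable V ∧ component v i =ᵐ[volume] V :=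
    ⟨hVp.1.aemeasurable.mk, hVp.1.aemeasurable.measurable_mk, hVp.1.aemeasurable.ae_eq_mk⟩
  have hU := helmholtz_ae_eq_heatAverage hp hp' hα hVm ((memLp_congr_ae hVe).1 hVp)
    (memLp_component hu.1 i) fun φ => (hu.2 φ i).trans (integral_congr_ae (by
      filter_upwards [hVe] with x hx; rw [← hx]))
  have h1 := eLpNorm_heatAverage_sub_le (hp.trans hpq) hα hδ hδ1 hVm hB fun a ha => by
    refine le_trans (eLpNorm_congr_ae ?_).le (h i a ha)
    filter_upwards [hVe] with x hx
    rw [hx, heat_congr_ae a hVe]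
  refine le_trans (eLpNorm_congr_ae ?_).le h1
  filter_upwards [hVe, hU] with x hx hx'
  rw [e, Pi.sub_apply, hx, hx']

/-- The filter estimate, with its constant in terms of the local bound. -/
theorem filterEstimate_of_localBound (hp : 1 ≤ p) (hp' : p ≠ ∞) (hpq : p ≤ q) {β C : ℝ}
    (hβ : 0 < β) (hβ1 : β < 1) (hγ : gammaExp n p q < β / 2) {A : ℝ≥0∞}
    (hA' : A ≠ ∞) (hA : LocalBound n p q (β / 2) A) (hC : 0 < C)
    (hAC : n * (4 * (ENNReal.ofReal (Real.Gamma (β / 2))⁻¹ * (A + ENNReal.ofReal (β / 2)⁻¹))) ≤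
      ENNReal.ofReal C) : FilterEstimate n p q β C := by
  intro v u α hα hα1 hv hu
  set δ := β / 2 - gammaExp n p q with hδ
  have hγ0 : 0 ≤ gammaExp n p q := gammaExp_nonneg hp hpq
  set D := ENNReal.ofReal (Real.Gamma (β / 2))⁻¹ * (A + ENNReal.ofReal (β / 2)⁻¹)
  have hD : D ≠ ∞ := ENNReal.mul_ne_top ENNReal.ofReal_ne_top
    (ENNReal.add_ne_top.2 ⟨hA', ENNReal.ofReal_ne_top⟩)
  -- A nonzero finite factor passes through the infimum over the representatives `g`, including the
  -- empty infimum `∞`.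
  have h0 : ENNReal.ofReal (C * α ^ δ) ≠ 0 := by
    simp only [ne_eq, ENNReal.ofReal_eq_zero, not_le]; positivity
  rw [lambdaNorm, ENNReal.mul_iInf_of_ne h0 ENNReal.ofReal_ne_top]
  refine le_iInf fun g => ?_
  rw [ENNReal.mul_iInf_of_ne h0 ENNReal.ofReal_ne_top]
  refine le_iInf fun ⟨hg, hΛ⟩ => ?_
  have key := eLpNorm_sub_le_of_heat hp hp' hpq hα (δ := δ) (by linarith) (by linarith) hv.1 hu
    (B := D * eLpNorm g p volume) (ENNReal.mul_ne_top hD hg.eLpNorm_ne_top) fun i a ha => by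
      have hVp := memLp_component hv.1 i
      have hGp := memLp_component hg i
      obtain ⟨V, hVm, hVe⟩ : ∃ V : Rn n → ℂ, Measurable V ∧ component v i =ᵐ[volume] V :=
        ⟨hVp.1.aemeasurable.mk, hVp.1.aemeasurable.measurable_mk, hVp.1.aemeasurable.ae_eq_mk⟩
      obtain ⟨G, hGm, hGe⟩ : ∃ G : Rn n → ℂ, Measurable G ∧ component g i =ᵐ[volume] G :=
        ⟨hGp.1.aemeasurable.mk, hGp.1.aemeasurable.measurable_mk, hGp.1.aemeasurable.ae_eq_mk⟩
      have h1 := eLpNorm_sub_heat_le hp hp' hpq hβ hβ1 ha hA hVm ((memLp_congr_ae hVe).1 hVp) hGm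
        ((memLp_congr_ae hGe).1 hGp) fun φ => by
          refine Eq.trans (integral_congr_ae ?_) ((hΛ φ i).trans (integral_congr_ae ?_))
          · filter_upwards [hVe] with x hx; rw [← hx]
          · filter_upwards [hGe] with x hx; rw [← hx]
      rw [← heat_congr_ae a hVe, ← eLpNorm_congr_ae hGe] at h1
      refine le_trans (eLpNorm_congr_ae ?_).le (h1.trans ?_)
      · filter_upwards [hVe] with x hx; rw [hx]
      · gcongr
        exact eLpNorm_mono_enorm fun x => enorm_component_le g i x
  refine key.trans ?_
  -- The argument yields the rate `α^{β - 2γ}`; only here is `α < 1` used, to weaken it to the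
  -- stated one.
  have hpow : α ^ (2 * δ) ≤ α ^ δ :=
    Real.rpow_le_rpow_of_exponent_ge hα hα1.le (by linarith)
  calc _ = (n * (4 * D)) * ENNReal.ofReal (α ^ (2 * δ)) * eLpNorm g p volume := by ring
    _ ≤ ENNReal.ofReal C * ENNReal.ofReal (α ^ δ) * eLpNorm g p volume := by gcongr
    _ = _ := by rw [← ENNReal.ofReal_mul hC.le]

/-- `Γ` is continuous and positive on this compact interval, which contains `β/2` because `β ≥ n/4 ≥
1/2`. -/
lemma exists_inv_gamma_le : ∃ K : ℝ, 0 < K ∧ ∀ b ∈ Set.Icc (1 / 4 : ℝ) 1,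
    (Real.Gamma b)⁻¹ ≤ K := by
  have hc : ContinuousOn Real.Gamma (Set.Icc (1 / 4) 1) := fun b hb =>
    (Real.differentiableAt_Gamma fun m => (by
      linarith [hb.1, (m.cast_nonneg : (0 : ℝ) ≤ m)] : -(m : ℝ) < b).ne').continuousAt.continuousWithinAt
  obtain ⟨b₀, hb₀, hmin⟩ := isCompact_Icc.exists_isMinOn
    (⟨1 / 2, by norm_num, by norm_num⟩ : (Set.Icc (1 / 4 : ℝ) 1).Nonempty) hc
  have h0 : 0 < Real.Gamma b₀ := Real.Gamma_pos_of_pos (by linarith [hb₀.1])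
  exact ⟨(Real.Gamma b₀)⁻¹, by positivity, fun b hb => inv_anti₀ h0 (hmin hb)⟩

/-- For `1 < p` and `q < ∞` the constant of the filter estimate is uniform in `β`. -/
theorem exists_filterEstimate_uniform (hn : 2 ≤ n) (hp : 1 < p) (hp' : p ≠ ∞) (hpq : p ≤ q)
    (hq : q ≠ ∞) : ∃ C : ℝ, 0 < C ∧ ∀ β : ℝ, (n : ℝ) / 4 ≤ β → β < 1 →
      gammaExp n p q < β / 2 → FilterEstimate n p q β C := by
  obtain ⟨A, hA, hloc⟩ : ∃ A : ℝ≥0∞, A ≠ ∞ ∧ ∀ b : ℝ, 1 / 4 ≤ b → gammaExp n p q < b →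
      LocalBound n p q b A := by
    -- For `p = q` the Hardy–Littlewood–Sobolev inequality is not available, but `γ = 0` and the
    -- elementary constant `1/b` is at most 4.
    rcases hpq.eq_or_lt with rfl | h
    · refine ⟨ENNReal.ofReal 4, ENNReal.ofReal_ne_top, fun b hb hγb a ha f hf hfp =>
        (localBound_of_lt hp.le hp' le_rfl (by linarith) hγb a ha f hf hfp).trans ?_⟩
      gcongr
      rw [gammaExp, sub_self, mul_zero, sub_zero]
      exact inv_le_of_inv_le₀ (by norm_num) (by linarith)
    · obtain ⟨A, hA, hA'⟩ := exists_localBound_uniform (n := n) (by omega) hp h hq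
      exact ⟨A, hA, fun b _ hb => hA' b hb⟩
  obtain ⟨K, hK, hΓ⟩ := exists_inv_gamma_le
  set D : ℝ≥0∞ := n * (4 * (ENNReal.ofReal K * (A + ENNReal.ofReal 4))) with hD
  have hDt : D ≠ ∞ := by finiteness
  refine ⟨D.toReal + 1, by positivity, fun β hβ hβ1 hγ => ?_⟩
  have hn' : (2 : ℝ) ≤ n := by exact_mod_cast hn
  have hβ0 : 1 / 2 ≤ β := by linarith
  refine filterEstimate_of_localBound hp.le hp' hpq (by linarith) hβ1 hγ hA
    (hloc _ (by linarith) hγ) (by positivity) ?_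
  calc _ ≤ D := by
        rw [hD]
        gcongr
        · exact hΓ _ ⟨by linarith, by linarith⟩
        · exact inv_le_of_inv_le₀ (by norm_num) (by linarith)
    _ = ENNReal.ofReal D.toReal := (ENNReal.ofReal_toReal hDt).symm
    _ ≤ _ := ENNReal.ofReal_le_ofReal (by linarith)

theorem exists_filterEstimate (hp : 1 ≤ p) (hp' : p ≠ ∞) (hpq : p ≤ q) {β : ℝ}
    (hβ : 0 < β) (hβ1 : β < 1) (hγ : gammaExp n p q < β / 2) :
    ∃ C : ℝ, 0 < C ∧ FilterEstimate n p q β C := by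
  set D : ℝ≥0∞ := n * (4 * (ENNReal.ofReal (Real.Gamma (β / 2))⁻¹ *
    (ENNReal.ofReal (β / 2 - gammaExp n p q)⁻¹ + ENNReal.ofReal (β / 2)⁻¹))) with hD
  have hDt : D ≠ ∞ := by finiteness
  refine ⟨D.toReal + 1, by positivity, filterEstimate_of_localBound hp hp' hpq hβ hβ1 hγ
    ENNReal.ofReal_ne_top (localBound_of_lt hp hp' hpq (by linarith) hγ) (by positivity) ?_⟩
  calc _ = ENNReal.ofReal D.toReal := (ENNReal.ofReal_toReal hDt).symm
    _ ≤ _ := ENNReal.ofReal_le_ofReal (by linarith)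

/-! ### Gagliardo seminorm, Sobolev embedding and strong convergence -/

lemma exists_rpow_mul_exp_neg_le (s : ℝ) (hs : 0 ≤ s) :
    ∃ C : ℝ, 0 < C ∧ ∀ r : ℝ, 0 < r → Real.exp (-r) ≤ C * r ^ (-s) := by
  refine ⟨1 + (⌈s⌉₊.factorial : ℝ), by positivity, fun r hr => ?_⟩
  have h1 : r ^ s ≤ (1 + (⌈s⌉₊.factorial : ℝ)) * Real.exp r := by
    have he : 1 ≤ Real.exp r := Real.one_le_exp hr.le
    rcases le_total r 1 with h | h
    · have h2 := Real.rpow_le_one hr.le h hs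
      have : (0 : ℝ) ≤ (⌈s⌉₊.factorial : ℝ) * Real.exp r := by positivity
      linarith
    · have h2 : r ^ s ≤ r ^ ⌈s⌉₊ := by
        rw [← Real.rpow_natCast]; exact Real.rpow_le_rpow_of_exponent_le h (Nat.le_ceil s)
      have h3 := Real.pow_div_factorial_le_exp r hr.le ⌈s⌉₊
      rw [div_le_iff₀ (by positivity)] at h3
      linarith
  rw [Real.exp_neg, Real.rpow_neg hr.le, ← div_eq_mul_inv, inv_eq_one_div,
    div_le_div_iff₀ (Real.exp_pos r) (by positivity), one_mul]
  exact h1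

/-- Polynomial decay of the heat kernel away from the origin. -/
lemma exists_heatKernel_le_rpow {σ : ℝ} (hσ : 0 ≤ σ) :
    ∃ C : ℝ, 0 < C ∧ ∀ t : ℝ, 0 < t → ∀ z : Rn n, z ≠ 0 →
      heatKernel t z ≤ C * t ^ (σ / 2) * ‖z‖ ^ (-((n : ℝ) + σ)) := by
  -- With this power `(|z|²/t)^{-s}` produces exactly `|z|^{-(n+σ)}`, and the remaining power of `t`
  -- is `σ/2`.
  set s := ((n : ℝ) + σ) / 2 with hs
  obtain ⟨C, hC, h⟩ := exists_rpow_mul_exp_neg_le s (by positivity)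
  refine ⟨C * 4 ^ s, by positivity, fun t ht z hz => ?_⟩
  have hz' : 0 < ‖z‖ := norm_pos_iff.2 hz
  have h1 := h ((4 * t)⁻¹ * ‖z‖ ^ 2) (by positivity)
  have h2 : (4 * Real.pi * t) ^ (-((n : ℝ) / 2)) ≤ t ^ (-((n : ℝ) / 2)) := by
    refine Real.rpow_le_rpow_of_nonpos ht ?_ (by linarith [(n.cast_nonneg : (0 : ℝ) ≤ n)])
    nlinarith [Real.pi_gt_three]
  calc heatKernel t z = (4 * Real.pi * t) ^ (-((n : ℝ) / 2)) *
        Real.exp (-((4 * t)⁻¹ * ‖z‖ ^ 2)) := by rw [heatKernel]; congr 2; ring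
    _ ≤ t ^ (-((n : ℝ) / 2)) * (C * ((4 * t)⁻¹ * ‖z‖ ^ 2) ^ (-s)) := by gcongr
    _ = _ := by
        rw [Real.mul_rpow (by positivity) (by positivity), Real.inv_rpow (by positivity),
          ← Real.rpow_neg (by positivity), neg_neg, Real.mul_rpow (by norm_num) ht.le,
          ← Real.rpow_natCast, ← Real.rpow_mul hz'.le]
        have e1 : t ^ (σ / 2) = t ^ (-((n : ℝ) / 2)) * t ^ s := by
          rw [← Real.rpow_add ht]; congr 1; rw [hs]; ring
        have e2 : ((2 : ℕ) : ℝ) * -s = -((n : ℝ) + σ) := by rw [hs]; push_cast; ring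
        rw [e1, e2]; ring

lemma integrable_heat_integrand (hp : 1 ≤ p) (hp' : p ≠ ∞) {t : ℝ} (ht : 0 < t) {V : Rn n → ℂ}
    (hVm : Measurable V) (hV : MemLp V p volume) (x : Rn n) :
    Integrable fun y => (heatKernel t (x - y) : ℂ) * V y := by
  refine ⟨Measurable.aestronglyMeasurable (by fun_prop), ?_⟩
  rw [hasFiniteIntegral_iff_enorm, lintegral_enorm_heat_integrand ht]
  refine (lheat_le_eLpNorm ht hp hp' (by fun_prop) x).trans_lt ?_
  rw [eLpNorm_enorm_comp]
  exact ENNReal.mul_lt_top ENNReal.ofReal_lt_top hV.eLpNorm_lt_top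

/-- The kernel has mass 1, so `V(x)` can be put under the integral. -/
lemma enorm_sub_heat_le (hp : 1 ≤ p) (hp' : p ≠ ∞) {t : ℝ} (ht : 0 < t) {V : Rn n → ℂ}
    (hVm : Measurable V) (hV : MemLp V p volume) (x : Rn n) :
    ‖V x - heat t V x‖ₑ ≤ ∫⁻ y, lheatKernel t (x - y) * ‖V x - V y‖ₑ := by
  have hk : Integrable fun y : Rn n => (heatKernel t (x - y) : ℂ) :=
    ((integrable_heatKernel ht).comp_sub_left x).ofReal
  have h1 : ∫ y : Rn n, (heatKernel t (x - y) : ℂ) = 1 := by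
    rw [integral_complex_ofReal, integral_sub_left_eq_self (fun y => heatKernel t y),
      integral_heatKernel ht, Complex.ofReal_one]
  have h2 : V x - heat t V x = ∫ y, (heatKernel t (x - y) : ℂ) * (V x - V y) := by
    simp_rw [mul_sub]
    rw [integral_sub (hk.mul_const _) (integrable_heat_integrand hp hp' ht hVm hV x),
      integral_mul_const, h1, one_mul, heat]
  rw [h2]
  refine (enorm_integral_le_lintegral_enorm _).trans (lintegral_mono fun y => ?_)
  rw [enorm_mul, enorm_heatKernel ht]

/-- Functions of finite Gagliardo seminorm are approximated by the heat semigroup. -/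
theorem exists_eLpNorm_sub_heat_le (hp : 1 ≤ p) (hp' : p ≠ ∞) {β : ℝ} (hβ : 0 < β)
    {V : Rn n → ℂ} (hVm : Measurable V) (hV : MemLp V p volume)
    (hM : ∫⁻ x, ∫⁻ y, ‖V x - V y‖ₑ ^ p.toReal *
      ENNReal.ofReal (‖x - y‖ ^ (-((n : ℝ) + β * p.toReal))) ≠ ∞) :
    ∃ K : ℝ≥0∞, K ≠ ∞ ∧ ∀ t : ℝ, 0 < t →
      eLpNorm (fun x => V x - heat t V x) p volume ≤ K * ENNReal.ofReal (t ^ (β / 2)) := by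
  have hP := one_le_toReal hp hp'
  set P := p.toReal with hPdef
  have hP0 : 0 < P := by linarith
  set M := ∫⁻ x, ∫⁻ y, ‖V x - V y‖ₑ ^ P * ENNReal.ofReal (‖x - y‖ ^ (-((n : ℝ) + β * P)))
  -- The choice `σ = βp` matches the Gagliardo weight `|x-y|^{-(n+βp)}`.
  obtain ⟨C, hC, hk⟩ := exists_heatKernel_le_rpow (n := n) (σ := β * P) (by positivity)
  refine ⟨(ENNReal.ofReal C * M) ^ (1 / P), ENNReal.rpow_ne_top_of_nonneg (by positivity)
    (ENNReal.mul_ne_top ENNReal.ofReal_ne_top hM), fun t ht => ?_⟩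
  have hpt : ∀ x, ‖V x - heat t V x‖ₑ ^ P ≤ ENNReal.ofReal (C * t ^ (β * P / 2)) *
      ∫⁻ y, ‖V x - V y‖ₑ ^ P * ENNReal.ofReal (‖x - y‖ ^ (-((n : ℝ) + β * P))) := by
    intro x
    calc _ ≤ (∫⁻ y, lheatKernel t (x - y) * ‖V x - V y‖ₑ) ^ P := by
          gcongr; exact enorm_sub_heat_le hp hp' ht hVm hV x
      _ ≤ (∫⁻ y, lheatKernel t (x - y)) ^ (P - 1) *
            ∫⁻ y, lheatKernel t (x - y) * ‖V x - V y‖ₑ ^ P :=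
          lintegral_mul_rpow_le (by fun_prop) (by fun_prop) hP
      _ = ∫⁻ y, lheatKernel t (x - y) * ‖V x - V y‖ₑ ^ P := by
          rw [lintegral_lheatKernel_sub_left ht, ENNReal.one_rpow, one_mul]
      _ ≤ _ := by
          rw [← lintegral_const_mul _ (by fun_prop)]
          refine lintegral_mono fun y => ?_
          -- The kernel bound fails on the diagonal, where the difference `V x - V y` vanishes.
          by_cases hxy : x = y
          · simp [hxy, hP0]
          rw [mul_left_comm, mul_comm (lheatKernel _ _), ← ENNReal.ofReal_mul (by positivity)]
          gcongr
          exact ENNReal.ofReal_le_ofReal (hk t ht _ (sub_ne_zero.2 hxy))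
  rw [eLpNorm_eq_lintegral_rpow_enorm_toReal (one_pos.trans_le hp).ne' hp']
  have hmeas : Measurable fun x => ∫⁻ y, ‖V x - V y‖ₑ ^ P *
      ENNReal.ofReal (‖x - y‖ ^ (-((n : ℝ) + β * P))) :=
    Measurable.lintegral_prod_right' (f := fun z : Rn n × Rn n => ‖V z.1 - V z.2‖ₑ ^ P *
      ENNReal.ofReal (‖z.1 - z.2‖ ^ (-((n : ℝ) + β * P)))) (by fun_prop)
  calc _ ≤ (ENNReal.ofReal (C * t ^ (β * P / 2)) * M) ^ (1 / P) := by
        gcongr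
        exact (lintegral_mono hpt).trans_eq (lintegral_const_mul _ hmeas)
    _ = _ := by
        rw [ENNReal.ofReal_mul hC.le, mul_right_comm, ENNReal.mul_rpow_of_nonneg _ _
          (by positivity), ENNReal.ofReal_rpow_of_nonneg (by positivity) (by positivity),
          ← Real.rpow_mul ht.le]
        congr 3; field_simp

/-- The heat semigroup property on `L^p`. -/
lemma heat_heat_ae_eq (hp : 1 ≤ p) (hp' : p ≠ ∞) {s t : ℝ} (hs : 0 < s) (ht : 0 < t)
    {V : Rn n → ℂ} (hVm : Measurable V) (hV : MemLp V p volume) :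
    heat s (heat t V) =ᵐ[volume] heat (s + t) V := by
  have hm : Measurable (heat t V) := measurable_heat hVm measurable_const measurable_id
  have hL := memLp_heat hp hp' ht hVm hV
  refine ae_eq_of_integral_schwartz_eq hp (memLp_heat hp hp' hs hm hL)
    (memLp_heat hp hp' (add_pos hs ht) hVm hV) fun φ => ?_
  have hφ := dualBdd_schwartz hp hp' φ
  obtain ⟨Φ, hΦ, -⟩ := exists_schwartz_heat hs φ
  rw [integral_heat_mul hp hp' hs hm hL hφ, integral_heat_mul hp hp' (add_pos hs ht) hVm hV hφ,
    ← hΦ, integral_heat_mul hp hp' ht hVm hV (dualBdd_schwartz hp hp' Φ), hΦ,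
    heat_heat_schwartz ht hs, add_comm]

lemma heat_sub (hp : 1 ≤ p) (hp' : p ≠ ∞) {t : ℝ} (ht : 0 < t) {V W : Rn n → ℂ}
    (hVm : Measurable V) (hV : MemLp V p volume) (hWm : Measurable W) (hW : MemLp W p volume)
    (x : Rn n) : heat t (fun y => V y - W y) x = heat t V x - heat t W x := by
  unfold heat
  simp_rw [mul_sub]
  exact integral_sub (integrable_heat_integrand hp hp' ht hVm hV x)
    (integrable_heat_integrand hp hp' ht hWm hW x)

lemma eLpNorm_heat_le (hp : 1 ≤ p) (hp' : p ≠ ∞) (hpq : p ≤ q) {t : ℝ} (ht : 0 < t)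
    {V : Rn n → ℂ} (hVm : Measurable V) :
    eLpNorm (heat t V) q volume ≤ ENNReal.ofReal (t ^ (-gammaExp n p q)) * eLpNorm V p volume := by
  calc _ ≤ eLpNorm (lheat t fun y => ‖V y‖ₑ) q volume :=
        eLpNorm_mono_enorm fun x => by simpa using enorm_heat_le ht V x
    _ ≤ _ := (eLpNorm_lheat_le ht hp hp' hpq (by fun_prop)).trans_eq (by rw [eLpNorm_enorm_comp])

/-- `L^p` bounds for `V - e^{tΔ} V` improve to `L^q` bounds. -/
theorem eLpNorm_sub_heat_le_of_rpow (hp : 1 ≤ p) (hp' : p ≠ ∞) (hpq : p ≤ q) {b : ℝ}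
    (hb : gammaExp n p q < b) {V : Rn n → ℂ} (hVm : Measurable V)
    (hV : MemLp V p volume) {K : ℝ≥0∞} (hK : K ≠ ∞)
    (h : ∀ t : ℝ, 0 < t →
      eLpNorm (fun x => V x - heat t V x) p volume ≤ K * ENNReal.ofReal (t ^ b))
    {a : ℝ} (ha : 0 < a) :
    eLpNorm (fun x => V x - heat a V x) q volume ≤
      K * ENNReal.ofReal (2 ^ (b - gammaExp n p q) - 1)⁻¹ *
        ENNReal.ofReal (a ^ (b - gammaExp n p q)) := by
  have hγ := gammaExp_nonneg (n := n) hp hpq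
  set δ := b - gammaExp n p q with hδdef
  have hδ : 0 < δ := by linarith
  have hm : ∀ t, Measurable (heat t V) := fun t =>
    measurable_heat hVm measurable_const measurable_id
  -- By the semigroup law this difference is `e^{tΔ}(V - e^{tΔ}V)`: the `L^p` rate `t^b` is traded
  -- for `t^{b-γ}` in `L^q`.
  have hstep : ∀ t : ℝ, 0 < t → eLpNorm (fun x => heat t V x - heat (2 * t) V x) q volume ≤
      K * ENNReal.ofReal (t ^ δ) := by
    intro t ht
    have e : (fun x => heat t V x - heat (2 * t) V x) =ᵐ[volume]
        heat t (fun y => V y - heat t V y) := by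
      filter_upwards [heat_heat_ae_eq hp hp' ht ht hVm hV] with x hx
      rw [heat_sub hp hp' ht hVm hV (hm t) (memLp_heat hp hp' ht hVm hV), hx, two_mul]
    rw [eLpNorm_congr_ae e]
    refine (eLpNorm_heat_le hp hp' hpq ht (hVm.sub (hm t))).trans ?_
    refine (mul_le_mul_right (h t ht) _).trans_eq ?_
    rw [mul_left_comm, ← ENNReal.ofReal_mul (by positivity), ← Real.rpow_add ht]
    congr 3; rw [hδdef]; ring
  have h2 : (1 : ℝ) < 2 ^ δ := Real.one_lt_rpow (by norm_num) hδ
  -- The sum `∑_{j≥1} 2^{-jδ}`, fixed by `(L + 1)(a/2)^δ = L a^δ`, so the telescoping induction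
  -- reproduces its own bound.
  set L := (2 ^ δ - 1 : ℝ)⁻¹ with hL
  have hL0 : 0 < L := inv_pos.2 (by linarith)
  have htel : ∀ (k : ℕ) (a : ℝ), 0 < a →
      eLpNorm (fun x => heat (a / 2 ^ k) V x - heat a V x) q volume ≤
        K * ENNReal.ofReal L * ENNReal.ofReal (a ^ δ) := by
    intro k
    induction k with
    | zero => intro a _; simp
    | succ k ih =>
      intro a ha
      have ha2 : 0 < a / 2 := by positivity
      have e : (fun x => heat (a / 2 ^ (k + 1)) V x - heat a V x) =
          (fun x => heat (a / 2 / 2 ^ k) V x - heat (a / 2) V x) +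
            fun x => heat (a / 2) V x - heat (2 * (a / 2)) V x := by
        ext x
        have e1 : a / 2 / 2 ^ k = a / 2 ^ (k + 1) := by field_simp; ring
        have e2 : 2 * (a / 2) = a := by ring
        simp only [Pi.add_apply, e1, e2]; ring
      rw [e]
      refine (eLpNorm_add_le ((hm _).sub (hm _)).aestronglyMeasurable
        ((hm _).sub (hm _)).aestronglyMeasurable (hp.trans hpq)).trans
        ((add_le_add (ih _ ha2) (hstep _ ha2)).trans_eq ?_)
      rw [mul_assoc, mul_assoc, ← mul_add, ← ENNReal.ofReal_mul hL0.le,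
        ← ENNReal.ofReal_mul hL0.le, ← ENNReal.ofReal_add (by positivity) (by positivity)]
      congr 2
      rw [Real.div_rpow ha.le (by norm_num), hL]
      have : (2 : ℝ) ^ δ - 1 ≠ 0 := by linarith
      field_simp
      ring
  have hlim : Tendsto (fun k : ℕ => a / 2 ^ k) atTop (𝓝 0) :=
    tendsto_const_nhds.div_atTop (tendsto_pow_atTop_atTop_of_one_lt (by norm_num))
  have hconv : Tendsto (fun k : ℕ => eLpNorm (heat (a / 2 ^ k) V - V) p volume) atTop (𝓝 0) := by
    have hb0 : 0 < b := by linarith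
    have h3 : Tendsto (fun k : ℕ => K * ENNReal.ofReal ((a / 2 ^ k) ^ b)) atTop (𝓝 0) := by
      have h4 := (hlim.rpow_const (p := b) (Or.inr hb0.le))
      rw [Real.zero_rpow hb0.ne'] at h4
      have h5 := ENNReal.Tendsto.const_mul (a := K) (ENNReal.tendsto_ofReal h4) (Or.inr hK)
      simpa using h5
    refine tendsto_of_tendsto_of_tendsto_of_le_of_le tendsto_const_nhds h3 (fun _ => zero_le)
      fun k => ?_
    beta_reduce
    rw [eLpNorm_sub_comm]
    exact h _ (by positivity)
  -- Convergence in `L^p` gives a subsequence converging almost everywhere, along which Fatou's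
  -- lemma passes the uniform `L^q` bound to the limit.
  obtain ⟨ns, -, hae⟩ := (tendstoInMeasure_of_tendsto_eLpNorm (one_pos.trans_le hp).ne'
    (fun k => (hm _).aestronglyMeasurable) hVm.aestronglyMeasurable hconv).exists_seq_tendsto_ae
  refine (Lp.eLpNorm_lim_le_liminf_eLpNorm
    (f := fun j x => heat (a / 2 ^ ns j) V x - heat a V x)
    (fun j => ((hm _).sub (hm _)).aestronglyMeasurable) _ ?_).trans ?_
  · filter_upwards [hae] with x hx using hx.sub_const _
  · refine liminf_le_of_le (by isBoundedDefault) fun c hc => ?_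
    obtain ⟨j, hj⟩ := hc.exists
    exact hj.trans (htel _ a ha)

/-- The definition of `MemFracSobolev` as an iterated integral for a Borel representative of one
component; the weight comes from `(n/p + β)p = n + βp`. -/
lemma lintegral_gagliardo_ne_top (hp : 1 ≤ p) (hp' : p ≠ ∞) {β : ℝ} {v : Rn n → Rn n}
    (hv : MemFracSobolev β p v) (i : Fin n) {V : Rn n → ℂ} (hVm : Measurable V)
    (hVe : component v i =ᵐ[volume] V) :
    ∫⁻ x, ∫⁻ y, ‖V x - V y‖ₑ ^ p.toReal *
      ENNReal.ofReal (‖x - y‖ ^ (-((n : ℝ) + β * p.toReal))) ≠ ∞ := by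
  have hP := one_le_toReal hp hp'
  have h := hv.2.eLpNorm_ne_top
  set P := p.toReal
  have hP0 : 0 < P := by linarith
  rw [← lt_top_iff_ne_top, eLpNorm_lt_top_iff_lintegral_rpow_enorm_lt_top
    (one_pos.trans_le hp).ne' hp'] at h
  have hm : Measurable fun z : Rn n × Rn n => ‖V z.1 - V z.2‖ₑ ^ P *
      ENNReal.ofReal (‖z.1 - z.2‖ ^ (-((n : ℝ) + β * P))) := by fun_prop
  rw [← lintegral_prod (fun z : Rn n × Rn n => ‖V z.1 - V z.2‖ₑ ^ P *
      ENNReal.ofReal (‖z.1 - z.2‖ ^ (-((n : ℝ) + β * P)))) hm.aemeasurable]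
  refine ne_top_of_le_ne_top h.ne (lintegral_mono_ae ?_)
  have h1 := (Measure.quasiMeasurePreserving_fst (μ := (volume : Measure (Rn n)))
    (ν := (volume : Measure (Rn n)))).ae_eq_comp hVe
  have h2 := (Measure.quasiMeasurePreserving_snd (μ := (volume : Measure (Rn n)))
    (ν := (volume : Measure (Rn n)))).ae_eq_comp hVe
  filter_upwards [h1, h2] with z hz1 hz2
  simp only [Function.comp_apply] at hz1 hz2
  have e1 : ‖V z.1 - V z.2‖ₑ ≤ ENNReal.ofReal ‖v z.1 - v z.2‖ := by
    rw [← hz1, ← hz2, ofReal_norm]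
    refine le_trans (le_of_eq ?_) (enorm_component_le (fun z : Rn n => z) i (v z.1 - v z.2))
    simp [component]
  have e2 : ENNReal.ofReal (‖z.1 - z.2‖ ^ (-((n : ℝ) + β * P))) =
      ENNReal.ofReal ((‖z.1 - z.2‖ ^ ((n : ℝ) / P + β))⁻¹) ^ P := by
    rw [ENNReal.ofReal_rpow_of_nonneg (by positivity) hP0.le, Real.inv_rpow (by positivity),
      ← Real.rpow_mul (norm_nonneg _), Real.rpow_neg (norm_nonneg _)]
    congr 3; field_simp
  rw [e2, ← ENNReal.mul_rpow_of_nonneg _ _ hP0.le]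
  gcongr
  rw [← ofReal_norm (_ / _), Real.norm_of_nonneg (by positivity), div_eq_mul_inv ‖_‖,
    ENNReal.ofReal_mul (norm_nonneg _)]
  gcongr

lemma exists_eLpNorm_component_sub_heat_le (hp : 1 ≤ p) (hp' : p ≠ ∞) (hpq : p ≤ q) {β : ℝ}
    (hβ : 0 < β) (hγ : gammaExp n p q < β / 2) {v : Rn n → Rn n} (hv : MemFracSobolev β p v)
    (i : Fin n) : ∃ K : ℝ≥0∞, K ≠ ∞ ∧ ∀ a : ℝ, 0 < a →
      eLpNorm (fun x => component v i x - heat a (component v i) x) q volume ≤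
        K * ENNReal.ofReal (a ^ (β / 2 - gammaExp n p q)) := by
  have hVp := memLp_component hv.1 i
  obtain ⟨V, hVm, hVe⟩ : ∃ V : Rn n → ℂ, Measurable V ∧ component v i =ᵐ[volume] V :=
    ⟨hVp.1.aemeasurable.mk, hVp.1.aemeasurable.measurable_mk, hVp.1.aemeasurable.ae_eq_mk⟩
  have hV := (memLp_congr_ae hVe).1 hVp
  obtain ⟨K, hK, h⟩ := exists_eLpNorm_sub_heat_le hp hp' hβ hVm hV
    (lintegral_gagliardo_ne_top hp hp' hv i hVm hVe)
  refine ⟨_, ENNReal.mul_ne_top hK ENNReal.ofReal_ne_top, fun a ha => le_trans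
    (eLpNorm_congr_ae ?_).le (eLpNorm_sub_heat_le_of_rpow hp hp' hpq hγ hVm hV hK h ha)⟩
  filter_upwards [hVe] with x hx
  rw [hx, heat_congr_ae a hVe]

/-- The Sobolev embedding `W^{β,p} ⊂ L^q` below the critical exponent. -/
theorem memLp_of_memFracSobolev (hp : 1 ≤ p) (hp' : p ≠ ∞) (hpq : p ≤ q) {β : ℝ}
    (hβ : 0 < β) (hγ : gammaExp n p q < β / 2) {v : Rn n → Rn n} (hv : MemFracSobolev β p v) :
    MemLp v q volume := by
  refine ⟨hv.1.1, ?_⟩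
  have hcomp : ∀ i, eLpNorm (component v i) q volume ≠ ∞ := by
    intro i
    obtain ⟨K, hK, h⟩ := exists_eLpNorm_component_sub_heat_le hp hp' hpq hβ hγ hv i
    have hVp := memLp_component hv.1 i
    obtain ⟨V, hVm, hVe⟩ : ∃ V : Rn n → ℂ, Measurable V ∧ component v i =ᵐ[volume] V :=
      ⟨hVp.1.aemeasurable.mk, hVp.1.aemeasurable.measurable_mk, hVp.1.aemeasurable.ae_eq_mk⟩
    have hm : AEStronglyMeasurable (heat 1 (component v i)) volume := by
      rw [heat_congr_ae 1 hVe]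
      exact (measurable_heat hVm measurable_const measurable_id).aestronglyMeasurable
    have h1 := h 1 one_pos
    have h2 := eLpNorm_heat_le (q := q) hp hp' hpq one_pos hVm
    rw [← heat_congr_ae 1 hVe, ← eLpNorm_congr_ae hVe] at h2
    -- At time 1 the difference is in `L^q` by the Gagliardo bound and `e^{Δ}v` by smoothing.
    have e : component v i = (fun x => component v i x - heat 1 (component v i) x) +
        heat 1 (component v i) := by ext x; simp
    rw [e]
    refine ne_top_of_le_ne_top (ENNReal.add_ne_top.2 ⟨?_, ?_⟩)
      (eLpNorm_add_le (hVp.1.sub hm) hm (hp.trans hpq))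
    · exact ne_top_of_le_ne_top (ENNReal.mul_ne_top hK ENNReal.ofReal_ne_top) h1
    · exact ne_top_of_le_ne_top (ENNReal.mul_ne_top ENNReal.ofReal_ne_top hVp.eLpNorm_ne_top) h2
  refine (eLpNorm_le_of_component (hp.trans hpq) (fun i => (memLp_component hv.1 i).1)
    (B := ∑ i, eLpNorm (component v i) q volume) fun i =>
      Finset.single_le_sum (f := fun i => eLpNorm (component v i) q volume)
        (fun _ _ => zero_le) (Finset.mem_univ i)).trans_lt ?_
  exact ENNReal.mul_lt_top (ENNReal.natCast_lt_top n)
    (ENNReal.sum_lt_top.2 fun i _ => (hcomp i).lt_top)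

/-- The rate of convergence of the Helmholtz filter on `W^{β,p}`. -/
theorem exists_eLpNorm_helmholtz_sub_le (hp : 1 ≤ p) (hp' : p ≠ ∞) (hpq : p ≤ q) {β : ℝ}
    (hβ : 0 < β) (hβ1 : β < 1) (hγ : gammaExp n p q < β / 2) {v : Rn n → Rn n}
    (hv : MemFracSobolev β p v) :
    ∃ K : ℝ≥0∞, K ≠ ∞ ∧ ∀ (α : ℝ) (u : Rn n → Rn n), 0 < α → IsHelmholtzSolution p α v u →
      eLpNorm (u - v) q volume ≤
        K * ENNReal.ofReal (α ^ (2 * (β / 2 - gammaExp n p q))) := by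
  choose K hK h using exists_eLpNorm_component_sub_heat_le hp hp' hpq hβ hγ hv
  have hS : ∑ i, K i ≠ ∞ := (ENNReal.sum_lt_top.2 fun i _ => (hK i).lt_top).ne
  have hγ0 := gammaExp_nonneg (n := n) hp hpq
  refine ⟨n * (4 * ∑ i, K i), by finiteness, fun α u hα hu => ?_⟩
  refine (eLpNorm_sub_le_of_heat hp hp' hpq hα
    (δ := β / 2 - gammaExp n p q) (by linarith) (by linarith) hv.1 hu hS
    fun i a ha => (h i a ha).trans ?_).trans_eq (by ring)
  gcongr
  exact Finset.single_le_sum (f := K) (fun _ _ => zero_le) (Finset.mem_univ i)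

/-- Strong convergence of the Helmholtz filter in `L^q`. -/
theorem tendsto_eLpNorm_helmholtz_sub (hp : 1 ≤ p) (hp' : p ≠ ∞) (hpq : p ≤ q) {β : ℝ}
    (hβ : 0 < β) (hβ1 : β < 1) (hγ : gammaExp n p q < β / 2) {v : Rn n → Rn n}
    (hv : MemFracSobolev β p v) {α : ℕ → ℝ} {u : ℕ → Rn n → Rn n} (hα : ∀ i, 0 < α i)
    (hα0 : Tendsto α atTop (𝓝 0)) (hu : ∀ i, IsHelmholtzSolution p (α i) v (u i)) :
    MemLp v q volume ∧ (∀ i, MemLp (u i) q volume) ∧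
      Tendsto (fun i => eLpNorm (u i - v) q volume) atTop (𝓝 0) := by
  have hvq := memLp_of_memFracSobolev hp hp' hpq hβ hγ hv
  obtain ⟨K, hK, h⟩ := exists_eLpNorm_helmholtz_sub_le hp hp' hpq hβ hβ1 hγ hv
  refine ⟨hvq, fun i => ?_, ?_⟩
  · have hd : MemLp (u i - v) q volume := ⟨(hu i).1.1.sub hv.1.1,
      (h _ _ (hα i) (hu i)).trans_lt (ENNReal.mul_lt_top hK.lt_top ENNReal.ofReal_lt_top)⟩
    simpa using hd.add hvq
  · set δ := β / 2 - gammaExp n p q with hδ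
    have hδ0 : 0 < 2 * δ := by linarith
    have h1 := hα0.rpow_const (p := 2 * δ) (Or.inr hδ0.le)
    rw [Real.zero_rpow hδ0.ne'] at h1
    have h2 := ENNReal.Tendsto.const_mul (a := K) (ENNReal.tendsto_ofReal h1) (Or.inr hK)
    rw [ENNReal.ofReal_zero, mul_zero] at h2
    exact tendsto_of_tendsto_of_tendsto_of_le_of_le tendsto_const_nhds h2 (fun _ => zero_le)
      fun i => h _ _ (hα i) (hu i)

end HelmholtzFilter

end

theorem proposition5p3 (n : ℕ) (hn : n = 2 ∨ n = 3) (p q : ℝ≥0∞)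
    (hp : 1 ≤ p) (hp' : p ≠ ∞) (hpq : p ≤ q) :
    -- the estimate, with a constant `C(n,p,q)`
    (1 < p → q ≠ ∞ →
      ∃ C : ℝ, 0 < C ∧ ∀ β : ℝ, (n : ℝ) / 4 ≤ β → β < 1 →
        HelmholtzFilter.gammaExp n p q < β / 2 →
          HelmholtzFilter.FilterEstimate n p q β C) ∧
    -- the end-points `p = 1` and `q = ∞` included
    (∀ β : ℝ, (n : ℝ) / 4 ≤ β → β < 1 → HelmholtzFilter.gammaExp n p q < β / 2 →
      ∃ C : ℝ, 0 < C ∧ HelmholtzFilter.FilterEstimate n p q β C) ∧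
    -- strong convergence in `L^q`
    (∀ β : ℝ, (n : ℝ) / 4 ≤ β → β < 1 → (p⁻¹).toReal - (q⁻¹).toReal < β / n →
      ∀ (v : HelmholtzFilter.Rn n → HelmholtzFilter.Rn n) (α : ℕ → ℝ)
        (u : ℕ → HelmholtzFilter.Rn n → HelmholtzFilter.Rn n),
        HelmholtzFilter.MemFracSobolev β p v →
        (∀ i, 0 < α i) → Tendsto α atTop (𝓝 0) →
        (∀ i, HelmholtzFilter.IsHelmholtzSolution p (α i) v (u i)) →
          MemLp v q volume ∧ (∀ i, MemLp (u i) q volume) ∧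
            Tendsto (fun i => eLpNorm (u i - v) q volume) atTop (𝓝 0)) := by
  have hn2 : 2 ≤ n := by omega
  have hn' : (2 : ℝ) ≤ n := by exact_mod_cast hn2
  refine ⟨fun hp1 hq => HelmholtzFilter.exists_filterEstimate_uniform hn2 hp1 hp' hpq hq,
    fun β hβ hβ1 hγ => HelmholtzFilter.exists_filterEstimate hp hp' hpq (by linarith) hβ1 hγ,
    fun β hβ hβ1 hγ v α u hv hα hα0 hu => ?_⟩
  refine HelmholtzFilter.tendsto_eLpNorm_helmholtz_sub hp hp' hpq (by linarith) hβ1 ?_ hv hα hα0 hu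
  -- The hypothesis `1/p - 1/q < β/n` is `γ < β/2` multiplied by `2/n`.
  rw [lt_div_iff₀ (by linarith)] at hγ
  rw [HelmholtzFilter.gammaExp]
  linarith
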